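/- Let $G=(V,E,w)$ be an undirected graph with vertex set $V=\{0,\dots,n-1\}$, with integer edge weights in the range $[1,M]$ ($M\ge 1$), and with a source vertex $s$. For a target $t\in V$ and an edge $e\in E$ (a vertex $v\in V$), let $d(s,t,e)$ (respectively $d(s,t,v)$) be the length of a shortest path from $s$ to $t$ in $G$ that does not use $e$ (that avoids $v$); it is $\infty$ if there is no such path, in particular $d(s,t,v)=\infty$ if $v\in\{s,t\}$. A Single-Source distance sensitivity oracle (Single-Source DSO) for edge (vertex) failures is a data structure that answers every query $(t,e)$ with $t\in V$, $e\in E$ (every query $(t,v)$ with $t,v\in V$) by returning $d(s,t,e)$ (respectively $d(s,t,v)$). The model is the word RAM with words of $b$ bits (arithmetic, comparisons and indirect memory access on words, each at unit cost), where $b\ge k\log_2(n+M+1)$ for an absolute constant $k$; in particular $b=O(\log n)$ bits suffice if $M$ is polynomial in $n$. Space is the number of words that the finished data structure occupies. The preprocessing algorithm is given $n$, $M$ and $s$, and has unit-cost access to a shortest path tree $T_s$ of $G$ rooted in $s$ (the parent of each vertex and the weight of the tree edge to it; $T_s$ spans the vertices that are reachable from $s$) and to the values $d(s,t,e)$ for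 all $t\in V$ and all edges $e$ of $T_s$ (respectively, for vertex failures, to the values $d(s,t,v)$ for all $t,v\in V$). It has no other access to $G$; the query algorithm sees only the data structure and the query, an edge being given by its two endpoints in either order. Lemma. There is a deterministic preprocessing algorithm that in time $O(n^2)$ builds a Single-Source DSO for edge failures taking $O(\min\{M^{1/3}n^{5/3},\,n^2\})$ space and having constant query time. The same holds for vertex failures. The algorithms and the constants hidden in the $O$-notation, in the query time and in $k$ are absolute: they depend on none of $n$, $M$, $G$, $s$, $T_s$, $b$. -/

import Mathlib

/-! ### Replacement distances in weighted undirected graphs -/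

namespace SSDSO

/-- The weight of a walk: the sum of the weights of its edges. -/
def walkWeight {V : Type} {G : SimpleGraph V} (wt : Sym2 V → ℕ) {s t : V} (p : G.Walk s t) : ℕ :=
  (p.edges.map wt).sum

/-- The distance `d(s,t)` (`⊤` if `t` cannot be reached from `s`). -/
noncomputable def sdist {V : Type} (G : SimpleGraph V) (wt : Sym2 V → ℕ) (s t : V) : ℕ∞ :=
  ⨅ p : G.Walk s t, (walkWeight wt p : ℕ∞)

/-- The replacement distance `d(s,t,e)`: the least weight of an `s`-`t`-walk of `G` that does not
use the edge `e` (`⊤` if there is none). -/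
noncomputable def edgeReplDist {V : Type} (G : SimpleGraph V) (wt : Sym2 V → ℕ) (s t : V)
    (e : Sym2 V) : ℕ∞ :=
  ⨅ (p : G.Walk s t) (_ : e ∉ p.edges), (walkWeight wt p : ℕ∞)

/-- The replacement distance `d(s,t,v)`: the least weight of an `s`-`t`-walk of `G` that does not
visit the vertex `v` (`⊤` if there is none, in particular if `v = s` or `v = t`). -/
noncomputable def vertexReplDist {V : Type} (G : SimpleGraph V) (wt : Sym2 V → ℕ) (s t : V)
    (v : V) : ℕ∞ :=
  ⨅ (p : G.Walk s t) (_ : v ∉ p.support), (walkWeight wt p : ℕ∞)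

/-- `par` is the parent function of a shortest path tree of `G` rooted in `s`: the vertices with a
parent are the vertices other than `s` that can be reached from `s`, and the edge to the parent is
the last edge of a shortest path from `s`. As edge weights are positive, following the parents
leads to `s` along a shortest path. -/
structure IsShortestPathTree {V : Type} (G : SimpleGraph V) (wt : Sym2 V → ℕ) (s : V)
    (par : V → Option V) : Prop where
  root : par s = none
  isSome_iff : ∀ t, t ≠ s → ((par t).isSome ↔ G.Reachable s t)
  adj : ∀ t u, par t = some u → G.Adj u t
  dist_eq : ∀ t u, par t = some u → sdist G wt s t = sdist G wt s u + (wt s(u, t) : ℕ∞)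

/-! ### A word RAM with an oracle

Programs are structured; there are registers `0, 1, 2, …` (a program uses finitely many of them) and
an indirectly addressed memory. All contents are words of `w` bits, that is, natural numbers below
`2 ^ w`. Every elementary operation, every test and every call of the oracle costs one step. -/

/-- Arithmetic operations and comparisons on words. -/
inductive Op
  | add | sub | mul | div | mod | lt | eq

/-- Operations on words of `w` bits; `add`, `sub` and `mul` are taken modulo `2 ^ w`. -/
def Op.eval (w : ℕ) : Op → ℕ → ℕ → ℕ
  | .add, a, b => (a + b) % 2 ^ w
  | .sub, a, b => (a + 2 ^ w - b) % 2 ^ w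
  | .mul, a, b => (a * b) % 2 ^ w
  | .div, a, b => a / b
  | .mod, a, b => a % b
  | .lt, a, b => if a < b then 1 % 2 ^ w else 0
  | .eq, a, b => if a = b then 1 % 2 ^ w else 0

/-- The kinds of questions that can be put to the oracle: the parent of a vertex in the tree, the
weight of the tree edge to the parent, a replacement distance. -/
inductive Req
  | parent | weight | replDist

/-- An oracle answers a question with two arguments by a number. -/
abbrev Oracle := Req → ℕ → ℕ → ℕ

/-- The trivial oracle, which gives no information. -/
def noOracle : Oracle := fun _ _ _ => 0

/-- Programs. Below, `r i` is the content of register `i`. -/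
inductive Prog
  /-- do nothing -/
  | skip
  /-- `r d := c` -/
  | const (d c : ℕ)
  /-- `r d := r a` -/
  | move (d a : ℕ)
  /-- `r d := op (r a) (r b)` -/
  | op (o : Op) (d a b : ℕ)
  /-- `r d := mem (r a)` -/
  | load (d a : ℕ)
  /-- `mem (r a) := r b` -/
  | store (a b : ℕ)
  /-- `r d :=` the answer of the oracle to the question `q` with arguments `r a`, `r b` -/
  | ask (q : Req) (d a b : ℕ)
  /-- sequential composition -/
  | seq (p₁ p₂ : Prog)
  /-- `if r a ≠ 0 then p₁ else p₂` -/
  | ite (a : ℕ) (p₁ p₂ : Prog)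
  /-- `while r a ≠ 0 do p` -/
  | loop (a : ℕ) (p : Prog)

/-- The contents of the registers and of the memory. -/
structure State where
  reg : ℕ → ℕ
  mem : ℕ → ℕ

/-- The state with given contents of the first registers and of the first memory cells, and zeros
elsewhere. -/
def State.init (args cells : List ℕ) : State where
  reg i := args.getD i 0
  mem a := cells.getD a 0

/-- Set register `d` to the word `x`. -/
def State.setReg (σ : State) (d x : ℕ) : State :=
  { σ with reg := Function.update σ.reg d x }

/-- Set the memory cell `a` to the word `x`. -/
def State.setMem (σ : State) (a x : ℕ) : State :=
  { σ with mem := Function.update σ.mem a x }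

/-- The words in the memory cells `0, …, r 0 - 1`. -/
def State.output (σ : State) : List ℕ :=
  (List.range (σ.reg 0)).map σ.mem

/-- `Exec w O p σ σ' T`: with words of `w` bits and the oracle `O`, the program `p` started in the
state `σ` halts in the state `σ'` after exactly `T` steps. -/
inductive Exec (w : ℕ) (O : Oracle) : Prog → State → State → ℕ → Prop
  | skip (σ : State) : Exec w O .skip σ σ 1
  | const (d c : ℕ) (σ : State) : Exec w O (.const d c) σ (σ.setReg d (c % 2 ^ w)) 1
  | move (d a : ℕ) (σ : State) : Exec w O (.move d a) σ (σ.setReg d (σ.reg a)) 1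
  | op (o : Op) (d a b : ℕ) (σ : State) :
      Exec w O (.op o d a b) σ (σ.setReg d (o.eval w (σ.reg a) (σ.reg b))) 1
  | load (d a : ℕ) (σ : State) : Exec w O (.load d a) σ (σ.setReg d (σ.mem (σ.reg a))) 1
  | store (a b : ℕ) (σ : State) : Exec w O (.store a b) σ (σ.setMem (σ.reg a) (σ.reg b)) 1
  | ask (q : Req) (d a b : ℕ) (σ : State) :
      Exec w O (.ask q d a b) σ (σ.setReg d (O q (σ.reg a) (σ.reg b) % 2 ^ w)) 1
  | seq (p₁ p₂ : Prog) (σ σ₁ σ₂ : State) (T₁ T₂ : ℕ) :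
      Exec w O p₁ σ σ₁ T₁ → Exec w O p₂ σ₁ σ₂ T₂ → Exec w O (.seq p₁ p₂) σ σ₂ (T₁ + T₂)
  | ite_true (a : ℕ) (p₁ p₂ : Prog) (σ σ' : State) (T : ℕ) :
      σ.reg a ≠ 0 → Exec w O p₁ σ σ' T → Exec w O (.ite a p₁ p₂) σ σ' (T + 1)
  | ite_false (a : ℕ) (p₁ p₂ : Prog) (σ σ' : State) (T : ℕ) :
      σ.reg a = 0 → Exec w O p₂ σ σ' T → Exec w O (.ite a p₁ p₂) σ σ' (T + 1)
  | loop_done (a : ℕ) (p : Prog) (σ : State) :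
      σ.reg a = 0 → Exec w O (.loop a p) σ σ 1
  | loop_step (a : ℕ) (p : Prog) (σ σ₁ σ₂ : State) (T₁ T₂ : ℕ) :
      σ.reg a ≠ 0 → Exec w O p σ σ₁ T₁ → Exec w O (.loop a p) σ₁ σ₂ T₂ →
      Exec w O (.loop a p) σ σ₂ (T₁ + T₂ + 1)

/-- Programs are deterministic: the final state and the number of steps are unique. -/
theorem Exec.deterministic {w : ℕ} {O : Oracle} {p : Prog} {σ σ₁ σ₂ : State} {T₁ T₂ : ℕ}
    (h₁ : Exec w O p σ σ₁ T₁) (h₂ : Exec w O p σ σ₂ T₂) : σ₁ = σ₂ ∧ T₁ = T₂ := by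
  induction h₁ generalizing σ₂ T₂ with
  | seq p₁ p₂ σ τ₁ τ₂ U₁ U₂ _ _ ih₁ ih₂ =>
    cases h₂ with
    | seq _ _ _ ρ₁ ρ₂ W₁ W₂ k₁ k₂ =>
      obtain ⟨rfl, rfl⟩ := ih₁ k₁
      obtain ⟨rfl, rfl⟩ := ih₂ k₂
      exact ⟨rfl, rfl⟩
  | ite_true a p₁ p₂ σ τ U h _ ih =>
    cases h₂ with
    | ite_true _ _ _ _ _ _ _ k => obtain ⟨rfl, rfl⟩ := ih k; exact ⟨rfl, rfl⟩
    | ite_false _ _ _ _ _ _ h0 k => exact absurd h0 h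
  | ite_false a p₁ p₂ σ τ U h _ ih =>
    cases h₂ with
    | ite_true _ _ _ _ _ _ h0 k => exact absurd h h0
    | ite_false _ _ _ _ _ _ _ k => obtain ⟨rfl, rfl⟩ := ih k; exact ⟨rfl, rfl⟩
  | loop_done a p σ h =>
    cases h₂ with
    | loop_done => exact ⟨rfl, rfl⟩
    | loop_step _ _ _ _ _ _ _ h0 => exact absurd h h0
  | loop_step a p σ τ₁ τ₂ U₁ U₂ h _ _ ih₁ ih₂ =>
    cases h₂ with
    | loop_done _ _ _ h0 => exact absurd h0 h
    | loop_step _ _ _ ρ₁ ρ₂ W₁ W₂ _ k₁ k₂ =>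
      obtain ⟨rfl, rfl⟩ := ih₁ k₁
      obtain ⟨rfl, rfl⟩ := ih₂ k₂
      exact ⟨rfl, rfl⟩
  | _ => cases h₂; exact ⟨rfl, rfl⟩

/-! ### The input oracles -/

/-- A distance as a word: `⊤` is the word all of whose bits are one. -/
noncomputable def encDist (w : ℕ) (d : ℕ∞) : ℕ :=
  if d = ⊤ then 2 ^ w - 1 else d.toNat

/-- The parent of `c` in the tree; `n` stands for "no parent". -/
def parentAnswer {n : ℕ} (par : Fin n → Option (Fin n)) (c : ℕ) : ℕ :=
  if h : c < n then (par ⟨c, h⟩).elim n Fin.val else 0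

/-- The weight of the tree edge between `c` and its parent; `0` if there is none. -/
def weightAnswer {n : ℕ} (wt : Sym2 (Fin n) → ℕ) (par : Fin n → Option (Fin n)) (c : ℕ) : ℕ :=
  if h : c < n then (par ⟨c, h⟩).elim 0 (fun u => wt s(u, ⟨c, h⟩)) else 0

/-- Access to the tree and to the replacement distances `d(s,t,e)` for the edges `e` of the tree. A
tree edge is named by its lower endpoint `c`, that is, `e = {par c, c}`. Meaningless questions are
answered by `0`. -/
noncomputable def edgeOracle (w : ℕ) {n : ℕ} (G : SimpleGraph (Fin n)) (wt : Sym2 (Fin n) → ℕ)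
    (s : Fin n) (par : Fin n → Option (Fin n)) : Oracle
  | .parent, c, _ => parentAnswer par c
  | .weight, c, _ => weightAnswer wt par c
  | .replDist, t, c =>
      if h : t < n ∧ c < n then
        (par ⟨c, h.2⟩).elim 0
          (fun u => encDist w (edgeReplDist G wt s ⟨t, h.1⟩ s(u, ⟨c, h.2⟩)))
      else 0

/-- Access to the tree and to the replacement distances `d(s,t,v)` for the vertices `v`.
Meaningless questions are answered by `0`. -/
noncomputable def vertexOracle (w : ℕ) {n : ℕ} (G : SimpleGraph (Fin n)) (wt : Sym2 (Fin n) → ℕ)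
    (s : Fin n) (par : Fin n → Option (Fin n)) : Oracle
  | .parent, c, _ => parentAnswer par c
  | .weight, c, _ => weightAnswer wt par c
  | .replDist, t, v =>
      if h : t < n ∧ v < n then encDist w (vertexReplDist G wt s ⟨t, h.1⟩ ⟨v, h.2⟩) else 0

/-- The space bound `min {M^(1/3) n^(5/3), n^2}`. -/
noncomputable def spaceBound (n M : ℕ) : ℝ :=
  min ((M : ℝ) ^ (1 / 3 : ℝ) * (n : ℝ) ^ (5 / 3 : ℝ)) ((n : ℝ) ^ 2)

end SSDSO

/-! A failure off the tree path from `s` to `t` leaves the distance unchanged, so let the failure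
sit at depth `i` on that path. A tree edge is named by its lower endpoint; edge and vertex failures
then become two instances of one predicate, `FailsAt`, and share one proof.

Fix `r` and put `L = r * r`. The vertices whose depth has the least frequent residue `ρ` modulo `L`
are the pivots; there are at most `n / L` of them. Each pivot stores the replacement distances for
all its ancestors, and each vertex those for the lowest `L` vertices of its path. For a failure
higher up, let `x` be the lowest pivot on the path to `t`; it lies below the failure. Routing
through `x` gives a walk of length `d(s,x,f) + d(x,t)` (`via`). If this is not optimal, an optimal
replacement path meets the tree path nowhere from the failure down to `x`
(`Geodesic.not_mem_support`), so it also survives every failure in that range, and the replacement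
distances there are no larger (`Geodesic.avoidDist_mono`). Hence the running minimum `far` of the
distances of this second kind is never too small, and `min` of `via` and `far` is the answer
(`Models.min_via_far`).

The number `K` of drops of `far` satisfies `K ^ 2 = O(n * M)` (`Geodesic.card_sq_le`). At each drop,
the part of an optimal replacement path after its last vertex on the path down to `x` is a detour
that starts between the preceding drop and this one. The values at the drops are integers that
decrease strictly and stay at least `d(s,t)`, so those in the first half exceed `d(s,t)` by about `K
/ 2`. If two such detours met early, following one and returning along the other would bypass the
upper failure too cheaply, as a step costs at most `M`. So about `K / 4` detours have pairwise
disjoint initial parts of about `K / (4 * M)` vertices each, all among `n` vertices.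

An array of length `O(n)` with `K` changes is cut into blocks of length `r`, and a block is stored
only if it differs from its predecessor. The directory of pointers changes at most `2 * K` times and
is compressed once more in the same way (`compress_spec`, `farTable_spec`). Access takes three
reads, and the space is `n / r ^ 2 + O(r * K + r)`. For the largest `r` with `r ^ 6 * M ≤ n` (or `r
= 1`) one has `r ^ 3 * K = O(n)`, so every contribution to the total is `O(n ^ 2 / r ^ 2)`, which is
`O(M ^ (1/3) * n ^ (5/3))` and at most `O(n ^ 2)`.

On the machine side, `wp` is a weakest-precondition calculus with a clock, `Inp` describes the input
by numbers only, and `Models` ties these numbers to a graph. -/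

namespace SSDSO

/-! ### Expressions, structured statements and their weakest preconditions -/

/-- Expressions over registers and memory. -/
inductive Ex
  | c (k : ℕ)
  | r (i : ℕ)
  | bin (o : Op) (a b : Ex)
  | ld (a : Ex)

namespace Ex

instance : Add Ex := ⟨.bin .add⟩
instance : Sub Ex := ⟨.bin .sub⟩
instance : Mul Ex := ⟨.bin .mul⟩
instance : Div Ex := ⟨.bin .div⟩
instance : Mod Ex := ⟨.bin .mod⟩

/-- Comparison `a < b`. -/
def lt (a b : Ex) : Ex := .bin .lt a b

/-- Comparison `a = b`. -/
def eq (a b : Ex) : Ex := .bin .eq a b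

/-- The value of an expression on words of `w` bits. -/
def eval (w : ℕ) (σ : State) : Ex → ℕ
  | c k => k % 2 ^ w
  | r i => σ.reg i
  | bin o a b => o.eval w (a.eval w σ) (b.eval w σ)
  | ld a => σ.mem (a.eval w σ)

/-- The number of steps of the code of an expression. -/
def cost : Ex → ℕ
  | c _ => 1
  | r _ => 1
  | bin _ a b => a.cost + (b.cost + 1)
  | ld a => a.cost + 1

/-- All registers of the expression are below `32`. -/
def ok : Ex → Bool
  | c _ => true
  | r i => decide (i < 32)
  | bin _ a b => a.ok && b.ok
  | ld a => a.ok

/-- Code that evaluates an expression into register `d`, using no register below `d`. -/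
def code (d : ℕ) : Ex → Prog
  | c k => .const d k
  | r i => .move d i
  | bin o a b => .seq (a.code d) (.seq (b.code (d + 1)) (.op o d d (d + 1)))
  | ld a => .seq (a.code d) (.load d d)

end Ex

/-- Equality of states up to the registers `32, 33, …`. -/
def State.Sim (σ τ : State) : Prop :=
  σ.mem = τ.mem ∧ ∀ i < 32, σ.reg i = τ.reg i

theorem State.Sim.refl (σ : State) : σ.Sim σ := ⟨rfl, fun _ _ => rfl⟩

theorem Ex.eval_sim {w : ℕ} {σ τ : State} (h : σ.Sim τ) :
    ∀ e : Ex, e.ok = true → e.eval w σ = e.eval w τ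
  | .c _, _ => rfl
  | .r i, hi => h.2 i (by simpa [ok] using hi)
  | .bin o a b, hi => by
      simp only [ok, Bool.and_eq_true] at hi
      simp only [eval, eval_sim h a hi.1, eval_sim h b hi.2]
  | .ld a, hi => by
      simp only [eval, eval_sim h a hi, h.1]

/-- Intermediate values form a stack of registers growing upwards from `d`: the code of a second
operand starts at `d + 1` and so preserves the first. With `32 ≤ d` the registers an expression may
read stay intact, so both operands are evaluated in the same state up to `Sim`. -/
theorem Ex.exec_code (w : ℕ) (O : Oracle) :
    ∀ (e : Ex) (d : ℕ) (σ : State), e.ok = true → 32 ≤ d →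
      ∃ σ', Exec w O (e.code d) σ σ' e.cost ∧ σ'.reg d = e.eval w σ ∧
        (∀ i < d, σ'.reg i = σ.reg i) ∧ σ'.mem = σ.mem
  | .c k, d, σ, _, _ =>
      ⟨_, .const d k σ, by simp [State.setReg, eval],
        fun i hi => by simp [State.setReg, Function.update_of_ne hi.ne], rfl⟩
  | .r j, d, σ, _, _ =>
      ⟨_, .move d j σ, by simp [State.setReg, eval],
        fun i hi => by simp [State.setReg, Function.update_of_ne hi.ne], rfl⟩
  | .bin o a b, d, σ, h, hd => by
      simp only [ok, Bool.and_eq_true] at h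
      obtain ⟨σ₁, e₁, v₁, f₁, m₁⟩ := exec_code w O a d σ h.1 hd
      obtain ⟨σ₂, e₂, v₂, f₂, m₂⟩ := exec_code w O b (d + 1) σ₁ h.2 (by omega)
      have hs : σ₁.Sim σ := ⟨m₁, fun i hi => f₁ i (by omega)⟩
      refine ⟨_, (Exec.seq _ _ _ _ _ _ _ e₁
        (Exec.seq _ _ _ _ _ _ _ e₂ (.op o d d (d + 1) σ₂))), ?_, ?_, ?_⟩
      · simp [State.setReg, eval, v₂, f₂ d (by omega), v₁, eval_sim hs b h.2]
      · intro i hi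
        simp [State.setReg, Function.update_of_ne hi.ne, f₂ i (by omega), f₁ i hi]
      · simp [State.setReg, m₂, m₁]
  | .ld a, d, σ, h, hd => by
      obtain ⟨σ₁, e₁, v₁, f₁, m₁⟩ := exec_code w O a d σ h hd
      refine ⟨_, (Exec.seq _ _ _ _ _ _ _ e₁ (.load d d σ₁)), ?_, ?_, ?_⟩
      · simp [State.setReg, eval, v₁, m₁]
      · intro i hi
        simp [State.setReg, Function.update_of_ne hi.ne, f₁ i hi]
      · simp [State.setReg, m₁]

namespace Prog

/-- `r d := e` -/
def set (d : ℕ) (e : Ex) : Prog := .seq (e.code 32) (.move d 32)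

/-- `mem a := e` -/
def put (a e : Ex) : Prog := .seq (a.code 32) (.seq (e.code 33) (.store 32 33))

/-- `r d :=` the answer of the oracle to the question `q` with arguments `a`, `b` -/
def query (q : Req) (d : ℕ) (a b : Ex) : Prog :=
  .seq (a.code 32) (.seq (b.code 33) (.ask q d 32 33))

/-- `if e ≠ 0 then p else q` -/
def cond (e : Ex) (p q : Prog) : Prog := .seq (e.code 32) (.ite 32 p q)

/-- `while e ≠ 0 do p` -/
def while' (e : Ex) (p : Prog) : Prog :=
  .seq (e.code 32) (.loop 32 (.seq p (e.code 32)))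

/-- Sequential composition of a list of programs. -/
def block : List Prog → Prog
  | [] => .skip
  | p :: l => .seq p (block l)

end Prog

/-- Started in any state that agrees with `τ` up to the auxiliary registers, the program `p` halts
such that `Q` holds for the final state (up to auxiliary registers) and the time on a clock that
shows `t` at the start. -/
def wp (w : ℕ) (O : Oracle) (p : Prog) (τ : State) (t : ℕ) (Q : State → ℕ → Prop) : Prop :=
  ∀ σ : State, σ.Sim τ → ∃ σ' τ' T, Exec w O p σ σ' T ∧ σ'.Sim τ' ∧ Q τ' (t + T)

variable {w : ℕ} {O : Oracle}

theorem wp_seq {p q : Prog} {τ : State} {t : ℕ} {Q : State → ℕ → Prop}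
    (h : wp w O p τ t fun τ' t' => wp w O q τ' t' Q) : wp w O (.seq p q) τ t Q := by
  intro σ hσ
  obtain ⟨σ₁, τ₁, T₁, e₁, s₁, h₁⟩ := h σ hσ
  obtain ⟨σ₂, τ₂, T₂, e₂, s₂, h₂⟩ := h₁ σ₁ s₁
  exact ⟨σ₂, τ₂, T₁ + T₂, .seq _ _ _ _ _ _ _ e₁ e₂, s₂, by rwa [← Nat.add_assoc]⟩

theorem wp_skip {τ : State} {t : ℕ} {Q : State → ℕ → Prop} (h : Q τ (t + 1)) :
    wp w O .skip τ t Q := fun σ hσ => ⟨σ, τ, 1, .skip σ, hσ, h⟩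

theorem wp_nil {τ : State} {t : ℕ} {Q : State → ℕ → Prop} (h : Q τ (t + 1)) :
    wp w O (.block []) τ t Q := wp_skip h

theorem wp_cons {p : Prog} {l : List Prog} {τ : State} {t : ℕ} {Q : State → ℕ → Prop}
    (h : wp w O p τ t fun τ' t' => wp w O (.block l) τ' t' Q) :
    wp w O (.block (p :: l)) τ t Q := wp_seq h

theorem wp_set {d : ℕ} {e : Ex} {τ : State} {t : ℕ} {Q : State → ℕ → Prop} (he : e.ok = true)
    (h : Q (τ.setReg d (e.eval w τ)) (t + (e.cost + 1))) : wp w O (.set d e) τ t Q := by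
  intro σ hσ
  obtain ⟨σ₁, e₁, v₁, f₁, m₁⟩ := e.exec_code w O 32 σ he le_rfl
  refine ⟨_, _, _, .seq _ _ _ _ _ _ _ e₁ (.move d 32 σ₁), ⟨?_, ?_⟩, h⟩
  · simp [State.setReg, m₁, hσ.1]
  · intro i hi
    by_cases hid : i = d
    · subst hid; simp [State.setReg, v₁, Ex.eval_sim hσ e he]
    · simp [State.setReg, Function.update_of_ne hid, f₁ i hi, hσ.2 i hi]

/-- Evaluation of two expressions one after the other. -/
theorem exec_code_pair (a b : Ex) {σ τ : State} (hσ : σ.Sim τ) (ha : a.ok = true)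
    (hb : b.ok = true) :
    ∃ σ₁ σ₂, Exec w O (a.code 32) σ σ₁ a.cost ∧ Exec w O (b.code 33) σ₁ σ₂ b.cost ∧
      σ₂.reg 32 = a.eval w τ ∧ σ₂.reg 33 = b.eval w τ ∧ σ₂.Sim τ := by
  obtain ⟨σ₁, e₁, v₁, f₁, m₁⟩ := a.exec_code w O 32 σ ha le_rfl
  obtain ⟨σ₂, e₂, v₂, f₂, m₂⟩ := b.exec_code w O 33 σ₁ hb (by norm_num)
  have hs : σ₁.Sim τ := ⟨m₁.trans hσ.1, fun i hi => (f₁ i hi).trans (hσ.2 i hi)⟩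
  refine ⟨σ₁, σ₂, e₁, e₂, ?_, ?_, ?_⟩
  · rw [f₂ 32 (by norm_num), v₁, Ex.eval_sim hσ a ha]
  · rw [v₂, Ex.eval_sim hs b hb]
  · exact ⟨m₂.trans hs.1, fun i hi => (f₂ i (by omega)).trans (hs.2 i hi)⟩

theorem wp_put {a e : Ex} {τ : State} {t : ℕ} {Q : State → ℕ → Prop} (ha : a.ok = true)
    (he : e.ok = true)
    (h : Q (τ.setMem (a.eval w τ) (e.eval w τ)) (t + (a.cost + (e.cost + 1)))) :
    wp w O (.put a e) τ t Q := by
  intro σ hσ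
  obtain ⟨σ₁, σ₂, e₁, e₂, v₁, v₂, hs⟩ := exec_code_pair (w := w) (O := O) a e hσ ha he
  refine ⟨_, _, _, .seq _ _ _ _ _ _ _ e₁ (.seq _ _ _ _ _ _ _ e₂ (.store 32 33 σ₂)), ⟨?_, ?_⟩, h⟩
  · simp [State.setMem, v₁, v₂, hs.1]
  · intro i hi
    simp [State.setMem, hs.2 i hi]

theorem wp_query {q : Req} {d : ℕ} {a e : Ex} {τ : State} {t : ℕ} {Q : State → ℕ → Prop}
    (ha : a.ok = true) (he : e.ok = true)
    (h : Q (τ.setReg d (O q (a.eval w τ) (e.eval w τ) % 2 ^ w)) (t + (a.cost + (e.cost + 1)))) :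
    wp w O (.query q d a e) τ t Q := by
  intro σ hσ
  obtain ⟨σ₁, σ₂, e₁, e₂, v₁, v₂, hs⟩ := exec_code_pair (w := w) (O := O) a e hσ ha he
  refine ⟨_, _, _, .seq _ _ _ _ _ _ _ e₁ (.seq _ _ _ _ _ _ _ e₂ (.ask q d 32 33 σ₂)),
    ⟨?_, ?_⟩, h⟩
  · simp [State.setReg, hs.1]
  · intro i hi
    by_cases hid : i = d
    · subst hid; simp [State.setReg, v₁, v₂]
    · simp [State.setReg, Function.update_of_ne hid, hs.2 i hi]

theorem wp_cond {e : Ex} {p q : Prog} {τ : State} {t : ℕ} {Q : State → ℕ → Prop}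
    (he : e.ok = true)
    (h₁ : e.eval w τ ≠ 0 → wp w O p τ (t + (e.cost + 1)) Q)
    (h₂ : e.eval w τ = 0 → wp w O q τ (t + (e.cost + 1)) Q) :
    wp w O (.cond e p q) τ t Q := by
  intro σ hσ
  obtain ⟨σ₁, e₁, v₁, f₁, m₁⟩ := e.exec_code w O 32 σ he le_rfl
  have hs : σ₁.Sim τ := ⟨m₁.trans hσ.1, fun i hi => (f₁ i hi).trans (hσ.2 i hi)⟩
  rw [Ex.eval_sim hσ e he] at v₁
  by_cases h0 : e.eval w τ = 0
  · obtain ⟨σ', τ', T, k₁, k₂, k₃⟩ := h₂ h0 σ₁ hs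
    refine ⟨σ', τ', _, .seq _ _ _ _ _ _ _ e₁ (.ite_false 32 p q _ _ _ (by rw [v₁, h0]) k₁), k₂, ?_⟩
    convert k₃ using 1; omega
  · obtain ⟨σ', τ', T, k₁, k₂, k₃⟩ := h₁ h0 σ₁ hs
    refine ⟨σ', τ', _, .seq _ _ _ _ _ _ _ e₁ (.ite_true 32 p q _ _ _ (by rwa [v₁]) k₁), k₂, ?_⟩
    convert k₃ using 1; omega

/-- A loop with `N` iterations, invariant `I` and at most `B` steps per iteration. -/
theorem wp_while (I : ℕ → State → Prop) (N B : ℕ) {e : Ex} {p : Prog} {τ : State} {t : ℕ}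
    {Q : State → ℕ → Prop} (he : e.ok = true) (h0 : I 0 τ)
    (hcond : ∀ j τ, j < N → I j τ → e.eval w τ ≠ 0)
    (hend : ∀ τ, I N τ → e.eval w τ = 0)
    (hstep : ∀ j τ t, j < N → I j τ → wp w O p τ t fun τ' t' => I (j + 1) τ' ∧ t' ≤ t + B)
    (hQ : ∀ τ' t', I N τ' → t' ≤ t + (N * (B + e.cost + 1) + e.cost + 1) → Q τ' t') :
    wp w O (.while' e p) τ t Q := by
  -- Induction on the number `k` of remaining iterations. Register `32` already holds the condition,
  -- since the loop body ends by evaluating it anew.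
  have key : ∀ k j, j + k = N → ∀ τ σ : State, I j τ → σ.Sim τ → σ.reg 32 = e.eval w τ →
      ∃ σ' τ' T, Exec w O (.loop 32 (.seq p (e.code 32))) σ σ' T ∧ σ'.Sim τ' ∧ I N τ' ∧
        T ≤ k * (B + e.cost + 1) + 1 := by
    intro k
    induction k with
    | zero =>
      intro j hj τ σ hI hs hv
      obtain rfl : j = N := hj
      exact ⟨σ, τ, 1, .loop_done _ _ _ (by rw [hv, hend τ hI]), hs, hI, by simp⟩
    | succ k ih =>
      intro j hj τ σ hI hs hv
      obtain ⟨σ₁, τ₁, T₁, e₁, s₁, hI₁, hT₁⟩ := hstep j τ 0 (by omega) hI σ hs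
      obtain ⟨σ₂, e₂, v₂, f₂, m₂⟩ := e.exec_code w O 32 σ₁ he le_rfl
      have hs₂ : σ₂.Sim τ₁ := ⟨m₂.trans s₁.1, fun i hi => (f₂ i hi).trans (s₁.2 i hi)⟩
      rw [Ex.eval_sim s₁ e he] at v₂
      obtain ⟨σ', τ', T, e', s', hI', hT⟩ := ih (j + 1) (by omega) τ₁ σ₂ hI₁ hs₂ v₂
      refine ⟨σ', τ', _, .loop_step _ _ _ _ _ _ _ (by rw [hv]; exact hcond j τ (by omega) hI)
        (.seq _ _ _ _ _ _ _ e₁ e₂) e', s', hI', ?_⟩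
      rw [Nat.succ_mul]
      omega
  intro σ hσ
  obtain ⟨σ₁, e₁, v₁, f₁, m₁⟩ := e.exec_code w O 32 σ he le_rfl
  have hs : σ₁.Sim τ := ⟨m₁.trans hσ.1, fun i hi => (f₁ i hi).trans (hσ.2 i hi)⟩
  rw [Ex.eval_sim hσ e he] at v₁
  obtain ⟨σ', τ', T, e', s', hI', hT⟩ := key N 0 (by simp) τ σ₁ h0 hs v₁
  exact ⟨σ', τ', _, .seq _ _ _ _ _ _ _ e₁ e', s', hQ _ _ hI' (by omega)⟩

@[simp] theorem State.setReg_reg (σ : State) (d x i : ℕ) :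
    (σ.setReg d x).reg i = if i = d then x else σ.reg i := by
  simp [State.setReg, Function.update_apply]

@[simp] theorem State.setReg_mem (σ : State) (d x : ℕ) : (σ.setReg d x).mem = σ.mem := rfl

@[simp] theorem State.setMem_reg (σ : State) (a x : ℕ) : (σ.setMem a x).reg = σ.reg := rfl

@[simp] theorem State.setMem_mem (σ : State) (a x b : ℕ) :
    (σ.setMem a x).mem b = if b = a then x else σ.mem b := by
  simp [State.setMem, Function.update_apply]

namespace Ex

variable (σ : State) (a b : Ex)

@[simp] theorem eval_c (k : ℕ) : (c k).eval w σ = k % 2 ^ w := rfl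
@[simp] theorem eval_r (i : ℕ) : (r i).eval w σ = σ.reg i := rfl
@[simp] theorem eval_ld : (ld a).eval w σ = σ.mem (a.eval w σ) := rfl
@[simp] theorem eval_add : (a + b).eval w σ = (a.eval w σ + b.eval w σ) % 2 ^ w := rfl
@[simp] theorem eval_sub : (a - b).eval w σ = (a.eval w σ + 2 ^ w - b.eval w σ) % 2 ^ w := rfl
@[simp] theorem eval_mul : (a * b).eval w σ = (a.eval w σ * b.eval w σ) % 2 ^ w := rfl
@[simp] theorem eval_div : (a / b).eval w σ = a.eval w σ / b.eval w σ := rfl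
@[simp] theorem eval_mod : (a % b).eval w σ = a.eval w σ % b.eval w σ := rfl
@[simp] theorem eval_lt :
    (lt a b).eval w σ = if a.eval w σ < b.eval w σ then 1 % 2 ^ w else 0 := rfl
@[simp] theorem eval_eq :
    (eq a b).eval w σ = if a.eval w σ = b.eval w σ then 1 % 2 ^ w else 0 := rfl
@[simp] theorem cost_c (k : ℕ) : (c k).cost = 1 := rfl
@[simp] theorem cost_r (i : ℕ) : (r i).cost = 1 := rfl
@[simp] theorem cost_ld : (ld a).cost = a.cost + 1 := rfl
@[simp] theorem cost_add : (a + b).cost = a.cost + (b.cost + 1) := rfl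
@[simp] theorem cost_sub : (a - b).cost = a.cost + (b.cost + 1) := rfl
@[simp] theorem cost_mul : (a * b).cost = a.cost + (b.cost + 1) := rfl
@[simp] theorem cost_div : (a / b).cost = a.cost + (b.cost + 1) := rfl
@[simp] theorem cost_mod : (a % b).cost = a.cost + (b.cost + 1) := rfl
@[simp] theorem cost_lt : (lt a b).cost = a.cost + (b.cost + 1) := rfl
@[simp] theorem cost_eq : (eq a b).cost = a.cost + (b.cost + 1) := rfl

end Ex

/-- Subtraction without underflow. -/
theorem Nat.add_sub_mod_of_le {a b W : ℕ} (hb : b ≤ a) (ha : a < W) : (a + W - b) % W = a - b := by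
  have : a + W - b = (a - b) + W := by omega
  rw [this, Nat.add_mod_right, Nat.mod_eq_of_lt (by omega)]

end SSDSO

namespace SSDSO

/-! ### Walks that avoid edges and vertices -/

section Walks

variable {V : Type} {G : SimpleGraph V} {wt : Sym2 V → ℕ}

@[simp] theorem walkWeight_nil {u : V} :
    walkWeight wt (SimpleGraph.Walk.nil : G.Walk u u) = 0 := rfl

@[simp] theorem walkWeight_cons {u v t : V} (h : G.Adj u v) (p : G.Walk v t) :
    walkWeight wt (.cons h p) = wt s(u, v) + walkWeight wt p := by
  simp [walkWeight]

@[simp] theorem walkWeight_append {u v t : V} (p : G.Walk u v) (q : G.Walk v t) :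
    walkWeight wt (p.append q) = walkWeight wt p + walkWeight wt q := by
  simp [walkWeight]

@[simp] theorem walkWeight_reverse {u v : V} (p : G.Walk u v) :
    walkWeight wt p.reverse = walkWeight wt p := by
  simp [walkWeight]

theorem walkWeight_le_length_mul {M : ℕ} (h : ∀ e ∈ G.edgeSet, wt e ≤ M) {u v : V}
    (p : G.Walk u v) : walkWeight wt p ≤ p.length * M := by
  induction p with
  | nil => simp
  | cons ha p ih =>
    have := h s(_, _) ha
    simp only [SimpleGraph.Walk.length_cons, walkWeight_cons, Nat.succ_mul]
    omega

/-- A path repeats no edge, so its edges form a submultiset of those of the walk. -/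
theorem walkWeight_bypass_le [DecidableEq V] {u v : V} (p : G.Walk u v) :
    walkWeight wt p.bypass ≤ walkWeight wt p := by
  have hn : p.bypass.edges.Nodup := p.bypass_isPath.isTrail.edges_nodup
  have hsub : (p.bypass.edges : Multiset (Sym2 V)) ≤ (p.edges : Multiset (Sym2 V)) :=
    hn.subperm p.edges_bypass_subset_edges
  obtain ⟨l, hl⟩ := Multiset.le_iff_exists_add.1 hsub
  have := congrArg (fun l => (l.map wt).sum) hl
  simp only [Multiset.map_coe, Multiset.sum_coe, Multiset.map_add, Multiset.sum_add] at this
  exact (Nat.le_add_right _ _).trans this.ge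

/-- The walk uses no edge of `Fe` and no vertex of `Fv`. -/
def Avoids (Fe : Set (Sym2 V)) (Fv : Set V) {u v : V} (p : G.Walk u v) : Prop :=
  (∀ e ∈ p.edges, e ∉ Fe) ∧ ∀ x ∈ p.support, x ∉ Fv

theorem Avoids.append {Fe : Set (Sym2 V)} {Fv : Set V} {u v t : V} {p : G.Walk u v}
    {q : G.Walk v t} (hp : Avoids Fe Fv p) (hq : Avoids Fe Fv q) :
    Avoids Fe Fv (p.append q) := by
  refine ⟨fun e he => ?_, fun x hx => ?_⟩
  · rw [SimpleGraph.Walk.edges_append, List.mem_append] at he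
    exact he.elim (hp.1 e) (hq.1 e)
  · rw [SimpleGraph.Walk.mem_support_append_iff] at hx
    exact hx.elim (hp.2 x) (hq.2 x)

theorem Avoids.reverse {Fe : Set (Sym2 V)} {Fv : Set V} {u v : V} {p : G.Walk u v}
    (hp : Avoids Fe Fv p) : Avoids Fe Fv p.reverse :=
  ⟨fun e he => hp.1 e (by simpa using he), fun x hx => hp.2 x (by simpa using hx)⟩

theorem Avoids.take {Fe : Set (Sym2 V)} {Fv : Set V} {u v : V} {p : G.Walk u v}
    (hp : Avoids Fe Fv p) (q : ℕ) : Avoids Fe Fv (p.take q) :=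
  ⟨fun e he => hp.1 e ((p.isSubwalk_take q).edges_subset he),
    fun x hx => hp.2 x ((p.isSubwalk_take q).support_subset hx)⟩

/-- The distance of `s` and `t` if the edges of `Fe` and the vertices of `Fv` fail. -/
noncomputable def avoidDist (G : SimpleGraph V) (wt : Sym2 V → ℕ) (Fe : Set (Sym2 V)) (Fv : Set V)
    (s t : V) : ℕ∞ :=
  ⨅ (p : G.Walk s t) (_ : Avoids Fe Fv p), (walkWeight wt p : ℕ∞)

theorem edgeReplDist_eq (s t : V) (e : Sym2 V) :
    edgeReplDist G wt s t e = avoidDist G wt {e} ∅ s t := by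
  unfold edgeReplDist avoidDist
  refine iInf_congr fun p => iInf_congr_Prop ?_ fun _ => rfl
  simp only [Avoids, Set.mem_singleton_iff, Set.mem_empty_iff_false, not_false_eq_true,
    implies_true, and_true]
  exact ⟨fun h x hx hxe => h (hxe ▸ hx), fun h he => h e he rfl⟩

theorem vertexReplDist_eq (s t v : V) :
    vertexReplDist G wt s t v = avoidDist G wt ∅ {v} s t := by
  unfold vertexReplDist avoidDist
  refine iInf_congr fun p => iInf_congr_Prop ?_ fun _ => rfl
  simp only [Avoids, Set.mem_singleton_iff, Set.mem_empty_iff_false, not_false_eq_true,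
    implies_true, true_and]
  exact ⟨fun h x hx hxe => h (hxe ▸ hx), fun h he => h v he rfl⟩

theorem avoidDist_le {Fe : Set (Sym2 V)} {Fv : Set V} {s t : V} {p : G.Walk s t}
    (hp : Avoids Fe Fv p) : avoidDist G wt Fe Fv s t ≤ walkWeight wt p :=
  iInf₂_le p hp

theorem sdist_le_walkWeight {s t : V} (p : G.Walk s t) : sdist G wt s t ≤ walkWeight wt p :=
  iInf_le _ p

theorem sdist_le_avoidDist (Fe : Set (Sym2 V)) (Fv : Set V) (s t : V) :
    sdist G wt s t ≤ avoidDist G wt Fe Fv s t :=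
  le_iInf₂ fun p _ => sdist_le_walkWeight p

theorem sdist_eq_top {s t : V} (h : ¬ G.Reachable s t) : sdist G wt s t = ⊤ :=
  iInf_eq_top.2 fun p => (h ⟨p⟩).elim

theorem avoidDist_eq_top_of_not_reachable {s t : V} (h : ¬ G.Reachable s t)
    (Fe : Set (Sym2 V)) (Fv : Set V) : avoidDist G wt Fe Fv s t = ⊤ :=
  top_le_iff.1 ((sdist_eq_top h).symm.le.trans (sdist_le_avoidDist Fe Fv s t))

/-- An infimum over a nonempty family in `ℕ∞` is attained, and shortening a minimiser to a path
keeps it avoiding without raising its weight. -/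
theorem exists_path_of_avoidDist_ne_top {Fe : Set (Sym2 V)} {Fv : Set V} {s t : V}
    (h : avoidDist G wt Fe Fv s t ≠ ⊤) :
    ∃ p : G.Walk s t, p.IsPath ∧ Avoids Fe Fv p ∧
      (walkWeight wt p : ℕ∞) = avoidDist G wt Fe Fv s t := by
  classical
  have hne : Nonempty {p : G.Walk s t // Avoids Fe Fv p} := by
    by_contra hc
    exact h (iInf₂_eq_top.2 fun p hp => (hc ⟨⟨p, hp⟩⟩).elim)
  have heq : avoidDist G wt Fe Fv s t =
      ⨅ p : {p : G.Walk s t // Avoids Fe Fv p}, (walkWeight wt p.1 : ℕ∞) := by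
    rw [avoidDist, iInf_subtype]
  obtain ⟨⟨p, hp⟩, hpe⟩ := ciInf_mem fun p : {p : G.Walk s t // Avoids Fe Fv p} =>
    (walkWeight wt p.1 : ℕ∞)
  have hb : Avoids Fe Fv p.bypass :=
    ⟨fun e he => hp.1 e (p.edges_bypass_subset_edges he), fun x hx => hp.2 x (p.support_bypass_subset_support hx)⟩
  refine ⟨p.bypass, p.bypass_isPath, hb, le_antisymm ?_ (avoidDist_le hb)⟩
  rw [heq, ← hpe]
  exact Nat.cast_le.2 (walkWeight_bypass_le p)

theorem avoidDist_le_card_mul [Fintype V] {M : ℕ} (hM : ∀ e ∈ G.edgeSet, wt e ≤ M)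
    {Fe : Set (Sym2 V)} {Fv : Set V} {s t : V} (h : avoidDist G wt Fe Fv s t ≠ ⊤) :
    avoidDist G wt Fe Fv s t ≤ (Fintype.card V * M : ℕ) := by
  obtain ⟨p, hp, -, hw⟩ := exists_path_of_avoidDist_ne_top h
  rw [← hw]
  exact_mod_cast (walkWeight_le_length_mul hM p).trans
    (Nat.mul_le_mul_right M hp.length_lt.le)

/-- The part of a walk after its last vertex in `A`. -/
theorem exists_suffix_from_last (A : Set V) {u t : V} (p : G.Walk u t)
    (h : ∃ x ∈ p.support, x ∈ A) :
    ∃ a ∈ A, ∃ (q : G.Walk u a) (r : G.Walk a t), p = q.append r ∧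
      ∀ x ∈ r.support, x ∈ A → x = a := by
  induction p with
  | nil =>
    obtain ⟨x, hx, hA⟩ := h
    obtain rfl : x = _ := by simpa using hx
    exact ⟨x, hA, .nil, .nil, rfl, fun y hy _ => by simpa using hy⟩
  | @cons u v t ha p ih =>
    by_cases hp : ∃ x ∈ p.support, x ∈ A
    · obtain ⟨a, hA, q, r, rfl, hr⟩ := ih hp
      exact ⟨a, hA, .cons ha q, r, rfl, hr⟩
    · obtain ⟨x, hx, hA⟩ := h
      rw [SimpleGraph.Walk.support_cons, List.mem_cons] at hx
      have hxu : x = u := hx.resolve_right fun hx => hp ⟨x, hx, hA⟩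
      subst hxu
      refine ⟨x, hA, .nil, .cons ha p, rfl, fun y hy hyA => ?_⟩
      rw [SimpleGraph.Walk.support_cons, List.mem_cons] at hy
      exact hy.resolve_right fun hy => hp ⟨y, hy, hyA⟩

end Walks

end SSDSO

namespace SSDSO

/-! ### Failures on a shortest path -/

section Geodesic

variable {V : Type} {G : SimpleGraph V} {wt : Sym2 V → ℕ} {s : V}

/-- `v 0, …, v k` is a path from `s`, and `D i` is the distance from `s` to `v i`. -/
structure Geodesic (G : SimpleGraph V) (wt : Sym2 V → ℕ) (s : V) (v : ℕ → V) (D : ℕ → ℕ)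
    (k : ℕ) : Prop where
  zero : v 0 = s
  adj : ∀ i < k, G.Adj (v i) (v (i + 1))
  succ : ∀ i < k, D (i + 1) = D i + wt s(v i, v (i + 1))
  dist : ∀ i ≤ k, sdist G wt s (v i) = D i
  pos : ∀ i < k, 1 ≤ wt s(v i, v (i + 1))

/-- `Fe` and `Fv` are sets of failing edges and vertices that contain nothing but the vertex
`v m` and the edge from `v (m - 1)` to `v m`. -/
structure FailsAt (v : ℕ → V) (m : ℕ) (Fe : Set (Sym2 V)) (Fv : Set V) : Prop where
  pos : 1 ≤ m
  edge : Fe ⊆ {s(v (m - 1), v m)}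
  vertex : Fv ⊆ {v m}

variable {v : ℕ → V} {D : ℕ → ℕ} {k : ℕ}

namespace Geodesic

theorem dist_lt (h : Geodesic G wt s v D k) {i j : ℕ} (hij : i < j) (hj : j ≤ k) : D i < D j := by
  induction j, hij using Nat.le_induction with
  | base =>
    have := h.succ i (by omega)
    have := h.pos i (by omega)
    simp only [Nat.succ_eq_add_one]
    omega
  | succ j hij ih =>
    have := ih (by omega); have := h.succ j (by omega); omega

theorem dist_le (h : Geodesic G wt s v D k) {i j : ℕ} (hij : i ≤ j) (hj : j ≤ k) : D i ≤ D j := by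
  rcases hij.eq_or_lt with rfl | hij
  · rfl
  · exact (h.dist_lt hij hj).le

theorem inj (h : Geodesic G wt s v D k) {i j : ℕ} (hi : i ≤ k) (hj : j ≤ k) (hv : v i = v j) :
    i = j := by
  have hd : D i = D j := by
    have h1 := h.dist i hi
    rw [hv, h.dist j hj] at h1
    exact_mod_cast h1.symm
  rcases lt_trichotomy i j with hij | hij | hij
  · exact absurd hd (h.dist_lt hij hj).ne
  · exact hij
  · exact absurd hd (h.dist_lt hij hi).ne'

theorem exists_walk (h : Geodesic G wt s v D k) {i j : ℕ} (hij : i ≤ j) (hj : j ≤ k) :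
    ∃ p : G.Walk (v i) (v j), D i + walkWeight wt p = D j ∧
      (∀ x ∈ p.support, ∃ l, i ≤ l ∧ l ≤ j ∧ x = v l) ∧
      ∀ e ∈ p.edges, ∃ l, i ≤ l ∧ l < j ∧ e = s(v l, v (l + 1)) := by
  induction j, hij using Nat.le_induction with
  | base => exact ⟨.nil, by simp, fun x hx => ⟨i, le_rfl, le_rfl, by simpa using hx⟩, by simp⟩
  | succ j hij ih =>
    obtain ⟨p, hp, hs, he⟩ := ih (by omega)
    refine ⟨p.append (.cons (h.adj j (by omega)) .nil), ?_, fun x hx => ?_, fun e hx => ?_⟩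
    · have := h.succ j (by omega)
      simp
      omega
    · rw [SimpleGraph.Walk.mem_support_append_iff] at hx
      rcases hx with hx | hx
      · obtain ⟨l, h1, h2, h3⟩ := hs x hx
        exact ⟨l, h1, by omega, h3⟩
      · simp only [SimpleGraph.Walk.support_cons, SimpleGraph.Walk.support_nil, List.mem_cons,
          List.not_mem_nil, or_false] at hx
        rcases hx with rfl | rfl
        · exact ⟨j, hij, by omega, rfl⟩
        · exact ⟨j + 1, by omega, le_rfl, rfl⟩
    · rw [SimpleGraph.Walk.edges_append, List.mem_append] at hx
      rcases hx with hx | hx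
      · obtain ⟨l, h1, h2, h3⟩ := he e hx
        exact ⟨l, h1, by omega, h3⟩
      · exact ⟨j, hij, by omega, by simpa using hx⟩

end Geodesic

theorem FailsAt.avoids {m : ℕ} {Fe : Set (Sym2 V)} {Fv : Set V} (hF : FailsAt v m Fe Fv) {a b : V}
    {p : G.Walk a b} (hp : v m ∉ p.support) : Avoids Fe Fv p := by
  refine ⟨fun e he heF => hp ?_, fun x hx hxF => hp ?_⟩
  · rw [hF.edge heF] at he
    exact p.snd_mem_support_of_mem_edges he
  · rwa [hF.vertex hxF] at hx

namespace Geodesic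

variable {m a : ℕ} {Fe : Set (Sym2 V)} {Fv : Set V}

/-- The third alternative starts at the failure itself, when `v m` survives: a failing edge lies
just above `v m` and is not used on the way down. -/
theorem exists_avoiding_walk (h : Geodesic G wt s v D k) (hF : FailsAt v m Fe Fv) {i j : ℕ}
    (hij : i ≤ j) (hj : j ≤ k) (hm : m ≤ k) (hmij : j < m ∨ m < i ∨ m = i ∧ v m ∉ Fv) :
    ∃ p : G.Walk (v i) (v j), D i + walkWeight wt p = D j ∧ Avoids Fe Fv p := by
  obtain ⟨p, hp, hs, he⟩ := h.exists_walk hij hj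
  refine ⟨p, hp, ?_⟩
  by_cases hmi : m = i
  · have hmF : v m ∉ Fv := by
      rcases hmij with hmij | hmij | hmij
      · omega
      · omega
      · exact hmij.2
    refine ⟨fun e hep heF => ?_, fun x hx hxF => ?_⟩
    · rw [hF.edge heF] at hep
      obtain ⟨l, h1, h2, h3⟩ := hs _ (p.fst_mem_support_of_mem_edges hep)
      have := h.inj (by omega) (by omega) h3
      have := hF.pos
      omega
    · rw [hF.vertex hxF] at hxF
      exact hmF hxF
  · refine hF.avoids fun hmp => ?_
    obtain ⟨l, h1, h2, h3⟩ := hs _ hmp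
    have := h.inj (by omega) (by omega) h3
    omega

theorem dist_zero (h : Geodesic G wt s v D k) : D 0 = 0 := by
  have h0 := h.dist 0 (Nat.zero_le k)
  have := sdist_le_walkWeight (wt := wt) (SimpleGraph.Walk.nil : G.Walk s s)
  rw [h.zero] at h0
  rw [h0] at this
  simpa using this

theorem le_dist_add_walkWeight (h : Geodesic G wt s v D k) {j l : ℕ} (hj : j ≤ k) (hl : l ≤ k)
    (r : G.Walk (v j) (v l)) : D l ≤ D j + walkWeight wt r := by
  obtain ⟨p, hp, -⟩ := h.exists_walk (Nat.zero_le j) hj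
  have h1 := sdist_le_walkWeight (wt := wt) ((p.append r).copy h.zero rfl)
  have hz := h.dist_zero
  rw [h.dist l hl] at h1
  have h2 : walkWeight wt ((p.append r).copy h.zero rfl) = walkWeight wt p + walkWeight wt r := by
    rw [← walkWeight_append]; simp [walkWeight]
  rw [h2] at h1
  have : D l ≤ walkWeight wt p + walkWeight wt r := by exact_mod_cast h1
  omega

/-- A walk to the path that avoids the failure can be prolonged along the path. -/
theorem avoidDist_le_of_walk (h : Geodesic G wt s v D k) (hF : FailsAt v m Fe Fv) {i j : ℕ}
    (hij : i ≤ j) (hj : j ≤ k) (hm : m ≤ k) (hmi : m < i ∨ m = i ∧ v m ∉ Fv)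
    {q : G.Walk s (v i)} (hq : Avoids Fe Fv q) :
    avoidDist G wt Fe Fv s (v j) ≤ (walkWeight wt q + (D j - D i) : ℕ) := by
  obtain ⟨p, hp, hpa⟩ := h.exists_avoiding_walk hF hij hj hm (Or.inr hmi)
  refine (avoidDist_le (hq.append hpa)).trans ?_
  rw [walkWeight_append]
  exact Nat.cast_le.2 (by omega)

/-- A walk from a vertex of the path above the failure can be preceded by the path. -/
theorem avoidDist_le_of_walk_from (h : Geodesic G wt s v D k) (hF : FailsAt v m Fe Fv) {i : ℕ}
    (hm : m ≤ k) (hmi : i < m) {t : V} {q : G.Walk (v i) t} (hq : Avoids Fe Fv q) :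
    avoidDist G wt Fe Fv s t ≤ (D i + walkWeight wt q : ℕ) := by
  obtain ⟨p, hp, hpa⟩ := h.exists_avoiding_walk hF (Nat.zero_le i) (by omega) hm (Or.inl hmi)
  have hz := h.dist_zero
  obtain ⟨h0, -, -, -, -⟩ := h
  subst h0
  refine (avoidDist_le (hpa.append hq)).trans ?_
  rw [walkWeight_append]
  exact Nat.cast_le.2 (by omega)

/-- Below the failure the tree path is intact, so routing through `v a` is always possible. This is
the inequality between the true value and `via`. -/
theorem avoidDist_le_add (h : Geodesic G wt s v D k) (hF : FailsAt v m Fe Fv) (hma : m < a)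
    (hak : a ≤ k) :
    avoidDist G wt Fe Fv s (v k) ≤ avoidDist G wt Fe Fv s (v a) + (D k - D a : ℕ) := by
  by_cases ht : avoidDist G wt Fe Fv s (v a) = ⊤
  · simp [ht]
  · obtain ⟨q, -, hq, hqe⟩ := exists_path_of_avoidDist_ne_top ht
    have := h.avoidDist_le_of_walk hF hak le_rfl (by omega) (Or.inl hma) hq
    rw [← hqe]
    exact_mod_cast this

/-- If a walk to `v k` that avoids the failure is shorter than all those that visit `v a`, it
meets the path between the failure and `v a` nowhere. -/
theorem not_mem_support (h : Geodesic G wt s v D k) (hF : FailsAt v m Fe Fv)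
    (hak : a ≤ k) {p : G.Walk s (v k)} (hp : Avoids Fe Fv p)
    (hlt : (walkWeight wt p : ℕ∞) < avoidDist G wt Fe Fv s (v a) + (D k - D a : ℕ))
    {j : ℕ} (hmj : m ≤ j) (hja : j ≤ a) : v j ∉ p.support := by
  classical
  intro hj
  have hsp := p.take_spec hj
  set q := p.takeUntil (v j) hj
  set r := p.dropUntil (v j) hj
  have hq : Avoids Fe Fv q :=
    ⟨fun e he => hp.1 e (by rw [← hsp, SimpleGraph.Walk.edges_append]; simp [he]),
     fun x hx => hp.2 x (by rw [← hsp, SimpleGraph.Walk.mem_support_append_iff]; simp [hx])⟩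
  -- From `v j` the tree path leads on to `v a`, so `v a` is reached with weight at most that of `q`
  -- plus `D a - D j`, while `r` weighs at least `D k - D j`. Thus `p` would be no shorter than a
  -- walk through `v a`. For `j = m`, the visit of `p` shows that `v m` has not failed.
  have h1 := h.avoidDist_le_of_walk hF hja hak (by omega)
    (by rcases hmj.eq_or_lt with rfl | hmj
        · exact Or.inr ⟨rfl, hp.2 _ hj⟩
        · exact Or.inl hmj) hq
  have h2 := h.le_dist_add_walkWeight (by omega) le_rfl r
  have h3 : walkWeight wt p = walkWeight wt q + walkWeight wt r := by
    rw [← walkWeight_append, hsp]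
  have h4 := lt_of_lt_of_le hlt (add_le_add_left h1 _)
  have h5 : walkWeight wt p < walkWeight wt q + (D a - D j) + (D k - D a) := by exact_mod_cast h4
  have h6 := h.dist_le hja hak
  have h7 := h.dist_le hak le_rfl
  omega

/-- If an optimal walk around the failure at `m` visits `v a` nowhere, it is also a walk around
failures between `m` and `a`. -/
theorem avoidDist_mono (h : Geodesic G wt s v D k) (hF : FailsAt v m Fe Fv) (hak : a ≤ k)
    (hlt : avoidDist G wt Fe Fv s (v k) < avoidDist G wt Fe Fv s (v a) + (D k - D a : ℕ))
    {m' : ℕ} {Fe' : Set (Sym2 V)} {Fv' : Set V} (hF' : FailsAt v m' Fe' Fv') (hm : m ≤ m')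
    (hma : m' ≤ a) : avoidDist G wt Fe' Fv' s (v k) ≤ avoidDist G wt Fe Fv s (v k) := by
  obtain ⟨p, -, hp, hpe⟩ := exists_path_of_avoidDist_ne_top hlt.ne_top
  rw [← hpe] at hlt ⊢
  exact avoidDist_le (hF'.avoids (h.not_mem_support hF hak hp hlt hm hma))

/-- The part of an optimal walk around the failure after its last vertex on the path. -/
theorem exists_detour (h : Geodesic G wt s v D k) (hF : FailsAt v m Fe Fv)
    (hak : a ≤ k)
    (hlt : avoidDist G wt Fe Fv s (v k) < avoidDist G wt Fe Fv s (v a) + (D k - D a : ℕ)) :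
    ∃ b < m, ∃ r : G.Walk (v b) (v k), r.IsPath ∧ Avoids Fe Fv r ∧
      (∀ j ≤ a, v j ∈ r.support → j = b) ∧
      (D b + walkWeight wt r : ℕ) ≤ avoidDist G wt Fe Fv s (v k) := by
  obtain ⟨p, hpath, hp, hpe⟩ := exists_path_of_avoidDist_ne_top hlt.ne_top
  rw [← hpe] at hlt
  -- Cut at the last vertex that lies on the path down to `v a`; there is one because `s` does. By
  -- `not_mem_support` it is above the failure.
  obtain ⟨x, ⟨b, hba, rfl⟩, q, r, rfl, hr⟩ := exists_suffix_from_last {x | ∃ j ≤ a, v j = x} p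
    ⟨s, p.start_mem_support, 0, Nat.zero_le a, h.zero⟩
  have hbm : b < m := by
    by_contra hbm
    exact h.not_mem_support hF hak hp hlt (not_lt.1 hbm) hba
      (by rw [SimpleGraph.Walk.mem_support_append_iff]; simp)
  refine ⟨b, hbm, r, hpath.of_append_right, ⟨fun e he => hp.1 e ?_, fun x hx => hp.2 x ?_⟩, ?_, ?_⟩
  · rw [SimpleGraph.Walk.edges_append]; simp [he]
  · rw [SimpleGraph.Walk.mem_support_append_iff]; simp [hx]
  · exact fun j hj hjr => h.inj (by omega) (by omega) (hr _ hjr ⟨j, hj, rfl⟩)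
  · rw [← hpe, walkWeight_append]
    have hb : D b ≤ walkWeight wt q := by
      have := sdist_le_walkWeight (wt := wt) q
      rw [h.dist b (by omega)] at this
      exact_mod_cast this
    exact Nat.cast_le.2 (by omega)

end Geodesic
end Geodesic
end SSDSO

/-! ### Disjoint detours and the number of breakpoints -/

namespace SSDSO
section Geodesic

variable {V : Type} {G : SimpleGraph V} {wt : Sym2 V → ℕ} {s : V}
variable {v : ℕ → V} {D : ℕ → ℕ} {k a : ℕ}

/-- Initial parts of two detours that start at different sides of the failure at `m` are disjoint
if together they are shorter than the excess of the replacement distance. -/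
theorem Geodesic.getVert_ne_of_lt (h : Geodesic G wt s v D k) {M : ℕ}
    (hM : ∀ e ∈ G.edgeSet, wt e ≤ M) {m : ℕ} {Fe : Set (Sym2 V)} {Fv : Set V}
    (hF : FailsAt v m Fe Fv) (hma : m ≤ a) (hak : a ≤ k)
    {b b' : ℕ} (hb : b < m) (hb' : m < b') (hba' : b' ≤ a)
    {r : G.Walk (v b) (v k)} {r' : G.Walk (v b') (v k)} (hr : Avoids Fe Fv r)
    (hr' : ∀ j ≤ a, v j ∈ r'.support → j = b') {q q' : ℕ}
    (hlt : (D k + (q + q') * M : ℕ) < avoidDist G wt Fe Fv s (v k)) :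
    r.getVert q ≠ r'.getVert q' := by
  intro heq
  have hr'F : Avoids Fe Fv r' := hF.avoids fun hm => by
    have := hr' m hma hm; omega
  have h1 := (h.avoidDist_le_of_walk_from hF (by omega) hb (hr.take q))
  have hp : Avoids Fe Fv ((r'.take q').reverse.copy heq.symm rfl) := by
    have := (hr'F.take q').reverse
    refine ⟨fun e he => this.1 e (by simpa using he), fun x hx => this.2 x (by simpa using hx)⟩
  obtain ⟨p, hpw, hpa⟩ := h.exists_avoiding_walk hF (hba'.trans hak) le_rfl (by omega)
    (Or.inr (Or.inl hb'))
  -- Down to `v b`, along `r` to the common vertex, back along `r'` to `v b'`, and down the tree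
  -- path: this avoids the failure and weighs at most `D k + (q + q') * M`, because `D b ≤ D b'`.
  have h2 := h.avoidDist_le_of_walk_from hF (by omega) hb (((hr.take q).append hp).append hpa)
  have h3 : walkWeight wt ((r'.take q').reverse.copy heq.symm rfl) =
      walkWeight wt (r'.take q') := by
    rw [← walkWeight_reverse (r'.take q')]; simp [walkWeight]
  rw [walkWeight_append, walkWeight_append, h3] at h2
  have h4 := Nat.cast_lt.1 (lt_of_lt_of_le hlt h2)
  have h5 : walkWeight wt (r.take q) ≤ q * M := (walkWeight_le_length_mul hM _).trans
    (Nat.mul_le_mul_right M (by simp [SimpleGraph.Walk.take_length]))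
  have h6 : walkWeight wt (r'.take q') ≤ q' * M := (walkWeight_le_length_mul hM _).trans
    (Nat.mul_le_mul_right M (by simp [SimpleGraph.Walk.take_length]))
  have h7 : D b ≤ D b' := h.dist_le (by omega) (by omega)
  rw [Nat.add_mul] at h4
  omega

/-- Integrality: each of the remaining steps lowers the value by at least one. -/
theorem sub_le_of_strictAnti {K : ℕ} {e : ℕ → ℕ} (he : ∀ i j, i < j → j < K → e j < e i) :
    ∀ i < K, K - 1 - i ≤ e i := by
  have : ∀ d i, i + d + 1 = K → d ≤ e i := by
    intro d
    induction d with
    | zero => simp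
    | succ d ih =>
      intro i hi
      have h1 := ih (i + 1) (by omega)
      have h2 := he i (i + 1) (by omega) (by omega)
      omega
  exact fun i hi => this _ i (by omega)

/-- Packing argument: `J`, about a quarter of the breakpoints, have detours whose first `N` vertices
are pairwise disjoint, with `N` about `K / (4 * M)`. Hence `J * N` is at most the number of
vertices. -/
theorem Geodesic.card_sq_le [Fintype V] (h : Geodesic G wt s v D k) {M : ℕ} (hM1 : 1 ≤ M)
    (hM : ∀ e ∈ G.edgeSet, wt e ≤ M) {Fe : ℕ → Set (Sym2 V)} {Fv : ℕ → Set V} {B : Finset ℕ}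
    (hak : a ≤ k) (hF : ∀ m ∈ B, FailsAt v m (Fe m) (Fv m)) (hBa : ∀ m ∈ B, m ≤ a)
    (hlt : ∀ m ∈ B, avoidDist G wt (Fe m) (Fv m) s (v k) <
      avoidDist G wt (Fe m) (Fv m) s (v a) + (D k - D a : ℕ))
    (hanti : ∀ m ∈ B, ∀ m' ∈ B, m < m' → avoidDist G wt (Fe m') (Fv m') s (v k) <
      avoidDist G wt (Fe m) (Fv m) s (v k)) :
    B.card ^ 2 ≤ 40 * (Fintype.card V * M) := by
  classical
  set K := B.card with hK
  rcases Nat.eq_zero_or_pos K with h0 | hKpos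
  · simp [h0]
  -- the breakpoints in increasing order
  obtain ⟨β, hβB, hβ⟩ : ∃ β : ℕ → ℕ, (∀ i < K, β i ∈ B) ∧ ∀ i j, i < j → j < K → β i < β j := by
    refine ⟨fun i => if hi : i < K then B.orderEmbOfFin rfl ⟨i, hi⟩ else 0, fun i hi => ?_,
      fun i j hij hj => ?_⟩
    · simp only [hi, dite_true]
      exact Finset.orderEmbOfFin_mem _ _ _
    · simp only [hj, hij.trans hj, dite_true]
      exact (B.orderEmbOfFin rfl).strictMono (by simpa using hij)
  have hdet : ∀ m, ∃ (b : ℕ) (r : G.Walk (v b) (v k)), m ∈ B → b < m ∧ r.IsPath ∧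
      Avoids (Fe m) (Fv m) r ∧ (∀ j ≤ a, v j ∈ r.support → j = b) ∧
      (D b + walkWeight wt r : ℕ) ≤ avoidDist G wt (Fe m) (Fv m) s (v k) := fun m => by
    by_cases hm : m ∈ B
    · obtain ⟨b, hb, r, hr⟩ := h.exists_detour (hF m hm) hak (hlt m hm)
      exact ⟨b, r, fun _ => ⟨hb, hr⟩⟩
    · exact ⟨k, .nil, fun hm' => absurd hm' hm⟩
  choose b r hbr using hdet
  have hb := fun m hm => (hbr m hm).1
  have hrp := fun m hm => (hbr m hm).2.1
  have hra := fun m hm => (hbr m hm).2.2.1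
  have hrs := fun m hm => (hbr m hm).2.2.2.1
  have hrw := fun m hm => (hbr m hm).2.2.2.2
  set f : ℕ → ℕ := fun i => (avoidDist G wt (Fe (β i)) (Fv (β i)) s (v k)).toNat with hf
  have hfe : ∀ i < K, avoidDist G wt (Fe (β i)) (Fv (β i)) s (v k) = f i := fun i hi =>
    (ENat.natCast_toNat (hlt _ (hβB i hi)).ne_top).symm
  have hfanti : ∀ i j, i < j → j < K → f j < f i := fun i j hij hj => by
    have := hanti _ (hβB i (hij.trans hj)) _ (hβB j hj) (hβ i j hij hj)
    rw [hfe i (hij.trans hj), hfe j hj] at this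
    exact_mod_cast this
  have hDf : ∀ i < K, D k ≤ f i := fun i hi => by
    have := sdist_le_avoidDist (G := G) (wt := wt) (Fe (β i)) (Fv (β i)) s (v k)
    rw [h.dist k le_rfl, hfe i hi] at this
    exact_mod_cast this
  -- The values drop strictly and never fall below `D k`, so the `i`-th still exceeds `D k` by the
  -- number of later breakpoints.
  have hexc : ∀ i < K, K - 1 - i ≤ f i - D k :=
    sub_le_of_strictAnti fun i j hij hj => by
      have := hfanti i j hij hj
      have := hDf j hj
      omega
  have hrw' : ∀ i < K, D (b (β i)) + walkWeight wt (r (β i)) ≤ f i := fun i hi => by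
    have := hrw _ (hβB i hi)
    rw [hfe i hi] at this
    exact_mod_cast this
  -- If the detour for `β j` started above `β i`, it would avoid the failure at `β i` too, whence `f
  -- i ≤ f j`.
  have hbb : ∀ i j, i < j → j < K → β i ≤ b (β j) := by
    intro i j hij hj
    by_contra hc
    have hi := hij.trans hj
    have hlt' := h.avoidDist_le_of_walk_from (hF _ (hβB i hi))
      ((hBa _ (hβB i hi)).trans hak) (not_le.1 hc) (q := r (β j))
      ((hF _ (hβB i hi)).avoids fun hm => by
        have := hrs _ (hβB j hj) _ (hBa _ (hβB i hi)) hm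
        omega)
    rw [hfe i hi] at hlt'
    have h1 := hrw' j hj
    have h2 := hfanti i j hij hj
    have h3 : f i ≤ D (b (β j)) + walkWeight wt (r (β j)) := by exact_mod_cast hlt'
    omega
  -- The tree path to the start of the detour weighs at most `D k`, so the detour itself carries the
  -- excess, at most `M` per edge.
  have hlen : ∀ i < K, f i - D k ≤ (r (β i)).length * M := fun i hi => by
    have h1 := h.avoidDist_le_of_walk_from (hF _ (hβB i hi))
      ((hBa _ (hβB i hi)).trans hak) (hb _ (hβB i hi)) (hra _ (hβB i hi))
    rw [hfe i hi] at h1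
    have h2 : f i ≤ D (b (β i)) + walkWeight wt (r (β i)) := by exact_mod_cast h1
    have h3 := walkWeight_le_length_mul hM (r (β i))
    have h4 : D (b (β i)) ≤ D k := h.dist_le
      (((hb _ (hβB i hi)).le.trans (hBa _ (hβB i hi))).trans hak) le_rfl
    omega
  -- For `i < J` the index `2 * i` is at most `(K - 1) / 2`, so the excess there is at least `(K -
  -- 1) / 2`; `N` is chosen such that `2 * N` edges weigh no more than this.
  set J := (K + 3) / 4 with hJ
  set N := (K - 1) / 2 / (2 * M) with hN
  have hN2 : N * (2 * M) ≤ (K - 1) / 2 := Nat.div_mul_le_self _ _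
  have hcard : J * N ≤ Fintype.card V := by
    have hinj : Function.Injective
        fun x : Fin J × Fin N => (r (β (2 * x.1))).getVert x.2 := by
      have key : ∀ (i j : Fin J) (q q' : Fin N), i < j →
          (r (β (2 * i))).getVert q ≠ (r (β (2 * j))).getVert q' := by
        intro i j q q' hij
        have hij' : (i : ℕ) < j := hij
        have hj := j.2
        have hjK : 2 * (j : ℕ) < K := by omega
        have hiK : 2 * (i : ℕ) < K := by omega
        -- `hbb` is not strict. Using only even indices leaves a breakpoint in between, which gives
        -- `β (2 * i) < b (β (2 * j))`.
        have hm := hbb (2 * i + 1) (2 * j) (by omega) hjK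
        have hm2 := hβ (2 * i) (2 * i + 1) (by omega) (by omega)
        refine h.getVert_ne_of_lt hM (hF _ (hβB _ hiK)) (hBa _ (hβB _ hiK)) hak
          (hb _ (hβB _ hiK)) (by omega)
          ((hb _ (hβB _ hjK)).le.trans (hBa _ (hβB _ hjK))) (hra _ (hβB _ hiK))
          (hrs _ (hβB _ hjK)) ?_
        rw [hfe _ hiK]
        have h1 := hexc _ hiK
        have h2 : ((q : ℕ) + q') * M < N * (2 * M) := by
          have : (q : ℕ) + q' < 2 * N := by omega
          calc ((q : ℕ) + q') * M < 2 * N * M := Nat.mul_lt_mul_of_pos_right this hM1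
            _ = N * (2 * M) := by ring
        exact Nat.cast_lt.2 (by omega)
      rintro ⟨i, q⟩ ⟨j, q'⟩ hxy
      simp only at hxy
      rcases lt_trichotomy i j with hij | hij | hij
      · exact absurd hxy (key i j q q' hij)
      · subst hij
        have hi := i.2
        have hiK : 2 * (i : ℕ) < K := by omega
        -- Within one detour the first `N` vertices are distinct because it is a path with at least
        -- `N` edges.
        have hl : N ≤ (r (β (2 * i))).length := by
          have h1 := hlen _ hiK
          have h2 := hexc _ hiK
          by_contra hc
          have : (r (β (2 * i))).length * M < N * M :=
            Nat.mul_lt_mul_of_pos_right (not_le.1 hc) hM1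
          have : N * (2 * M) = N * M + N * M := by ring
          omega
        have hqq := (hrp _ (hβB _ hiK)).getVert_injOn
          (show (q : ℕ) ≤ _ by omega) (show (q' : ℕ) ≤ _ by omega) hxy
        exact Prod.ext rfl (Fin.ext hqq)
      · exact absurd hxy.symm (key j i q' q hij)
    simpa using Fintype.card_le_of_injective _ hinj
  -- The breakpoints are distinct vertices. This absorbs the terms linear in `J` that the rounding
  -- in `N` and `J` produces.
  have hKV : K ≤ Fintype.card V := by
    have hinj : Function.Injective fun m : B => v m := fun x y hxy => Subtype.ext
      (h.inj ((hBa _ x.2).trans hak) ((hBa _ y.2).trans hak) hxy)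
    simpa [hK] using Fintype.card_le_of_injective _ hinj
  have hN3 : (K - 1) / 2 < (N + 1) * (2 * M) := by
    rw [Nat.add_mul, hN]
    have := Nat.div_add_mod ((K - 1) / 2) (2 * M)
    have := Nat.mod_lt ((K - 1) / 2) (show 0 < 2 * M by omega)
    rw [Nat.mul_comm (2 * M)] at *
    omega
  have hK4 : K ≤ 4 * J := by omega
  have hK2 : K ≤ (N + 1) * (4 * M) + 1 := by
    have : (N + 1) * (4 * M) = 2 * ((N + 1) * (2 * M)) := by ring
    omega
  calc K ^ 2 ≤ 4 * J * ((N + 1) * (4 * M) + 1) := by rw [sq]; exact Nat.mul_le_mul hK4 hK2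
    _ = 16 * M * (J * N) + 16 * M * J + 4 * J := by ring
    _ ≤ 16 * M * Fintype.card V + 16 * M * Fintype.card V + 4 * (M * Fintype.card V) := by
        have hJV : J ≤ Fintype.card V := by omega
        have := Nat.mul_le_mul hM1 hJV
        gcongr
        linarith
    _ ≤ 40 * (Fintype.card V * M) := by nlinarith [Nat.zero_le (M * Fintype.card V)]

end Geodesic
end SSDSO

namespace SSDSO

/-! ### The number of changes of a sequence -/

/-- The number of changes in `A 0, …, A (N - 1)`. -/
def changes (A : ℕ → ℕ) (N : ℕ) : ℕ := ((Finset.Ico 1 N).filter fun p => A p ≠ A (p - 1)).card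

theorem changes_mono_of_imp {A B : ℕ → ℕ} {N : ℕ}
    (h : ∀ p, 1 ≤ p → p < N → A p ≠ A (p - 1) → B p ≠ B (p - 1)) : changes A N ≤ changes B N := by
  refine Finset.card_le_card fun p hp => ?_
  simp only [Finset.mem_filter, Finset.mem_Ico] at hp ⊢
  exact ⟨hp.1, h p hp.1.1 hp.1.2 hp.2⟩

theorem changes_succ (A : ℕ → ℕ) {N : ℕ} (hN : 1 ≤ N) :
    changes A (N + 1) = changes A N + if A N ≠ A (N - 1) then 1 else 0 := by
  unfold changes
  rw [Nat.Ico_succ_right_eq_insert_Ico hN, Finset.filter_insert]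
  split_ifs with h
  · rw [Finset.card_insert_of_notMem (by simp)]
  · simp

@[simp] theorem changes_one (A : ℕ → ℕ) : changes A 1 = 0 := by simp [changes]

/-- The number of blocks of length `r` among the first `N` blocks of `A` that differ from the block
before. -/
def blockChanges (A : ℕ → ℕ) (r N : ℕ) : ℕ :=
  ((Finset.Ico 1 N).filter fun j => ∃ q < r, A (j * r + q) ≠ A ((j - 1) * r + q)).card

theorem blockChanges_succ (A : ℕ → ℕ) (r : ℕ) {N : ℕ} (hN : 1 ≤ N) :
    blockChanges A r (N + 1) = blockChanges A r N +
      if ∃ q < r, A (N * r + q) ≠ A ((N - 1) * r + q) then 1 else 0 := by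
  unfold blockChanges
  rw [Nat.Ico_succ_right_eq_insert_Ico hN, Finset.filter_insert]
  split_ifs with h
  · rw [Finset.card_insert_of_notMem (by simp)]
  · simp

@[simp] theorem blockChanges_one (A : ℕ → ℕ) (r : ℕ) : blockChanges A r 1 = 0 := by
  simp [blockChanges]

theorem blockChanges_le_succ (A : ℕ → ℕ) (r N : ℕ) :
    blockChanges A r N ≤ blockChanges A r (N + 1) :=
  Finset.card_le_card (Finset.filter_subset_filter _ (Finset.Ico_subset_Ico_right (by omega)))

theorem blockChanges_mono (A : ℕ → ℕ) (r : ℕ) : Monotone (blockChanges A r) :=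
  monotone_nat_of_le_succ (blockChanges_le_succ A r)

/-- If the blocks `j - 1` and `j` differ at offset `q`, the array changes somewhere between these
two entries, hence at a position in block `j - 1` or in block `j`. So each change is charged at most
twice. -/
theorem blockChanges_le (A : ℕ → ℕ) (r N : ℕ) :
    blockChanges A r N ≤ 2 * changes A (N * r) := by
  classical
  unfold blockChanges
  set S := (Finset.Ico 1 (N * r)).filter fun p => A p ≠ A (p - 1) with hS
  have hsub : ((Finset.Ico 1 N).filter fun j => ∃ q < r, A (j * r + q) ≠ A ((j - 1) * r + q)) ⊆
      S.image (fun p => p / r) ∪ S.image (fun p => p / r + 1) := by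
    intro j hj
    simp only [Finset.mem_filter, Finset.mem_Ico] at hj
    obtain ⟨⟨hj1, hjN⟩, q, hq, hne⟩ := hj
    have hjr : (j - 1) * r + r = j * r := by
      rw [← Nat.succ_mul]; congr 1; omega
    have hNr : (j + 1) * r ≤ N * r := Nat.mul_le_mul_right r hjN
    rw [Nat.succ_mul] at hNr
    obtain ⟨p, hp1, hp2, hp⟩ : ∃ p, (j - 1) * r + q < p ∧ p ≤ j * r + q ∧ A p ≠ A (p - 1) := by
      by_contra hc
      push Not at hc
      have : ∀ d, d ≤ r → A ((j - 1) * r + q + d) = A ((j - 1) * r + q) := by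
        intro d
        induction d with
        | zero => simp
        | succ d ih =>
          intro hd
          rw [← ih (by omega)]
          have := hc ((j - 1) * r + q + (d + 1)) (by omega) (by omega)
          simpa using this
      apply hne
      rw [← this r le_rfl]
      congr 1
      omega
    have hpS : p ∈ S := by
      simp only [hS, Finset.mem_filter, Finset.mem_Ico]
      exact ⟨⟨by omega, by omega⟩, hp⟩
    have hr : 0 < r := by omega
    rw [Finset.mem_union, Finset.mem_image, Finset.mem_image]
    by_cases hpj : j * r ≤ p
    · left
      refine ⟨p, hpS, ?_⟩
      exact Nat.div_eq_of_lt_le hpj (by rw [Nat.succ_mul]; omega)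
    · right
      refine ⟨p, hpS, ?_⟩
      have : p / r = j - 1 := Nat.div_eq_of_lt_le (by omega) (by
        rw [Nat.add_one_mul]; omega)
      omega
  have h1 := Finset.card_le_card hsub
  have h2 := Finset.card_union_le (S.image (fun p => p / r)) (S.image (fun p => p / r + 1))
  have h3 := Finset.card_image_le (s := S) (f := fun p => p / r)
  have h4 := Finset.card_image_le (s := S) (f := fun p => p / r + 1)
  have h5 : S.card = changes A (N * r) := rfl
  omega

/-! ### The input of the preprocessing -/

/-- The input, with vertices as numbers: the answers of the oracle, the depths in the tree
and the distances along the tree from the root of the component. -/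
structure Inp (w : ℕ) (O : Oracle) where
  n : ℕ
  M : ℕ
  s : ℕ
  par : ℕ → ℕ
  wgt : ℕ → ℕ
  val : ℕ → ℕ → ℕ
  dep : ℕ → ℕ
  len : ℕ → ℕ
  hM : 1 ≤ M
  hs : s < n
  big : (n + M + 1) ^ 20 ≤ 2 ^ w
  ask_par : ∀ c < n, ∀ b, O .parent c b % 2 ^ w = par c
  ask_wgt : ∀ c < n, ∀ b, O .weight c b % 2 ^ w = wgt c
  ask_val : ∀ t < n, ∀ c < n, O .replDist t c % 2 ^ w = val t c
  par_le : ∀ c < n, par c ≤ n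
  dep_lt : ∀ c < n, dep c < n
  dep_zero : ∀ c < n, par c = n → dep c = 0
  dep_succ : ∀ c < n, par c < n → dep c = dep (par c) + 1
  len_zero : ∀ c < n, par c = n → len c = 0
  len_succ : ∀ c < n, par c < n → len c = len (par c) + wgt c
  len_le : ∀ c < n, len c ≤ n * M
  val_le : ∀ t < n, ∀ c < n, val t c = 2 ^ w - 1 ∨ val t c ≤ n * M

namespace Inp

variable {w : ℕ} {O : Oracle} (T : Inp w O)

/-- The word for `∞`. -/
def inf (_ : Inp w O) : ℕ := 2 ^ w - 1

/-- The `j`-th ancestor. -/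
def up (t j : ℕ) : ℕ := T.par^[j] t

/-- The ancestor at depth `i`. -/
def anc (t i : ℕ) : ℕ := T.up t (T.dep t - i)

/-- The distance from the source as a word. -/
noncomputable def dst (t : ℕ) : ℕ := if T.anc t 0 = T.s then T.len t else T.inf

/-- The start of the scratch memory. -/
def Z : ℕ := 64 * (T.n + 1) ^ 3

/-- The end of the records of the vertices. -/
def base : ℕ := 8 + 8 * T.n

/-- The pivot of a vertex. -/
def piv (L ρ t : ℕ) : ℕ := T.anc t (T.dep t - (T.dep t - ρ) % L)

/-- The length of a shortest replacement path via the pivot. -/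
noncomputable def via (L ρ t i : ℕ) : ℕ :=
  if T.val (T.piv L ρ t) (T.anc t i) = T.inf then T.inf
  else T.val (T.piv L ρ t) (T.anc t i) + (T.dst t - T.dst (T.piv L ρ t))

/-- The least replacement distance for a failure at depth at most `i` for which a path via the
pivot is too long. -/
noncomputable def far (L ρ t : ℕ) : ℕ → ℕ
  | 0 => T.inf
  | i + 1 =>
    if i + 1 ≤ T.dep t - L ∧ T.val t (T.anc t (i + 1)) < T.via L ρ t (i + 1) ∧
        T.val t (T.anc t (i + 1)) < far L ρ t i then T.val t (T.anc t (i + 1))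
    else far L ρ t i

theorem up_zero (t : ℕ) : T.up t 0 = t := rfl

theorem up_succ (t j : ℕ) : T.up t (j + 1) = T.par (T.up t j) :=
  Function.iterate_succ_apply' _ _ _

theorem up_add (t i j : ℕ) : T.up (T.up t i) j = T.up t (j + i) :=
  (Function.iterate_add_apply _ _ _ _).symm

theorem n_pos : 0 < T.n := Nat.zero_lt_of_lt T.hs

theorem up_spec {t : ℕ} (ht : t < T.n) :
    ∀ j ≤ T.dep t, T.up t j < T.n ∧ T.dep (T.up t j) = T.dep t - j
  | 0, _ => ⟨ht, rfl⟩
  | j + 1, hj => by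
    obtain ⟨h1, h2⟩ := up_spec ht j (by omega)
    have h3 : T.par (T.up t j) < T.n := by
      refine lt_of_le_of_ne (T.par_le _ h1) fun h => ?_
      have := T.dep_zero _ h1 h
      omega
    rw [up_succ]
    refine ⟨h3, ?_⟩
    have := T.dep_succ _ h1 h3
    omega

theorem up_lt {t j : ℕ} (ht : t < T.n) (hj : j ≤ T.dep t) : T.up t j < T.n :=
  (T.up_spec ht j hj).1

theorem dep_up {t j : ℕ} (ht : t < T.n) (hj : j ≤ T.dep t) : T.dep (T.up t j) = T.dep t - j :=
  (T.up_spec ht j hj).2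

theorem par_up_dep {t : ℕ} (ht : t < T.n) : T.par (T.up t (T.dep t)) = T.n := by
  obtain ⟨h1, h2⟩ := T.up_spec ht _ le_rfl
  by_contra hc
  have := T.dep_succ _ h1 (lt_of_le_of_ne (T.par_le _ h1) hc)
  omega

theorem anc_lt {t : ℕ} (ht : t < T.n) (i : ℕ) : T.anc t i < T.n := T.up_lt ht (Nat.sub_le _ _)

theorem dep_anc {t i : ℕ} (ht : t < T.n) (hi : i ≤ T.dep t) : T.dep (T.anc t i) = i := by
  rw [anc, T.dep_up ht (Nat.sub_le _ _)]; omega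

theorem anc_dep (t : ℕ) : T.anc t (T.dep t) = t := by simp [anc, up_zero]

theorem anc_anc {t i j : ℕ} (ht : t < T.n) (hi : i ≤ T.dep t) (hj : j ≤ i) :
    T.anc (T.anc t i) j = T.anc t j := by
  rw [anc, T.dep_anc ht hi, anc, up_add, anc]
  congr 1
  omega

theorem par_anc {t i : ℕ} (hi : i + 1 ≤ T.dep t) :
    T.par (T.anc t (i + 1)) = T.anc t i := by
  rw [anc, ← up_succ, anc]; congr 1; omega

theorem len_up {t : ℕ} (ht : t < T.n) {j : ℕ} (hj : j ≤ T.dep t) :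
    T.len (T.up t j) + ∑ i ∈ Finset.range j, T.wgt (T.up t i) = T.len t := by
  induction j with
  | zero => simp [up_zero]
  | succ j ih =>
    rw [Finset.sum_range_succ, ← ih (by omega), up_succ]
    have := T.len_succ _ (T.up_lt ht (by omega : j ≤ T.dep t))
      (by rw [← up_succ]; exact T.up_lt ht hj)
    omega

theorem sum_wgt_up {t : ℕ} (ht : t < T.n) :
    ∑ i ∈ Finset.range (T.dep t), T.wgt (T.up t i) = T.len t := by
  have h1 := T.len_up ht le_rfl
  have h2 := T.len_zero _ (T.up_lt ht le_rfl) (T.par_up_dep ht)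
  omega

theorem piv_lt {L ρ t : ℕ} (ht : t < T.n) : T.piv L ρ t < T.n := T.anc_lt ht _

/-- Whether `dst` is `inf` is decided by the root, so it is the same for `t` and its ancestors; if
it is `inf`, the difference is `0`. Therefore the subtraction in `via` needs no test for `∞`. -/
theorem dst_sub_le {t : ℕ} (ht : t < T.n) (i : ℕ) :
    T.dst (T.anc t i) ≤ T.dst t ∧ T.dst t - T.dst (T.anc t i) ≤ T.n * T.M := by
  have h1 := T.len_up ht (Nat.sub_le (T.dep t) i)
  have h2 : T.anc (T.anc t i) 0 = T.anc t 0 := by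
    rw [anc, anc, up_add, T.dep_up ht (Nat.sub_le _ _), anc]
    congr 1
    omega
  have h3 := T.len_le t ht
  unfold dst
  rw [h2]
  change T.len (T.anc t i) + _ = _ at h1
  split_ifs
  · exact ⟨by omega, by omega⟩
  · exact ⟨le_rfl, by simp⟩

theorem far_eq_of_lt {L ρ t i : ℕ} (h : T.dep t - L < i) : T.far L ρ t i = T.far L ρ t (i - 1) := by
  obtain ⟨i, rfl⟩ : ∃ j, i = j + 1 := ⟨i - 1, by omega⟩
  rw [far, if_neg (by omega)]; rfl

theorem far_change {L ρ t i : ℕ} (hi : 1 ≤ i) (h : T.far L ρ t i ≠ T.far L ρ t (i - 1)) :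
    i ≤ T.dep t - L ∧ T.val t (T.anc t i) < T.via L ρ t i ∧
      T.val t (T.anc t i) < T.far L ρ t (i - 1) ∧ T.far L ρ t i = T.val t (T.anc t i) := by
  obtain ⟨i, rfl⟩ : ∃ j, i = j + 1 := ⟨i - 1, by omega⟩
  rw [far] at h ⊢
  split_ifs at h ⊢ with hc
  · exact ⟨hc.1, hc.2.1, hc.2.2, rfl⟩
  · exact absurd rfl h

theorem far_antitone {L ρ t : ℕ} : Antitone (T.far L ρ t) := by
  refine antitone_nat_of_succ_le fun i => ?_
  rw [far]
  split_ifs with hc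
  · exact hc.2.2.le
  · rfl

theorem far_le {L ρ t i j : ℕ} (hi : 1 ≤ i) (hij : i ≤ j) (hiL : i ≤ T.dep t - L)
    (h : T.val t (T.anc t i) < T.via L ρ t i) : T.far L ρ t j ≤ T.val t (T.anc t i) := by
  refine (T.far_antitone hij).trans ?_
  obtain ⟨i, rfl⟩ : ∃ j, i = j + 1 := ⟨i - 1, by omega⟩
  rw [far]
  split_ifs with hc
  · rfl
  · simp only [not_and, not_lt] at hc
    exact hc hiL h

/-- The value is `∞`, or the replacement distance of an earlier position. -/
theorem far_cases {L ρ t : ℕ} : ∀ i, T.far L ρ t i = T.inf ∨ ∃ j, 1 ≤ j ∧ j ≤ i ∧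
    j ≤ T.dep t - L ∧ T.val t (T.anc t j) < T.via L ρ t j ∧ T.far L ρ t i = T.val t (T.anc t j)
  | 0 => Or.inl rfl
  | i + 1 => by
    by_cases h : T.far L ρ t (i + 1) = T.far L ρ t i
    · rw [h]
      rcases far_cases i with h | ⟨j, h1, h2, h3⟩
      · exact Or.inl h
      · exact Or.inr ⟨j, h1, by omega, h3⟩
    · obtain ⟨h1, h2, h3, h4⟩ := T.far_change (by omega) h
      exact Or.inr ⟨i + 1, by omega, le_rfl, h1, h2, h4⟩

/-- A crude bound that involves no graph. It keeps the output below `Z` (`total_le`) and settles the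
case `r = 1` of `cube_mul_le`. -/
theorem changes_far_le {L ρ t : ℕ} (ht : t < T.n) (N : ℕ) : changes (T.far L ρ t) N ≤ T.n := by
  have : ((Finset.Ico 1 N).filter fun p => T.far L ρ t p ≠ T.far L ρ t (p - 1)) ⊆
      Finset.range T.n := fun p hp => by
    simp only [Finset.mem_filter, Finset.mem_Ico] at hp
    have h1 := (T.far_change hp.1.1 hp.2).1
    have h2 := T.dep_lt t ht
    rw [Finset.mem_range]
    omega
  simpa [changes] using Finset.card_le_card this

/-! Bounds that exclude overflows. -/

theorem le_Z : 64 * (T.n + 1) ≤ T.Z := by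
  unfold Z
  have : T.n + 1 ≤ (T.n + 1) ^ 3 := Nat.le_self_pow (by norm_num) _
  omega

/-- As `n + M + 1 ≥ 3`, a constant up to `3 ^ a` is absorbed by `a` more factors of the base.
`Z_bound`, `len_bound` and `cube_bound` derive from `big` in this way. -/
theorem pow_bound (C a b : ℕ) (hC : C ≤ 3 ^ a) (hab : a + b ≤ 20) :
    C * (T.n + M T + 1) ^ b ≤ 2 ^ w := by
  have h3 : 3 ≤ T.n + T.M + 1 := by have := T.n_pos; have := T.hM; omega
  calc C * (T.n + T.M + 1) ^ b ≤ (T.n + T.M + 1) ^ a * (T.n + T.M + 1) ^ b :=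
        Nat.mul_le_mul_right _ (hC.trans (Nat.pow_le_pow_left h3 a))
    _ = (T.n + T.M + 1) ^ (a + b) := (pow_add _ _ _).symm
    _ ≤ (T.n + T.M + 1) ^ 20 := Nat.pow_le_pow_right (by omega) hab
    _ ≤ 2 ^ w := T.big

theorem Z_bound : 16 * T.Z ≤ 2 ^ w := by
  refine le_trans ?_ (T.pow_bound 1024 7 3 (by norm_num) (by norm_num))
  unfold Z
  have : (T.n + 1) ^ 3 ≤ (T.n + T.M + 1) ^ 3 := Nat.pow_le_pow_left (by omega) 3
  omega

theorem len_bound : 8 * (T.n * T.M + T.n + 1) ≤ 2 ^ w := by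
  refine le_trans ?_ (T.pow_bound 8 2 2 (by norm_num) (by norm_num))
  have : T.n * T.M + T.n + 1 ≤ (T.n + T.M + 1) ^ 2 := by nlinarith
  omega

end Inp
end SSDSO

namespace SSDSO

open Ex Prog

variable {w : ℕ} {O : Oracle}

/-! ### Compression of an array -/

/-- Copy the block at `r 27` of length `r 3` to `r 6`; set `r 25` to a number other than `0` if it
differs from the block at `r 24`. -/
def copyBlock : Prog := block [
  set 25 (c 0), set 26 (c 0),
  while' (lt (r 26) (r 3)) (block [
    put (r 6 + r 26) (ld (r 27 + r 26)),
    cond (eq (ld (r 24 + r 26)) (ld (r 27 + r 26))) skip (set 25 (c 1)),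
    set 26 (r 26 + c 1)])]

/-- Copying and comparing share one pass. The old block at `ℓ`, the copy at `ℓ + b` and the source
at `sp` are disjoint, so the copy disturbs neither side of the comparison. It becomes permanent only
if the caller then moves the free pointer. -/
theorem copyBlock_spec {τ : State} {t : ℕ} {Q : State → ℕ → Prop} {ℓ b sp : ℕ} {A : ℕ → ℕ}
    (h3 : τ.reg 3 = b) (h6 : τ.reg 6 = ℓ + b) (h24 : τ.reg 24 = ℓ) (h27 : τ.reg 27 = sp)
    (hA : ∀ q < b, τ.mem (sp + q) = A q) (hdisj : ℓ + 2 * b ≤ sp) (hsp : sp + b < 2 ^ w)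
    (hw : 1 < 2 ^ w)
    (hQ : ∀ τ' t', (∀ i, i ≠ 25 → i ≠ 26 → τ'.reg i = τ.reg i) →
      (∀ q < b, τ'.mem (ℓ + b + q) = A q) →
      (∀ a, a < ℓ + b ∨ ℓ + 2 * b ≤ a → τ'.mem a = τ.mem a) →
      (τ'.reg 25 = 0 ↔ ∀ q < b, τ.mem (ℓ + q) = A q) → t' ≤ t + (40 * b + 40) → Q τ' t') :
    wp w O copyBlock τ t Q := by
  refine wp_cons (wp_set rfl (wp_cons (wp_set rfl (wp_cons ?_))))
  refine wp_while (fun j σ => (∀ i, i ≠ 25 → i ≠ 26 → σ.reg i = τ.reg i) ∧ σ.reg 26 = j ∧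
      (∀ q < j, σ.mem (ℓ + b + q) = A q) ∧
      (∀ a, a < ℓ + b ∨ ℓ + 2 * b ≤ a → σ.mem a = τ.mem a) ∧
      (σ.reg 25 = 0 ↔ ∀ q < j, τ.mem (ℓ + q) = A q)) b 35 rfl ?_ ?_ ?_ ?_ ?_
  · simp +contextual
  · rintro j σ hj ⟨hr, h26, -⟩
    simp [h26, hr 3, h3, hj, Nat.mod_eq_of_lt hw]
  · rintro σ ⟨hr, h26, -⟩
    simp [h26, hr 3, h3]
  · rintro j σ u hj ⟨hr, h26, hc, hf, hd⟩
    have e6 := hr 6 (by decide) (by decide)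
    have e24 := hr 24 (by decide) (by decide)
    have e27 := hr 27 (by decide) (by decide)
    rw [h6] at e6
    rw [h24] at e24
    rw [h27] at e27
    have hsj : σ.mem (sp + j) = A j := by rw [hf _ (Or.inr (by omega)), hA j hj]
    have hlj : σ.mem (ℓ + j) = τ.mem (ℓ + j) := hf _ (Or.inl (by omega))
    refine wp_cons (wp_put rfl rfl (wp_cons ?_))
    have m1 : (ℓ + b + j) % 2 ^ w = ℓ + b + j := Nat.mod_eq_of_lt (by omega)
    have m2 : (sp + j) % 2 ^ w = sp + j := Nat.mod_eq_of_lt (by omega)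
    have m3 : (ℓ + j) % 2 ^ w = ℓ + j := Nat.mod_eq_of_lt (by omega)
    have m4 : (j + 1) % 2 ^ w = j + 1 := Nat.mod_eq_of_lt (by omega)
    have m5 : 1 % 2 ^ w = 1 := Nat.mod_eq_of_lt hw
    have hb0 : b ≠ 0 := by omega
    have hcopy : ∀ q < j + 1, (if ℓ + b + q = ℓ + b + j then A j else σ.mem (ℓ + b + q)) = A q := by
      intro q hq
      split_ifs with hqj
      · congr 1; omega
      · exact hc q (by omega)
    have hframe : ∀ a, a < ℓ + b ∨ ℓ + 2 * b ≤ a →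
        (if a = ℓ + b + j then A j else σ.mem a) = τ.mem a := by
      intro a ha
      rw [if_neg (by omega), hf a ha]
    refine wp_cond rfl (fun hne => wp_skip ?_) fun heq => wp_set rfl ?_
    · have hAj : τ.mem (ℓ + j) = A j := by
        by_contra hcon
        simp [e6, h26, e24, e27, m1, m2, m3, hsj, hlj, hb0, hcon] at hne
      refine wp_cons (wp_set rfl (wp_nil ⟨⟨?_, ?_, ?_, ?_, ?_⟩, ?_⟩))
      · intro i hi1 hi2; simp [hi2, hr i hi1 hi2]
      · simp [h26, m5, m4]
      · simpa [e6, h26, e27, m1, m2, hsj] using hcopy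
      · simpa [e6, h26, e27, m1, m2, hsj] using hframe
      · simp only [State.setReg_reg, State.setMem_reg, reduceIte, Nat.reduceEqDiff, hd]
        rw [Nat.forall_lt_succ_right]; simp [hAj]
      · simp
    · have hAj : τ.mem (ℓ + j) ≠ A j := by
        intro hcon
        simp [e6, h26, e24, e27, m1, m2, m3, hsj, hlj, hb0, hcon, m5] at heq
      refine wp_cons (wp_set rfl (wp_nil ⟨⟨?_, ?_, ?_, ?_, ?_⟩, ?_⟩))
      · intro i hi1 hi2; simp [hi2, hi1, hr i hi1 hi2]
      · simp [h26, m5, m4]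
      · simpa [e6, h26, e27, m1, m2, hsj] using hcopy
      · simpa [e6, h26, e27, m1, m2, hsj] using hframe
      · simp only [State.setReg_reg, State.setMem_reg, reduceIte, Nat.reduceEqDiff, eval_c, m5]
        rw [Nat.forall_lt_succ_right]; simp [hAj]
      · simp
  · rintro σ u ⟨hr, h26, hc, hf, hd⟩ hu
    refine wp_nil (hQ σ _ hr hc hf hd ?_)
    simp at hu
    omega

/-- The first `j` entries of the directory at `dir` are pointers to the blocks of `A`. -/
structure Compressed (mem A : ℕ → ℕ) (b p ℓ dir j : ℕ) : Prop where
  entry : ∀ i < j, p ≤ mem (dir + i) ∧ mem (dir + i) ≤ ℓ ∧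
    ∀ q < b, mem (mem (dir + i) + q) = A (i * b + q)
  last : 1 ≤ j → mem (dir + (j - 1)) = ℓ
  changes_le : changes (fun i => mem (dir + i)) j ≤ blockChanges A b j

theorem Compressed.zero (mem A : ℕ → ℕ) (b p ℓ dir : ℕ) : Compressed mem A b p ℓ dir 0 :=
  ⟨by simp, by simp, by simp [changes]⟩

theorem Compressed.ne_of_ne {mem A : ℕ → ℕ} {b p ℓ dir j : ℕ} (h : Compressed mem A b p ℓ dir j)
    (hj : 1 ≤ j) (hne : ¬ ∀ q < b, mem (ℓ + q) = A (j * b + q)) :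
    ∃ q < b, A (j * b + q) ≠ A ((j - 1) * b + q) := by
  by_contra hcon
  push Not at hcon
  refine hne fun q hq => ?_
  rw [hcon q hq, ← (h.entry (j - 1) (by omega)).2.2 q hq, h.last hj]

/-- `x = ℓ` reuses the preceding block, `x = ℓ + b` keeps the fresh copy and is paid for by a change
of blocks. For `j = 0` nothing has to be paid, since changes are counted from position `1` on. -/
theorem Compressed.step {mem mem₁ A : ℕ → ℕ} {b p ℓ dir j x : ℕ}
    (h : Compressed mem A b p ℓ dir j) (hp : p ≤ ℓ)
    (hmem : ∀ a, a < ℓ + b ∨ ℓ + 2 * b ≤ a → mem₁ a = mem a)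
    (hdir : dir + j < p ∨ ℓ + 2 * b ≤ dir)
    (hx : x = ℓ ∨ x = ℓ + b ∧ (1 ≤ j → ∃ q < b, A (j * b + q) ≠ A ((j - 1) * b + q)))
    (hxA : ∀ q < b, mem₁ (x + q) = A (j * b + q)) :
    Compressed (fun a => if a = dir + j then x else mem₁ a) A b p x dir (j + 1) := by
  have hx1 : ℓ ≤ x ∧ x ≤ ℓ + b := by omega
  have hDj : ∀ i < j, mem₁ (dir + i) = mem (dir + i) := fun i hi => hmem _ (by omega)
  refine ⟨fun i hi => ?_, fun _ => by simp, ?_⟩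
  · by_cases hij : i = j
    · subst hij
      simp only [reduceIte]
      refine ⟨by omega, le_rfl, fun q hq => ?_⟩
      rw [if_neg (by omega), hxA q hq]
    · have hi' : i < j := by omega
      obtain ⟨k1, k2, k3⟩ := h.entry i hi'
      simp only [Nat.add_left_cancel_iff, hij, if_false, hDj i hi']
      refine ⟨k1, by omega, fun q hq => ?_⟩
      rw [if_neg (by omega), hmem _ (by omega), k3 q hq]
  · rcases Nat.eq_zero_or_pos j with rfl | hj1
    · simp
    · rw [changes_succ _ hj1, blockChanges_succ _ _ hj1]
      refine add_le_add (le_trans (changes_mono_of_imp fun i hi1 hij hne => ?_) h.changes_le) ?_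
      · simp only [Nat.add_left_cancel_iff] at hne
        rw [if_neg (by omega), if_neg (by omega), hDj i (by omega),
          hDj (i - 1) (by omega)] at hne
        exact hne
      · simp only [Nat.add_left_cancel_iff, reduceIte]
        rw [if_neg (show j - 1 ≠ j by omega), hDj (j - 1) (by omega), h.last hj1]
        rcases hx with hx | hx
        · simp [hx]
        · rw [if_pos (hx.2 hj1)]
          split_ifs <;> simp

/-- The invariant of the loop of `compress`. -/
structure CompressInv (τ : State) (A : ℕ → ℕ) (p b src N dir Z j : ℕ) (σ : State) : Prop where
  frame : ∀ i, i < 23 → i ≠ 6 → σ.reg i = τ.reg i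
  r23 : σ.reg 23 = j
  r27 : σ.reg 27 = src + j * b
  r6 : σ.reg 6 = σ.reg 24 + b
  le : p ≤ σ.reg 24
  bound : σ.reg 24 ≤ p + b * blockChanges A b j + if j = 0 then 0 else b
  mem : ∀ a, a < p ∨ Z ≤ a → a < dir ∨ dir + N ≤ a → σ.mem a = τ.mem a
  compressed : Compressed σ.mem A b p (σ.reg 24) dir j

/-- The body of the loop of `compress`. -/
def compressBody : Prog := block [
    copyBlock,
    cond (r 25) (block [set 24 (r 6), set 6 (r 6 + r 3)]) skip,
    put (r 22 + r 23) (r 24),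
    set 27 (r 27 + r 3),
    set 23 (r 23 + c 1)]

theorem compressBody_spec {τ σ : State} {u : ℕ} {p b src N dir Z j : ℕ} {A : ℕ → ℕ}
    (h3 : τ.reg 3 = b) (h22 : τ.reg 22 = dir) (hA : ∀ i < N * b, τ.mem (src + i) = A i)
    (hZ : p + b * (2 * changes A (N * b)) + 3 * b ≤ Z) (hsrc : Z ≤ src)
    (hsrcw : src + N * b < 2 ^ w)
    (hdir : dir + N ≤ p ∨ Z ≤ dir ∧ src + N * b ≤ dir) (hdirw : dir + N < 2 ^ w)
    (hw : 1 < 2 ^ w) (hj : j < N) (hI : CompressInv τ A p b src N dir Z j σ) :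
    wp w O compressBody σ u fun σ' u' =>
      CompressInv τ A p b src N dir Z (j + 1) σ' ∧ u' ≤ u + (40 * b + 70) := by
  have e3 : σ.reg 3 = b := (hI.frame 3 (by decide) (by decide)).trans h3
  have e22 : σ.reg 22 = dir := (hI.frame 22 (by decide) (by decide)).trans h22
  have hjb : j * b + b ≤ N * b := by
    rw [← Nat.succ_mul]; exact Nat.mul_le_mul_right b hj
  have hℓ' : σ.reg 24 + 2 * b ≤ Z := by
    have h1 := hI.bound
    have h2 : b * blockChanges A b j ≤ b * (2 * changes A (N * b)) := Nat.mul_le_mul_left b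
      ((blockChanges_mono A b hj.le).trans (blockChanges_le A b N))
    have h3 : (if j = 0 then 0 else b) ≤ b := by split_ifs <;> simp
    omega
  refine wp_cons (copyBlock_spec (ℓ := σ.reg 24) (b := b) (sp := src + j * b)
    (A := fun q => A (j * b + q)) e3 hI.r6 rfl hI.r27 ?_ (by omega) (by omega) hw ?_)
  · intro q hq
    rw [hI.mem _ (Or.inr (by omega)) (by omega), Nat.add_assoc, hA _ (by omega)]
  intro σ₁ u₁ hr₁ hc₁ hf₁ hd₁ hu₁
  -- Both branches of the conditional continue here; register `24` holds the slot chosen for block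
  -- `j`.
  have tail : ∀ σ₂ u₂, σ₂.mem = σ₁.mem → (∀ i, i ≠ 6 → i ≠ 24 → σ₂.reg i = σ₁.reg i) →
      σ₂.reg 6 = σ₂.reg 24 + b → (σ₂.reg 24 = σ.reg 24 ∨ σ₂.reg 24 = σ.reg 24 + b ∧
        (1 ≤ j → ∃ q < b, A (j * b + q) ≠ A ((j - 1) * b + q))) →
      (∀ q < b, σ₁.mem (σ₂.reg 24 + q) = A (j * b + q)) → u₂ ≤ u₁ + 10 →
      wp w O (block [put (r 22 + r 23) (r 24), set 27 (r 27 + r 3), set 23 (r 23 + c 1)]) σ₂ u₂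
        fun σ' u' => CompressInv τ A p b src N dir Z (j + 1) σ' ∧ u' ≤ u + (40 * b + 70) := by
    intro σ₂ u₂ hm₂ hr₂ h6₂ hx hxA hu₂
    have hr : ∀ i, i < 24 → i ≠ 6 → σ₂.reg i = σ.reg i := fun i hi hi6 =>
      (hr₂ i hi6 (by omega)).trans (hr₁ i (by omega) (by omega))
    have g3 : σ₂.reg 3 = b := (hr 3 (by decide) (by decide)).trans e3
    have g22 : σ₂.reg 22 = dir := (hr 22 (by decide) (by decide)).trans e22
    have g23 : σ₂.reg 23 = j := (hr 23 (by decide) (by decide)).trans hI.r23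
    have g27 : σ₂.reg 27 = src + j * b := (hr₂ 27 (by decide) (by decide)).trans
      ((hr₁ 27 (by decide) (by decide)).trans hI.r27)
    have m1 : (dir + j) % 2 ^ w = dir + j := Nat.mod_eq_of_lt (by omega)
    have m2 : (src + j * b + b) % 2 ^ w = src + j * b + b := Nat.mod_eq_of_lt (by omega)
    have m3 : (j + 1) % 2 ^ w = j + 1 := Nat.mod_eq_of_lt (by omega)
    have hlele := hI.le
    have hstep := hI.compressed.step hI.le hf₁ (by omega) hx hxA
    refine wp_cons (wp_put rfl rfl (wp_cons (wp_set rfl (wp_cons (wp_set rfl (wp_nil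
      ⟨⟨fun i hi hi6 => ?_, ?_, ?_, ?_, ?_, ?_, fun a ha ha' => ?_, ?_⟩, ?_⟩))))))
    · simp [show i ≠ 23 by omega, show i ≠ 27 by omega, hr i (by omega) hi6, hI.frame i hi hi6]
    · simp [g23, m3, Nat.mod_eq_of_lt hw]
    · simp [g27, g3, m2, Nat.succ_mul]
      omega
    · simp [h6₂]
    · simp
      omega
    · simp only [State.setReg_reg, State.setMem_reg, Nat.reduceEqDiff, if_false,
        Nat.add_eq_zero_iff, one_ne_zero, and_false]
      have hb := hI.bound
      rcases hx with hx | ⟨hx, hx'⟩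
      · rw [hx]
        have := Nat.mul_le_mul_left b (blockChanges_le_succ A b j)
        have h3 : (if j = 0 then 0 else b) ≤ b := by split_ifs <;> simp
        omega
      · rw [hx]
        rcases Nat.eq_zero_or_pos j with rfl | hj1
        · simp [blockChanges] at hb ⊢
          omega
        · rw [blockChanges_succ _ _ hj1, if_pos (hx' hj1), Nat.mul_add]
          rw [if_neg (by omega)] at hb
          omega
    · have : a ≠ dir + j := by omega
      simp [g22, g23, m1, this, hm₂]
      rw [hf₁ a (by omega), hI.mem a ha ha']
    · simp only [State.setReg_reg, State.setMem_reg, State.setReg_mem, Nat.reduceEqDiff, if_false]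
      convert hstep using 1
      funext a
      simp [g22, g23, m1, hm₂]
    · simp
      omega
  refine wp_cons (wp_cond rfl (fun hne => ?_) fun heq => ?_)
  · have g3 : σ₁.reg 3 = b := (hr₁ 3 (by decide) (by decide)).trans e3
    have g6 : σ₁.reg 6 = σ.reg 24 + b := (hr₁ 6 (by decide) (by decide)).trans hI.r6
    have m4 : (σ.reg 24 + b + b) % 2 ^ w = σ.reg 24 + b + b := Nat.mod_eq_of_lt (by omega)
    refine wp_cons (wp_set rfl (wp_cons (wp_set rfl (wp_nil (tail _ _ rfl ?_ ?_ ?_ ?_ ?_)))))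
    · intro i hi1 hi2
      simp [hi1, hi2]
    · simp [g3, g6, m4]
    · right
      refine ⟨by simp [g6], fun hj1 => hI.compressed.ne_of_ne hj1 fun hcon => hne (hd₁.2 hcon)⟩
    · simpa [g6] using hc₁
    · simp
  · have g24 : σ₁.reg 24 = σ.reg 24 := hr₁ 24 (by decide) (by decide)
    refine wp_skip (tail _ _ rfl (fun _ _ _ => rfl) ?_ (Or.inl g24) ?_ ?_)
    · rw [hr₁ 6 (by decide) (by decide), g24, hI.r6]
    · intro q hq
      rw [g24, hf₁ _ (by omega)]
      exact hd₁.1 heq q hq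
    · simp

/-- Write the distinct blocks of length `r 3` of the array at `r 20` consisting of `r 21` blocks to
`r 6`, and pointers to the blocks to the array at `r 22`. -/
def compress : Prog := block [
  set 24 (r 6), set 6 (r 6 + r 3), set 23 (c 0), set 27 (r 20),
  while' (lt (r 23) (r 21)) compressBody]

/-- The first block is compared with whatever the slot at `p` contains: a match is still correct, a
mismatch wastes one slot. This accounts for `2 * changes + 2` slots in the output; one more is
working space for the next tentative copy. -/
theorem compress_spec {τ : State} {t : ℕ} {Q : State → ℕ → Prop} {p b src N dir Z : ℕ} {A : ℕ → ℕ}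
    (h3 : τ.reg 3 = b) (h6 : τ.reg 6 = p) (h20 : τ.reg 20 = src) (h21 : τ.reg 21 = N)
    (h22 : τ.reg 22 = dir) (hA : ∀ i < N * b, τ.mem (src + i) = A i)
    (hZ : p + b * (2 * changes A (N * b) + 3) ≤ Z) (hsrc : Z ≤ src) (hsrcw : src + N * b < 2 ^ w)
    (hdir : dir + N ≤ p ∨ Z ≤ dir ∧ src + N * b ≤ dir) (hdirw : dir + N < 2 ^ w) (hN : 1 ≤ N)
    (hw : 1 < 2 ^ w)
    (hQ : ∀ τ' t', (∀ i, i < 20 → i ≠ 6 → τ'.reg i = τ.reg i) →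
      p ≤ τ'.reg 6 → τ'.reg 6 ≤ p + b * (2 * changes A (N * b) + 2) →
      (∀ a, a < p ∨ Z ≤ a → a < dir ∨ dir + N ≤ a → τ'.mem a = τ.mem a) →
      (∀ j < N, p ≤ τ'.mem (dir + j) ∧ τ'.mem (dir + j) + b ≤ τ'.reg 6 ∧
        ∀ q < b, τ'.mem (τ'.mem (dir + j) + q) = A (j * b + q)) →
      changes (fun j => τ'.mem (dir + j)) N ≤ 2 * changes A (N * b) →
      t' ≤ t + (N * (40 * b + 80) + 40) → Q τ' t') :
    wp w O compress τ t Q := by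
  have hlim : b * blockChanges A b N ≤ b * (2 * changes A (N * b)) :=
    Nat.mul_le_mul_left b (blockChanges_le A b N)
  have hb3 : b * (2 * changes A (N * b) + 3) = b * (2 * changes A (N * b)) + 3 * b := by ring
  have hb2 : b * (2 * changes A (N * b) + 2) = b * (2 * changes A (N * b)) + 2 * b := by ring
  rw [hb3, ← Nat.add_assoc] at hZ
  have m0 : (p + b) % 2 ^ w = p + b := Nat.mod_eq_of_lt (by omega)
  refine wp_cons (wp_set rfl (wp_cons (wp_set rfl (wp_cons (wp_set rfl (wp_cons
    (wp_set rfl (wp_cons ?_))))))))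
  refine wp_while (CompressInv τ A p b src N dir Z) N (40 * b + 70) rfl ?_ ?_ ?_ ?_ ?_
  · refine ⟨fun i hi hi6 => ?_, ?_, ?_, ?_, ?_, ?_, ?_, .zero _ _ _ _ _ _⟩
    · simp [show i ≠ 27 by omega, show i ≠ 23 by omega, show i ≠ 24 by omega, hi6]
    all_goals simp [h6, h20, h3, m0]
  · intro j σ hj hI
    simp [hI.r23, hI.frame 21, h21, hj, Nat.mod_eq_of_lt hw]
  · intro σ hI
    simp [hI.r23, hI.frame 21, h21]
  · intro j σ u hj hI
    exact compressBody_spec h3 h22 hA hZ hsrc hsrcw hdir hdirw hw hj hI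
  · intro σ u hI hu
    have h1 := hI.bound
    have h2 := hI.le
    have h4 := hI.r6
    rw [if_neg (by omega)] at h1
    refine wp_nil (hQ σ _ (fun i hi => hI.frame i (by omega)) (by omega) (by omega) hI.mem
      (fun j hj => ?_) (hI.compressed.changes_le.trans (blockChanges_le A b N)) ?_)
    · obtain ⟨k1, k2, k3⟩ := hI.compressed.entry j hj
      exact ⟨k1, by omega, k3⟩
    · simp at hu
      have : N * (40 * b + 70 + 3 + 1) + 6 * N = N * (40 * b + 80) := by ring
      omega

end SSDSO

namespace SSDSO

open Ex Prog

variable {w : ℕ} {O : Oracle}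

/-! ### Tables for a vertex -/

/-- Write the ancestors of the vertex `r 10` of depth `r 11` to `r 17`, in the order of their
depths. -/
def walkUp : Prog := block [
  set 20 (r 10), set 21 (c 0),
  while' (lt (r 21) (r 11 + c 1)) (block [
    put (r 17 + (r 11 - r 21)) (r 20),
    query .parent 20 (r 20) (c 0),
    set 21 (r 21 + c 1)])]

/-- Write the ancestors of the vertex `r 10` from depth `r 22` on and the replacement distances for
them to `r 6`. -/
def table : Prog := block [
  set 20 (r 22), set 23 (r 6),
  while' (lt (r 20) (r 11 + c 1)) (block [
    set 21 (ld (r 17 + r 20)),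
    put (r 23) (r 21),
    query .replDist 21 (r 10) (r 21),
    put (r 23 + c 1) (r 21),
    set 23 (r 23 + c 2),
    set 20 (r 20 + c 1)])]

/-- The body of the loop of `farArray`: the next value of the array. -/
def farStep : Prog := cond (lt (r 21) (r 14)) (block [
  set 22 (ld (r 17 + r 21)),
  query .replDist 23 (r 10) (r 22),
  query .replDist 24 (r 12) (r 22),
  -- The word for `∞` is left alone; an addition would wrap around.
  cond (eq (r 24) (r 8)) skip (set 24 (r 24 + r 13)),
  cond (lt (r 23) (r 24)) (cond (lt (r 23) (r 20)) (set 20 (r 23)) skip) skip]) skip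

/-- Write the array `far` of the vertex `r 10` to `r 18`. -/
def farArray : Prog := block [
  set 20 (r 8), put (r 18) (r 20), set 21 (c 1),
  -- The array is padded to a multiple of the square of the block length; beyond depth `dep t - L`
  -- it repeats its last value.
  while' (lt (r 21) (r 4 * r 9)) (block [
    farStep,
    put (r 18 + r 21) (r 20),
    set 21 (r 21 + c 1)])]

/-! ### Correctness of the programs that fill the tables -/

namespace Inp

variable (T : Inp w O)

theorem walkUp_spec {τ : State} {u v : ℕ} {Q : State → ℕ → Prop} {t : ℕ} (ht : t < T.n)
    (h10 : τ.reg 10 = t) (h11 : τ.reg 11 = T.dep t) (h17 : τ.reg 17 = v) (hv : v + T.n < 2 ^ w)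
    (hQ : ∀ τ' u', (∀ i < 20, τ'.reg i = τ.reg i) →
      (∀ i ≤ T.dep t, τ'.mem (v + i) = T.anc t i) →
      (∀ a, a < v ∨ v + T.n ≤ a → τ'.mem a = τ.mem a) → u' ≤ u + (40 * T.n + 40) → Q τ' u') :
    wp w O walkUp τ u Q := by
  have hd := T.dep_lt t ht
  have hw : 1 < 2 ^ w := by have := T.len_bound; omega
  have m1 : (T.dep t + 1) % 2 ^ w = T.dep t + 1 := Nat.mod_eq_of_lt (by omega)
  refine wp_cons (wp_set rfl (wp_cons (wp_set rfl (wp_cons ?_))))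
  refine wp_while (fun j σ => (∀ i < 20, σ.reg i = τ.reg i) ∧ σ.reg 21 = j ∧
      σ.reg 20 = T.up t j ∧ (∀ i < j, σ.mem (v + (T.dep t - i)) = T.up t i) ∧
      ∀ a, a < v ∨ v + T.n ≤ a → σ.mem a = τ.mem a) (T.dep t + 1) 20 rfl ?_ ?_ ?_ ?_ ?_
  · refine ⟨fun i hi => ?_, ?_⟩
    · simp [show i ≠ 20 by omega, show i ≠ 21 by omega]
    · simp [h10, up_zero]
  · rintro j σ hj ⟨hr, h21, -⟩
    simp [h21, hr 11, h11, m1, hj, Nat.mod_eq_of_lt hw]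
  · rintro σ ⟨hr, h21, -⟩
    simp [h21, hr 11, h11, m1]
  · rintro j σ u' hj ⟨hr, h21, h20, hm, hf⟩
    have e11 := (hr 11 (by decide)).trans h11
    have e17 := (hr 17 (by decide)).trans h17
    have m2 : (T.dep t + 2 ^ w - j) % 2 ^ w = T.dep t - j :=
      Nat.add_sub_mod_of_le (by omega) (by omega)
    have m3 : (v + (T.dep t - j)) % 2 ^ w = v + (T.dep t - j) := Nat.mod_eq_of_lt (by omega)
    have m4 : (j + 1) % 2 ^ w = j + 1 := Nat.mod_eq_of_lt (by omega)
    refine wp_cons (wp_put rfl rfl (wp_cons (wp_query rfl rfl (wp_cons (wp_set rfl (wp_nil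
      ⟨⟨fun i hi => ?_, ?_, ?_, fun i hi => ?_, fun a ha => ?_⟩, ?_⟩))))))
    · simp [show i ≠ 20 by omega, show i ≠ 21 by omega, hr i hi]
    · simp [h21, m4, Nat.mod_eq_of_lt hw]
    · simp only [State.setReg_reg, State.setMem_reg, Nat.reduceEqDiff, if_false, reduceIte,
        eval_r, h20]
      rw [T.ask_par _ (T.up_lt ht (by omega)), up_succ]
    · simp only [State.setReg_mem, State.setMem_mem, eval_add, eval_sub, eval_r, e11, e17, h21,
        h20, m2, m3]
      split_ifs with h
      · congr 1; omega
      · exact hm i (by omega)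
    · simp only [State.setReg_mem, State.setMem_mem, eval_add, eval_sub, eval_r, e11, e17, h21,
        h20, m2, m3]
      rw [if_neg (by omega), hf a ha]
    · simp
  · rintro σ u' ⟨hr, h21, h20, hm, hf⟩ hu
    refine wp_nil (hQ σ _ hr (fun i hi => ?_) hf ?_)
    · have := hm (T.dep t - i) (by omega)
      rwa [Nat.sub_sub_self hi] at this
    · simp at hu
      omega

theorem table_spec {τ : State} {u v : ℕ} {Q : State → ℕ → Prop} {t lo p : ℕ} (ht : t < T.n)
    (h10 : τ.reg 10 = t) (h11 : τ.reg 11 = T.dep t) (h17 : τ.reg 17 = v) (h6 : τ.reg 6 = p)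
    (h22 : τ.reg 22 = lo) (hlo : lo ≤ T.dep t) (hp : p + 2 * (T.dep t + 1 - lo) ≤ v)
    (hv : v + T.n < 2 ^ w) (hV : ∀ i ≤ T.dep t, τ.mem (v + i) = T.anc t i)
    (hQ : ∀ τ' u', (∀ i < 20, τ'.reg i = τ.reg i) →
      (∀ i ≤ T.dep t, lo ≤ i → τ'.mem (p + 2 * (i - lo)) = T.anc t i ∧
        τ'.mem (p + 2 * (i - lo) + 1) = T.val t (T.anc t i)) →
      (∀ a, a < p ∨ p + 2 * (T.dep t + 1 - lo) ≤ a → τ'.mem a = τ.mem a) →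
      u' ≤ u + (40 * T.n + 40) → Q τ' u') :
    wp w O table τ u Q := by
  have hd := T.dep_lt t ht
  have hw : 2 < 2 ^ w := by have := T.len_bound; omega
  have w1 : 1 % 2 ^ w = 1 := Nat.mod_eq_of_lt (by omega)
  have w2 : 2 % 2 ^ w = 2 := Nat.mod_eq_of_lt (by omega)
  have m1 : (T.dep t + 1) % 2 ^ w = T.dep t + 1 := Nat.mod_eq_of_lt (by omega)
  refine wp_cons (wp_set rfl (wp_cons (wp_set rfl (wp_cons ?_))))
  refine wp_while (fun j σ => (∀ i < 20, σ.reg i = τ.reg i) ∧ σ.reg 20 = lo + j ∧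
      σ.reg 23 = p + 2 * j ∧ (∀ i < j, σ.mem (p + 2 * i) = T.anc t (lo + i) ∧
        σ.mem (p + 2 * i + 1) = T.val t (T.anc t (lo + i))) ∧
      ∀ a, a < p ∨ p + 2 * (T.dep t + 1 - lo) ≤ a → σ.mem a = τ.mem a)
    (T.dep t + 1 - lo) 30 rfl ?_ ?_ ?_ ?_ ?_
  · refine ⟨fun i hi => ?_, ?_⟩
    · simp [show i ≠ 20 by omega, show i ≠ 23 by omega]
    · simp [h22, h6]
  · rintro j σ hj ⟨hr, h20, -⟩
    simp [h20, hr 11, h11, m1, w1, show lo + j < T.dep t + 1 by omega]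
  · rintro σ ⟨hr, h20, -⟩
    simp [h20, hr 11, h11, m1, show ¬ lo + (T.dep t + 1 - lo) < T.dep t + 1 by omega]
  · rintro j σ u' hj ⟨hr, h20, h23, hm, hf⟩
    have e10 := (hr 10 (by decide)).trans h10
    have e17 := (hr 17 (by decide)).trans h17
    have m2 : (v + (lo + j)) % 2 ^ w = v + (lo + j) := Nat.mod_eq_of_lt (by omega)
    have m3 : (p + 2 * j + 1) % 2 ^ w = p + 2 * j + 1 := Nat.mod_eq_of_lt (by omega)
    have m4 : (lo + j + 1) % 2 ^ w = lo + j + 1 := Nat.mod_eq_of_lt (by omega)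
    have m5 : (p + 2 * j + 2) % 2 ^ w = p + 2 * j + 2 := Nat.mod_eq_of_lt (by omega)
    have hVj : σ.mem (v + (lo + j)) = T.anc t (lo + j) := by
      rw [hf _ (Or.inr (by omega)), hV _ (by omega)]
    have hask := T.ask_val t ht _ (T.anc_lt ht (lo + j))
    refine wp_cons (wp_set rfl (wp_cons (wp_put rfl rfl (wp_cons (wp_query rfl rfl (wp_cons
      (wp_put rfl rfl (wp_cons (wp_set rfl (wp_cons (wp_set rfl (wp_nil
      ⟨⟨fun i hi => ?_, ?_, ?_, fun i hi => ?_, fun a ha => ?_⟩, ?_⟩))))))))))))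
    · simp [show i ≠ 20 by omega, show i ≠ 21 by omega, show i ≠ 23 by omega, hr i hi]
    · rw [Nat.add_assoc] at m4
      simp [h20, w1, Nat.add_assoc, m4]
    · simp [h23, w2, m5]
      ring
    · simp [h20, h23, e10, e17, w1, m2, m3, hVj, hask]
      rcases Nat.lt_succ_iff_lt_or_eq.1 hi with hi | rfl
      · simp [show p + 2 * i ≠ p + 2 * j + 1 by omega, show i ≠ j by omega,
          show p + 2 * i + 1 ≠ p + 2 * j by omega, hm i hi]
      · simp
    · simp only [State.setReg_mem, State.setMem_mem, State.setReg_reg, State.setMem_reg, eval_add,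
        eval_r, eval_c, Nat.reduceEqDiff, if_false, h23, w1, m3]
      rw [if_neg (by omega), if_neg (by omega), hf a ha]
    · simp
  · rintro σ u' ⟨hr, h20, h23, hm, hf⟩ hu
    refine wp_nil (hQ σ _ hr (fun i hi hlo => ?_) hf ?_)
    · have := hm (i - lo) (by omega)
      rwa [Nat.add_sub_cancel' hlo] at this
    · simp at hu
      omega

theorem farStep_spec {σ : State} {u v : ℕ} {Q : State → ℕ → Prop} {t L ρ j : ℕ} (ht : t < T.n)
    (h8 : σ.reg 8 = T.inf)
    (h10 : σ.reg 10 = t) (h14 : σ.reg 14 = T.dep t + 1 - L) (h17 : σ.reg 17 = v)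
    (h12 : L ≤ T.dep t → σ.reg 12 = T.piv L ρ t)
    (h13 : L ≤ T.dep t → σ.reg 13 = T.dst t - T.dst (T.piv L ρ t))
    (h20 : σ.reg 20 = T.far L ρ t j) (h21 : σ.reg 21 = j + 1)
    (hv : v + T.n < 2 ^ w) (hV : ∀ i ≤ T.dep t, σ.mem (v + i) = T.anc t i)
    (hQ : ∀ σ' u', (∀ i, i < 20 ∨ i = 21 → σ'.reg i = σ.reg i) → σ'.mem = σ.mem →
      σ'.reg 20 = T.far L ρ t (j + 1) → u' ≤ u + 50 → Q σ' u') :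
    wp w O farStep σ u Q := by
  have hd := T.dep_lt t ht
  have hlb := T.len_bound
  have hinf : T.inf = 2 ^ w - 1 := rfl
  have w1 : 1 % 2 ^ w = 1 := Nat.mod_eq_of_lt (by omega)
  refine wp_cond rfl (fun hne => ?_) fun heq => ?_
  · have hj : j + 1 < T.dep t + 1 - L := by
      by_contra hc
      simp [h21, h14, hc] at hne
    have hL : L ≤ T.dep t := by omega
    have hx : T.piv L ρ t < T.n := T.piv_lt ht
    have ha := T.anc_lt ht (j + 1)
    have ask1 := T.ask_val t ht _ ha
    have ask2 := T.ask_val _ hx _ ha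
    have hval := T.val_le _ hx _ ha
    have hdst : T.dst t - T.dst (T.piv L ρ t) ≤ T.n * T.M := (T.dst_sub_le ht _).2
    have m1 : (v + (j + 1)) % 2 ^ w = v + (j + 1) := Nat.mod_eq_of_lt (by omega)
    have hVj := hV (j + 1) (by omega)
    have hfar : T.far L ρ t (j + 1) = if T.val t (T.anc t (j + 1)) < T.via L ρ t (j + 1) ∧
        T.val t (T.anc t (j + 1)) < T.far L ρ t j then T.val t (T.anc t (j + 1))
        else T.far L ρ t j := by
      rw [far]
      simp [show j + 1 ≤ T.dep t - L by omega]
    -- Common continuation for a finite and an infinite distance of the pivot: registers `23` and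
    -- `24` hold the true value and `via`.
    have tail : ∀ σ' u', (∀ i, i < 20 ∨ i = 21 → σ'.reg i = σ.reg i) → σ'.mem = σ.mem →
        σ'.reg 20 = T.far L ρ t j → σ'.reg 23 = T.val t (T.anc t (j + 1)) →
        σ'.reg 24 = T.via L ρ t (j + 1) → u' ≤ u + 25 →
        wp w O (block [cond (lt (r 23) (r 24)) (cond (lt (r 23) (r 20)) (set 20 (r 23)) skip)
          skip]) σ' u' Q := by
      intro σ' u' hr hm g20 g23 g24 hu
      refine wp_cons (wp_cond rfl (fun h1 => wp_cond rfl (fun h2 => wp_set rfl (wp_nil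
        (hQ _ _ (fun i hi => ?_) hm ?_ ?_))) fun h2 => wp_skip (wp_nil (hQ _ _ hr hm ?_ ?_)))
        fun h1 => wp_skip (wp_nil (hQ _ _ hr hm ?_ ?_)))
      · simp [show i ≠ 20 by omega, hr i hi]
      · simp [g23, g24, g20, w1] at h1 h2 ⊢
        rw [hfar, if_pos ⟨h1, h2⟩]
      · simp
        omega
      · simp [g23, g24, g20, w1] at h1 h2 ⊢
        rw [hfar, if_neg (by simp; omega)]
      · simp
        omega
      · simp [g23, g24, g20, w1] at h1 ⊢
        rw [hfar, if_neg (by simp; omega)]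
      · simp
        omega
    refine wp_cons (wp_set rfl (wp_cons (wp_query rfl rfl (wp_cons (wp_query rfl rfl
      (wp_cons (wp_cond rfl (fun h => wp_skip (tail _ _ ?_ rfl ?_ ?_ ?_ ?_))
        fun h => wp_set rfl (tail _ _ ?_ rfl ?_ ?_ ?_ ?_))))))))
    · intro i hi
      simp [show i ≠ 22 by omega, show i ≠ 23 by omega, show i ≠ 24 by omega]
    · simp [h20]
    · simp [h10, h17, h21, m1, hVj, ask1]
    · simp [h8, h12 hL, h17, h21, m1, hVj, ask2, w1] at h ⊢
      rw [via, if_pos h, h]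
    · simp
    · intro i hi
      simp [show i ≠ 22 by omega, show i ≠ 23 by omega, show i ≠ 24 by omega]
    · simp [h20]
    · simp [h10, h17, h21, m1, hVj, ask1]
    · simp [h8, h12 hL, h13 hL, h17, h21, m1, hVj, ask2, w1] at h ⊢
      rw [via, if_neg h, Nat.mod_eq_of_lt (by omega)]
    · simp
  · have hj : ¬ j + 1 < T.dep t + 1 - L := by
      intro hc
      simp [h21, h14, hc, w1] at heq
    refine wp_skip (hQ _ _ (fun _ _ => rfl) rfl ?_ ?_)
    · rw [h20, T.far_eq_of_lt (i := j + 1) (by omega), Nat.add_sub_cancel]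
    · simp

theorem farArray_spec {τ : State} {u v f : ℕ} {Q : State → ℕ → Prop} {t L ρ q : ℕ} (ht : t < T.n)
    (h4 : τ.reg 4 = L) (h9 : τ.reg 9 = q) (h8 : τ.reg 8 = T.inf)
    (h10 : τ.reg 10 = t) (h14 : τ.reg 14 = T.dep t + 1 - L) (h17 : τ.reg 17 = v)
    (h12 : L ≤ T.dep t → τ.reg 12 = T.piv L ρ t)
    (h13 : L ≤ T.dep t → τ.reg 13 = T.dst t - T.dst (T.piv L ρ t))
    (h18 : τ.reg 18 = f) (hN : 1 ≤ L * q)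
    (hv : v + T.n ≤ f) (hf : f + L * q < 2 ^ w) (hV : ∀ i ≤ T.dep t, τ.mem (v + i) = T.anc t i)
    (hQ : ∀ τ' u', (∀ i < 20, τ'.reg i = τ.reg i) →
      (∀ i < L * q, τ'.mem (f + i) = T.far L ρ t i) →
      (∀ a, a < f ∨ f + L * q ≤ a → τ'.mem a = τ.mem a) →
      u' ≤ u + (80 * (L * q) + 40) → Q τ' u') :
    wp w O farArray τ u Q := by
  have hd := T.dep_lt t ht
  have hlb := T.len_bound
  have w1 : 1 % 2 ^ w = 1 := Nat.mod_eq_of_lt (by omega)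
  have m1 : L * q % 2 ^ w = L * q := Nat.mod_eq_of_lt (by omega)
  refine wp_cons (wp_set rfl (wp_cons (wp_put rfl rfl (wp_cons (wp_set rfl (wp_cons ?_))))))
  refine wp_while (fun j σ => (∀ i < 20, σ.reg i = τ.reg i) ∧ σ.reg 21 = j + 1 ∧
      σ.reg 20 = T.far L ρ t j ∧ (∀ i ≤ j, σ.mem (f + i) = T.far L ρ t i) ∧
      ∀ a, a < f ∨ f + L * q ≤ a → σ.mem a = τ.mem a) (L * q - 1) 65 rfl ?_ ?_ ?_ ?_ ?_
  · refine ⟨fun i hi => ?_, ?_, ?_, ?_, fun a ha => ?_⟩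
    · simp [show i ≠ 20 by omega, show i ≠ 21 by omega]
    · simp [w1]
    · simp [h8, far]
    · simp [h8, h18, far]
    · simp only [State.setReg_mem, State.setMem_mem, State.setReg_reg, eval_r,
        Nat.reduceEqDiff, if_false, h18]
      rw [if_neg (by omega)]
  · rintro j σ hj ⟨hr, h21, -⟩
    simp [h21, hr 4, hr 9, h4, h9, m1, w1, show j + 1 < L * q by omega]
  · rintro σ ⟨hr, h21, -⟩
    simp [h21, hr 4, hr 9, h4, h9, m1, show ¬ L * q - 1 + 1 < L * q by omega]
  · rintro j σ u' hj ⟨hr, h21, h20, hm, hfr⟩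
    refine wp_cons (T.farStep_spec (L := L) (ρ := ρ) (j := j) (v := v) ht ((hr 8 (by decide)).trans h8)
      ((hr 10 (by decide)).trans h10) ((hr 14 (by decide)).trans h14)
      ((hr 17 (by decide)).trans h17) (fun h => (hr 12 (by decide)).trans (h12 h))
      (fun h => (hr 13 (by decide)).trans (h13 h)) h20 h21 (by omega)
      (fun i hi => (hfr _ (Or.inl (by omega))).trans (hV i hi)) ?_)
    intro σ₁ u₁ hr₁ hm₁ g20 hu₁
    have g18 : σ₁.reg 18 = f := (hr₁ 18 (by decide)).trans ((hr 18 (by decide)).trans h18)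
    have g21 : σ₁.reg 21 = j + 1 := (hr₁ 21 (by decide)).trans h21
    have m2 : (f + (j + 1)) % 2 ^ w = f + (j + 1) := Nat.mod_eq_of_lt (by omega)
    have m3 : (j + 1 + 1) % 2 ^ w = j + 1 + 1 := Nat.mod_eq_of_lt (by omega)
    refine wp_cons (wp_put rfl rfl (wp_cons (wp_set rfl (wp_nil
      ⟨⟨fun i hi => ?_, ?_, ?_, fun i hi => ?_, fun a ha => ?_⟩, ?_⟩))))
    · simp [show i ≠ 21 by omega, hr₁ i (Or.inl hi), hr i hi]
    · simp [g21, w1, m3]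
    · simp [g20]
    · simp only [State.setReg_mem, State.setMem_mem, eval_add, eval_r, g18, g21, m2, hm₁, g20]
      split_ifs with h
      · congr 1; omega
      · exact hm i (by omega)
    · simp only [State.setReg_mem, State.setMem_mem, eval_add, eval_r, g18, g21, m2, hm₁, g20]
      rw [if_neg (by omega), hfr a ha]
    · simp
      omega
  · rintro σ u' ⟨hr, h21, h20, hm, hfr⟩ hu
    refine wp_nil (hQ σ _ hr (fun i hi => hm i (by omega)) hfr ?_)
    simp at hu
    omega

end Inp
end SSDSO

namespace SSDSO

open Ex Prog

variable {w : ℕ} {O : Oracle}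

/-! ### The data of a vertex -/

/-- The tables of the vertex `r 10`: the ancestors, the pivot and the depth at which the table of
the near ancestors starts. -/
def prologue : Prog := block [
  -- The record of a vertex `t` consists of the cells `8 + 8 * t` to `15 + 8 * t`: parent, depth,
  -- distance, pointer to the near table, pointer to the full row of a pivot, pivot, pointer to the
  -- far table, first depth of the near table.
  set 11 (ld (c 9 + c 8 * r 10)),
  walkUp,
  -- A vertex of depth less than `L` needs no pivot, as its whole path is near.
  cond (lt (r 11) (r 4)) (set 14 (c 0)) (block [
    set 14 (r 11 + c 1 - r 4),
    -- The largest depth up to `dep t` with residue `ρ`. In this branch `dep t ≥ L > ρ`, so nothing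
    -- underflows.
    set 12 (ld (r 17 + (r 11 - (r 11 - r 5) % r 4))),
    set 13 (ld (c 10 + c 8 * r 10) - ld (c 10 + c 8 * r 12)),
    put (c 13 + c 8 * r 10) (r 12)]),
  put (c 15 + c 8 * r 10) (r 14)]

/-- Write the tables of the near ancestors and, if the vertex `r 10` is a pivot, of all
ancestors. -/
def tables : Prog := block [
  put (c 11 + c 8 * r 10) (r 6),
  set 22 (r 14),
  table,
  set 6 (r 6 + c 2 * r 4),
  cond (eq (r 11 % r 4) (r 5)) (block [
    put (c 12 + c 8 * r 10) (r 6),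
    set 22 (c 0),
    table,
    set 6 (r 6 + c 2 * r 0)]) skip]

/-- Write the compressed array `far`. -/
def farTable : Prog := block [
  farArray,
  put (c 14 + c 8 * r 10) (r 6),
  set 16 (r 6),
  -- Room for the final directory. The directory of the first compression is temporary and goes to
  -- scratch memory at `r 19`.
  set 6 (r 6 + r 9),
  set 20 (r 18), set 21 (r 3 * r 9), set 22 (r 19),
  compress,
  set 20 (r 19), set 21 (r 9), set 22 (r 16),
  compress]

namespace Inp

variable (T : Inp w O)

/-- The number of blocks of length `r ^ 2`. -/
def quo (r : ℕ) : ℕ := T.n / (r * r) + 1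

/-- The space for the compressed array `far`. -/
noncomputable def farCost (r ρ t : ℕ) : ℕ :=
  T.quo r + r * (6 * changes (T.far (r * r) ρ t) (r * r * T.quo r) + 4)

/-- The space for the tables of ancestors. -/
def tableCost (r ρ t : ℕ) : ℕ :=
  2 * (r * r) + if T.dep t % (r * r) = ρ then 2 * T.n else 0

/-- The contents of the registers that do not change while the vertices are processed. -/
structure Globals (r ρ : ℕ) (σ : State) : Prop where
  r0 : σ.reg 0 = T.n
  r3 : σ.reg 3 = r
  r4 : σ.reg 4 = r * r
  r5 : σ.reg 5 = ρ
  r8 : σ.reg 8 = T.inf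
  r9 : σ.reg 9 = T.quo r
  r17 : σ.reg 17 = 2 * T.Z
  r18 : σ.reg 18 = 3 * T.Z
  r19 : σ.reg 19 = 4 * T.Z

/-- The admissible parameters. -/
structure Params (r ρ : ℕ) : Prop where
  pos : 1 ≤ r
  le : r * r ≤ T.n
  lt : ρ < r * r

variable {T}

theorem Globals.congr {r ρ : ℕ} {σ σ' : State} (h : T.Globals r ρ σ)
    (hr : ∀ i < 20, i < 6 ∨ 7 ≤ i ∧ i < 10 ∨ 17 ≤ i → σ'.reg i = σ.reg i) : T.Globals r ρ σ' := by
  obtain ⟨h0, h3, h4, h5, h8, h9, h17, h18, h19⟩ := h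
  constructor <;> rw [hr _ (by decide) (by decide)] <;> assumption

theorem Params.bounds {r ρ : ℕ} (h : T.Params r ρ) : 1 ≤ r * r ∧ r ≤ r * r ∧
    1 ≤ r * r * T.quo r ∧ r * r * T.quo r ≤ 2 * T.n ∧ r * T.quo r ≤ 2 * T.n ∧ T.quo r ≤ 2 * T.n := by
  have h1 := h.pos
  have h2 : r ≤ r * r := Nat.le_mul_self r
  have h3 := h.le
  have h4 : r * r * T.quo r ≤ 2 * T.n := by
    unfold quo
    rw [Nat.mul_add]
    have := Nat.mul_div_le T.n (r * r)
    omega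
  have h5 : 1 ≤ T.quo r := Nat.le_add_left 1 _
  have h6 : r * T.quo r ≤ r * r * T.quo r := Nat.mul_le_mul_right _ h2
  have h7 : T.quo r ≤ r * T.quo r := Nat.le_mul_of_pos_left _ h1
  refine ⟨by omega, h2, Nat.mul_pos (by omega) h5, h4, by omega, by omega⟩

variable (T)

theorem prologue_spec {τ : State} {u : ℕ} {Q : State → ℕ → Prop} {r ρ t : ℕ} (ht : t < T.n)
    (hP : T.Params r ρ) (hG : T.Globals r ρ τ) (h10 : τ.reg 10 = t)
    (hdep : ∀ c < T.n, τ.mem (9 + 8 * c) = T.dep c) (hdst : ∀ c < T.n, τ.mem (10 + 8 * c) = T.dst c)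
    (hQ : ∀ τ' u', (∀ i < 20, i ≤ 10 ∨ 15 ≤ i → τ'.reg i = τ.reg i) →
      τ'.reg 11 = T.dep t → τ'.reg 14 = T.dep t + 1 - r * r →
      (r * r ≤ T.dep t → τ'.reg 12 = T.piv (r * r) ρ t) →
      (r * r ≤ T.dep t → τ'.reg 13 = T.dst t - T.dst (T.piv (r * r) ρ t)) →
      (∀ i ≤ T.dep t, τ'.mem (2 * T.Z + i) = T.anc t i) →
      (r * r ≤ T.dep t → τ'.mem (13 + 8 * t) = T.piv (r * r) ρ t) →
      τ'.mem (15 + 8 * t) = T.dep t + 1 - r * r →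
      (∀ a < T.Z, a ≠ 13 + 8 * t → a ≠ 15 + 8 * t → τ'.mem a = τ.mem a) →
      u' ≤ u + (40 * T.n + 120) → Q τ' u') :
    wp w O prologue τ u Q := by
  have hd := T.dep_lt t ht
  have hZ := T.le_Z
  have hZw := T.Z_bound
  have hρ := hP.lt
  have hn := hP.le
  have hr1 := hP.bounds.1
  have hc : ∀ k < 64, k % 2 ^ w = k := fun k hk => Nat.mod_eq_of_lt (by omega)
  have m8 : 8 * t % 2 ^ w = 8 * t := Nat.mod_eq_of_lt (by omega)
  have mk : ∀ k < 64, (k + 8 * t) % 2 ^ w = k + 8 * t := fun k hk => Nat.mod_eq_of_lt (by omega)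
  refine wp_cons (wp_set rfl (wp_cons (T.walkUp_spec (t := t) (v := 2 * T.Z) ht ?_ ?_ ?_ (by omega)
    ?_)))
  · simp [h10]
  · simp [h10, hc, m8, mk, hdep t ht]
  · simp [hG.r17]
  intro σ u₁ hr hV hf hu
  have g10 : σ.reg 10 = t := by rw [hr 10 (by decide)]; simp [h10]
  have g11 : σ.reg 11 = T.dep t := by
    rw [hr 11 (by decide)]; simp [h10, hc, m8, mk, hdep t ht]
  have g : ∀ i < 20, i ≠ 11 → σ.reg i = τ.reg i := fun i hi h => by rw [hr i hi]; simp [h]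
  have g4 : σ.reg 4 = r * r := (g 4 (by decide) (by decide)).trans hG.r4
  have g5 : σ.reg 5 = ρ := (g 5 (by decide) (by decide)).trans hG.r5
  have g17 : σ.reg 17 = 2 * T.Z := (g 17 (by decide) (by decide)).trans hG.r17
  simp only [Ex.cost_ld, Ex.cost_add, Ex.cost_mul, Ex.cost_c, Ex.cost_r] at hu
  refine wp_cons (wp_cond rfl (fun hne => ?_) fun heq => ?_)
  · have hlt : T.dep t < r * r := by
      by_contra hcon
      simp [g11, g4, hcon] at hne
    refine wp_set rfl (wp_cons (wp_put rfl rfl (wp_nil (hQ _ _ ?_ ?_ ?_ ?_ ?_ ?_ ?_ ?_ ?_ ?_))))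
    · intro i hi hi'
      simp [show i ≠ 14 by omega, g i hi (by omega)]
    · simp [g11]
    · simp
      omega
    · intro; omega
    · intro; omega
    · intro i hi
      simp [g10, hc, m8, mk]
      rw [if_neg (by omega), hV i hi]
    · intro; omega
    · simp [g10, hc, m8, mk]
      omega
    · intro a ha h1 h2
      simp [g10, hc, m8, mk, h2]
      rw [hf a (by omega)]; rfl
    · simp
      omega
  · have hle : r * r ≤ T.dep t := by
      by_contra hcon
      simp [g11, g4, hc, not_le.1 hcon] at heq
    have m1 : (T.dep t + 1) % 2 ^ w = T.dep t + 1 := Nat.mod_eq_of_lt (by omega)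
    have m2 : (T.dep t + 1 + 2 ^ w - r * r) % 2 ^ w = T.dep t + 1 - r * r :=
      Nat.add_sub_mod_of_le (by omega) (by omega)
    have m3 : (T.dep t + 2 ^ w - ρ) % 2 ^ w = T.dep t - ρ :=
      Nat.add_sub_mod_of_le (by omega) (by omega)
    have hmod : (T.dep t - ρ) % (r * r) ≤ T.dep t := (Nat.mod_le _ _).trans (Nat.sub_le _ _)
    have m4 : (T.dep t + 2 ^ w - (T.dep t - ρ) % (r * r)) % 2 ^ w =
        T.dep t - (T.dep t - ρ) % (r * r) := Nat.add_sub_mod_of_le hmod (by omega)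
    have m5 : (2 * T.Z + (T.dep t - (T.dep t - ρ) % (r * r))) % 2 ^ w =
        2 * T.Z + (T.dep t - (T.dep t - ρ) % (r * r)) := Nat.mod_eq_of_lt (by omega)
    have hp : σ.mem (2 * T.Z + (T.dep t - (T.dep t - ρ) % (r * r))) = T.piv (r * r) ρ t :=
      hV _ (Nat.sub_le _ _)
    have hx := T.piv_lt (L := r * r) (ρ := ρ) ht
    have m6 : 8 * T.piv (r * r) ρ t % 2 ^ w = 8 * T.piv (r * r) ρ t := Nat.mod_eq_of_lt (by omega)
    have m7 : (10 + 8 * T.piv (r * r) ρ t) % 2 ^ w = 10 + 8 * T.piv (r * r) ρ t :=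
      Nat.mod_eq_of_lt (by omega)
    have hσ : ∀ c < T.n, σ.mem (10 + 8 * c) = T.dst c := fun c hc => by
      rw [hf _ (by omega)]; exact hdst c hc
    have hdle : T.dst t ≤ T.inf := by
      have := T.len_bound
      have h1 := T.len_le t ht
      have h2 : T.inf = 2 ^ w - 1 := rfl
      unfold dst
      split_ifs <;> omega
    have m9 : (T.dst t + 2 ^ w - T.dst (T.piv (r * r) ρ t)) % 2 ^ w =
        T.dst t - T.dst (T.piv (r * r) ρ t) := by
      refine Nat.add_sub_mod_of_le (T.dst_sub_le ht _).1 ?_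
      have h2 : T.inf = 2 ^ w - 1 := rfl
      omega
    refine wp_cons (wp_set rfl (wp_cons (wp_set rfl (wp_cons (wp_set rfl (wp_cons (wp_put rfl rfl
      (wp_nil (wp_cons (wp_put rfl rfl (wp_nil (hQ _ _ ?_ ?_ ?_ ?_ ?_ ?_ ?_ ?_ ?_ ?_))))))))))))
    · intro i hi hi'
      simp [show i ≠ 14 by omega, show i ≠ 12 by omega, show i ≠ 13 by omega, g i hi (by omega)]
    · simp [g11]
    · simp [g11, g4, hc, m1, m2]
    · simp [g11, g4, g5, g17, m3, m4, m5, hp]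
    · simp [g11, g4, g5, g17, g10, m3, m4, m5, hp, m6, m7, m8, mk, hc, hσ t ht, hσ _ hx, m9]
    · intro i hi
      simp [g11, g4, g5, g17, g10, m3, m4, m5, hp, m8, mk, hc]
      rw [if_neg (by omega), if_neg (by omega), hV i hi]
    · simp [g11, g4, g5, g17, g10, m3, m4, m5, hp, m8, mk, hc]
    · simp [g11, g4, g10, m1, m2, m8, mk, hc]
    · intro a ha h1 h2
      simp [g10, hc, m8, mk, h2, h1]
      rw [hf a (by omega)]; rfl
    · simp
      omega

end Inp
end SSDSO

/-! ### Tables of ancestors -/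

namespace SSDSO

open Ex Prog

variable {w : ℕ} {O : Oracle}
namespace Inp

variable (T : Inp w O)

/-- A table at `p` of the ancestors of `t` from depth `lo` on. -/
def IsTable (mem : ℕ → ℕ) (p lo t : ℕ) : Prop :=
  ∀ i ≤ T.dep t, lo ≤ i → mem (p + 2 * (i - lo)) = T.anc t i ∧
    mem (p + 2 * (i - lo) + 1) = T.val t (T.anc t i)

theorem IsTable.congr {mem mem' : ℕ → ℕ} {p lo t lim : ℕ} (h : T.IsTable mem p lo t)
    (hlim : p + 2 * (T.dep t + 1 - lo) ≤ lim) (hm : ∀ a, p ≤ a → a < lim → mem' a = mem a) :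
    T.IsTable mem' p lo t := fun i hi hlo => by
  rw [hm _ (by omega) (by omega), hm _ (by omega) (by omega)]
  exact h i hi hlo

theorem tables_spec {τ : State} {u p : ℕ} {Q : State → ℕ → Prop} {r ρ t : ℕ} (ht : t < T.n)
    (hP : T.Params r ρ) (hG : T.Globals r ρ τ) (h10 : τ.reg 10 = t) (h6 : τ.reg 6 = p)
    (h11 : τ.reg 11 = T.dep t) (h14 : τ.reg 14 = T.dep t + 1 - r * r)
    (hV : ∀ i ≤ T.dep t, τ.mem (2 * T.Z + i) = T.anc t i)
    (hp : T.base ≤ p) (hpZ : p + T.tableCost r ρ t ≤ T.Z)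
    (hQ : ∀ τ' u', (∀ i < 20, i ≠ 6 → τ'.reg i = τ.reg i) →
      τ'.reg 6 = p + T.tableCost r ρ t →
      τ'.mem (11 + 8 * t) = p → T.IsTable τ'.mem p (T.dep t + 1 - r * r) t →
      (T.dep t % (r * r) = ρ → τ'.mem (12 + 8 * t) = p + 2 * (r * r) ∧
        T.IsTable τ'.mem (p + 2 * (r * r)) 0 t) →
      (∀ a, a < p ∨ T.Z ≤ a → a ≠ 11 + 8 * t → a ≠ 12 + 8 * t → τ'.mem a = τ.mem a) →
      u' ≤ u + (80 * T.n + 160) → Q τ' u') :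
    wp w O tables τ u Q := by
  have hd := T.dep_lt t ht
  have hZ := T.le_Z
  have hZw := T.Z_bound
  have hn := hP.le
  have hr1 := hP.bounds.1
  have hbase : T.base = 8 + 8 * T.n := rfl
  have hc : ∀ k < 64, k % 2 ^ w = k := fun k hk => Nat.mod_eq_of_lt (by omega)
  have m8 : 8 * t % 2 ^ w = 8 * t := Nat.mod_eq_of_lt (by omega)
  have mk : ∀ k < 64, (k + 8 * t) % 2 ^ w = k + 8 * t := fun k hk => Nat.mod_eq_of_lt (by omega)
  have hcost : 2 * (r * r) ≤ T.tableCost r ρ t := by unfold tableCost; omega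
  refine wp_cons (wp_put rfl rfl (wp_cons (wp_set rfl (wp_cons (T.table_spec (t := t)
    (v := 2 * T.Z) (p := p) (lo := T.dep t + 1 - r * r) ht ?_ ?_ ?_ ?_ ?_ (by omega) (by omega)
    (by omega) ?_ ?_)))))
  · simp [h10]
  · simp [h11]
  · simp [hG.r17]
  · simp [h6]
  · simp [h14]
  · intro i hi
    simp [h10, hc, m8, mk]
    rw [if_neg (by omega), hV i hi]
  intro σ u₁ hr htab hf hu
  have g : ∀ i < 20, σ.reg i = τ.reg i := fun i hi => by
    rw [hr i hi]; simp [show i ≠ 22 by omega]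
  have gf : ∀ a, a < p ∨ T.Z ≤ a → a ≠ 11 + 8 * t → σ.mem a = τ.mem a := fun a ha ha' => by
    rw [hf a (by omega)]; simp [h10, hc, m8, mk, ha']
  have gp : σ.mem (11 + 8 * t) = p := by
    rw [hf _ (by omega)]; simp [h10, hc, m8, mk, h6]
  have g4 : σ.reg 4 = r * r := (g 4 (by decide)).trans hG.r4
  have g5 : σ.reg 5 = ρ := (g 5 (by decide)).trans hG.r5
  have g6 : σ.reg 6 = p := (g 6 (by decide)).trans h6
  have g10 : σ.reg 10 = t := (g 10 (by decide)).trans h10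
  have g11 : σ.reg 11 = T.dep t := (g 11 (by decide)).trans h11
  have g0 : σ.reg 0 = T.n := (g 0 (by decide)).trans hG.r0
  have g17 : σ.reg 17 = 2 * T.Z := (g 17 (by decide)).trans hG.r17
  have m1 : 2 * (r * r) % 2 ^ w = 2 * (r * r) := Nat.mod_eq_of_lt (by omega)
  have m2 : (p + 2 * (r * r)) % 2 ^ w = p + 2 * (r * r) := Nat.mod_eq_of_lt (by omega)
  simp only [Ex.cost_add, Ex.cost_mul, Ex.cost_c, Ex.cost_r] at hu
  refine wp_cons (wp_set rfl (wp_cons (wp_cond rfl (fun hne => ?_) fun heq => ?_)))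
  · have hmod : T.dep t % (r * r) = ρ := by
      by_contra hcon
      simp [g11, g4, g5, hcon] at hne
    have hcost' : T.tableCost r ρ t = 2 * (r * r) + 2 * T.n := by simp [tableCost, hmod]
    refine wp_cons (wp_put rfl rfl (wp_cons (wp_set rfl (wp_cons (T.table_spec (t := t)
      (v := 2 * T.Z) (p := p + 2 * (r * r)) (lo := 0) ht ?_ ?_ ?_ ?_ ?_ (by omega) (by omega)
      (by omega) ?_ ?_)))))
    · simp [g10]
    · simp [g11]
    · simp [g17]
    · simp [g6, g4, hc, m1, m2]
    · simp
    · intro i hi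
      simp [g10, hc, m8, mk]
      rw [if_neg (by omega), gf _ (by omega) (by omega), hV i hi]
    intro σ' u₂ hr' htab' hf' hu'
    have gf' : ∀ a, a < p + 2 * (r * r) ∨ T.Z ≤ a → a ≠ 12 + 8 * t → σ'.mem a = σ.mem a := by
      intro a ha ha'
      rw [hf' a (by omega)]
      simp [g10, hc, m8, mk, ha']
    have g' : ∀ i < 20, i ≠ 6 → σ'.reg i = τ.reg i := fun i hi hi6 => by
      rw [hr' i hi, ← g i hi]; simp [show i ≠ 22 by omega, hi6]
    have g6' : σ'.reg 6 = p + 2 * (r * r) := by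
      rw [hr' 6 (by decide)]; simp [g6, g4, hc, m1, m2]
    have m3 : 2 * T.n % 2 ^ w = 2 * T.n := Nat.mod_eq_of_lt (by omega)
    have m4 : (p + 2 * (r * r) + 2 * T.n) % 2 ^ w = p + 2 * (r * r) + 2 * T.n :=
      Nat.mod_eq_of_lt (by omega)
    simp at hu'
    refine wp_cons (wp_set rfl (wp_nil (wp_nil (hQ _ _ (fun i hi hi6 => ?_) ?_ ?_ ?_
      (fun _ => ⟨?_, htab'⟩) (fun a ha h1 h2 => ?_) ?_))))
    · simp [hi6, g' i hi hi6]
    · rw [hcost', ← Nat.add_assoc]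
      simp [g6', g' 0, hG.r0, hc, m3, m4]
    · simp only [State.setReg_mem]
      rw [gf' _ (by omega) (by omega), gp]
    · exact IsTable.congr T htab (lim := p + 2 * (r * r)) (by omega) fun a h1 h2 =>
        gf' a (by omega) (by omega)
    · simp only [State.setReg_mem]
      rw [hf' _ (by omega)]
      simp [g10, hc, m8, mk, g6, g4, m1, m2]
    · simp only [State.setReg_mem]
      rw [gf' a (by omega) h2, gf a ha h1]
    · simp
      omega
  · have hmod : ¬ T.dep t % (r * r) = ρ := by
      intro hcon
      simp [g11, g4, g5, hc, hcon] at heq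
    refine wp_skip (wp_nil (hQ _ _ (fun i hi hi6 => ?_) ?_ ?_ htab
      (fun h => absurd h hmod) (fun a ha h1 h2 => gf a ha h1) ?_))
    · simp [hi6, g i hi]
    · simp [g6, g4, hc, m1, m2, tableCost, hmod]
    · simp [gp]
    · simp
      omega

end Inp
end SSDSO

/-! ### The doubly compressed array -/

namespace SSDSO

open Ex Prog

variable {w : ℕ} {O : Oracle}
namespace Inp

variable (T : Inp w O)

/-- A compressed representation of the array `far` of `t` at `p`, using cells below `lim`. -/
def IsFarTable (mem : ℕ → ℕ) (p lim r ρ t : ℕ) : Prop :=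
  p + T.quo r ≤ lim ∧ ∀ i < r * r * T.quo r, ∃ a b, mem (p + i / (r * r)) = a ∧
    mem (a + i / r % r) = b ∧ mem (b + i % r) = T.far (r * r) ρ t i ∧
    p ≤ a ∧ a + r ≤ lim ∧ p ≤ b ∧ b + r ≤ lim

theorem div_lt_quo {r i : ℕ} (hi : i < r * r * T.quo r) :
    i / (r * r) < T.quo r := Nat.div_lt_of_lt_mul hi

theorem IsFarTable.congr {mem mem' : ℕ → ℕ} {p r ρ t lim : ℕ} (h : T.IsFarTable mem p lim r ρ t)
    (hr : 1 ≤ r) (hm : ∀ a, p ≤ a → a < lim → mem' a = mem a) :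
    T.IsFarTable mem' p lim r ρ t := by
  refine ⟨h.1, fun i hi => ?_⟩
  obtain ⟨a, b, h1, h2, h3, h4, h5, h6, h7⟩ := h.2 i hi
  have hq := T.div_lt_quo hi
  have k1 := Nat.mod_lt (i / r) hr
  have k2 := Nat.mod_lt i hr
  have := h.1
  have := Nat.zero_le (i / (r * r))
  refine ⟨a, b, ?_, ?_, ?_, h4, h5, h6, h7⟩
  · rw [hm _ (by omega) (by omega), h1]
  · rw [hm _ (by omega) (by omega), h2]
  · rw [hm _ (by omega) (by omega), h3]

theorem IsFarTable.mono {mem : ℕ → ℕ} {p r ρ t lim lim' : ℕ} (h : T.IsFarTable mem p lim r ρ t)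
    (hl : lim ≤ lim') : T.IsFarTable mem p lim' r ρ t := by
  refine ⟨h.1.trans hl, fun i hi => ?_⟩
  obtain ⟨a, b, h1, h2, h3, h4, h5, h6, h7⟩ := h.2 i hi
  exact ⟨a, b, h1, h2, h3, h4, h5.trans hl, h6, h7.trans hl⟩

/-- The second `compress` runs on the directory left by the first, so a value is found by three
reads: final directory, block of pointers, block of values. -/
theorem farTable_spec {τ : State} {u p : ℕ} {Q : State → ℕ → Prop} {r ρ t : ℕ} (ht : t < T.n)
    (hP : T.Params r ρ) (hG : T.Globals r ρ τ) (h10 : τ.reg 10 = t) (h6 : τ.reg 6 = p)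
    (h14 : τ.reg 14 = T.dep t + 1 - r * r)
    (h12 : r * r ≤ T.dep t → τ.reg 12 = T.piv (r * r) ρ t)
    (h13 : r * r ≤ T.dep t → τ.reg 13 = T.dst t - T.dst (T.piv (r * r) ρ t))
    (hV : ∀ i ≤ T.dep t, τ.mem (2 * T.Z + i) = T.anc t i)
    (hp : T.base ≤ p) (hpZ : p + T.farCost r ρ t + r ≤ T.Z)
    (hQ : ∀ τ' u', (∀ i < 20, i ≠ 6 → i ≠ 16 → τ'.reg i = τ.reg i) →
      p ≤ τ'.reg 6 → τ'.reg 6 ≤ p + T.farCost r ρ t →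
      τ'.mem (14 + 8 * t) = p → T.IsFarTable τ'.mem p (τ'.reg 6) r ρ t →
      (∀ a < p, a ≠ 14 + 8 * t → τ'.mem a = τ.mem a) →
      u' ≤ u + (1000 * T.n + 300) → Q τ' u') :
    wp w O farTable τ u Q := by
  have hd := T.dep_lt t ht
  have hZ := T.le_Z
  have hZw := T.Z_bound
  obtain ⟨hr1, hrr, hN1, hN, hN', hN''⟩ := hP.bounds
  have hn := hP.le
  have hr0 := hP.pos
  have hbase : T.base = 8 + 8 * T.n := rfl
  have hc : ∀ k < 64, k % 2 ^ w = k := fun k hk => Nat.mod_eq_of_lt (by omega)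
  have m8 : 8 * t % 2 ^ w = 8 * t := Nat.mod_eq_of_lt (by omega)
  have mk : ∀ k < 64, (k + 8 * t) % 2 ^ w = k + 8 * t := fun k hk => Nat.mod_eq_of_lt (by omega)
  set q := T.quo r with hq
  have hrq : r * q * r = r * r * q := by ring
  have hqr : q * r = r * q := Nat.mul_comm _ _
  have hq1 : 1 ≤ q := Nat.le_add_left 1 _
  have hrq1 : 1 ≤ r * q := Nat.mul_pos hr0 hq1
  set K := changes (T.far (r * r) ρ t) (r * r * q) with hK
  -- The two terms differ because the first directory may have up to `2 * K` changes, against `K`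
  -- for the array itself.
  have hcost : T.farCost r ρ t = q + (r * (2 * K + 2) + r * (2 * (2 * K) + 2)) := by
    unfold farCost
    ring
  rw [hcost] at hpZ hQ
  have hb3 : ∀ a, r * (2 * a + 3) = r * (2 * a + 2) + r := fun a => by ring
  have hw : 1 < 2 ^ w := by omega
  have m1 : (p + q) % 2 ^ w = p + q := Nat.mod_eq_of_lt (by omega)
  have m2 : r * q % 2 ^ w = r * q := Nat.mod_eq_of_lt (by omega)
  refine wp_cons (T.farArray_spec (L := r * r) (ρ := ρ) (q := q) (v := 2 * T.Z) (f := 3 * T.Z) ht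
    hG.r4 hG.r9 hG.r8 h10 h14 hG.r17 h12 h13 hG.r18 hN1 (by omega) (by omega) hV ?_)
  intro σ u₁ hr hF hf hu
  have g3 : σ.reg 3 = r := (hr 3 (by decide)).trans hG.r3
  have g6 : σ.reg 6 = p := (hr 6 (by decide)).trans h6
  have g9 : σ.reg 9 = q := (hr 9 (by decide)).trans hG.r9
  have g10 : σ.reg 10 = t := (hr 10 (by decide)).trans h10
  have g18 : σ.reg 18 = 3 * T.Z := (hr 18 (by decide)).trans hG.r18
  have g19 : σ.reg 19 = 4 * T.Z := (hr 19 (by decide)).trans hG.r19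
  refine wp_cons (wp_put rfl rfl (wp_cons (wp_set rfl (wp_cons (wp_set rfl (wp_cons (wp_set rfl
    (wp_cons (wp_set rfl (wp_cons (wp_set rfl (wp_cons (compress_spec (p := p + q) (b := r)
    (src := 3 * T.Z) (N := r * q) (dir := 4 * T.Z) (Z := T.Z) (A := T.far (r * r) ρ t)
    ?_ ?_ ?_ ?_ ?_ ?_ ?_ (by omega) (by omega) (by omega) (by omega) (by omega) hw ?_)))))))))))))
  · simp [g3]
  · simp [g6, g9, m1]
  · simp [g18]
  · simp [g3, g9, m2]
  · simp [g19]
  · intro i hi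
    simp [g10, hc, m8, mk]
    rw [if_neg (by omega), hF i (by omega)]
  · rw [hrq, ← hK, hb3]
    omega
  intro σ₁ u₂ hr₁ hp1 hp1' hf₁ hd₁ hch₁ hu₁
  rw [hrq, ← hK] at hch₁ hp1'
  simp at hu₁
  have g₁ : ∀ i < 20, i ≠ 6 → i ≠ 16 → σ₁.reg i = σ.reg i := fun i hi h1 h2 => by
    rw [hr₁ i hi h1]
    simp [h1, h2, show i ≠ 20 by omega, show i ≠ 21 by omega, show i ≠ 22 by omega]
  have gf₁ : ∀ a < p + q, a ≠ 14 + 8 * t → σ₁.mem a = σ.mem a := fun a ha h => by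
    rw [hf₁ a (by omega) (by omega)]
    simp [g10, hc, m8, mk, h]
  have gp₁ : σ₁.mem (14 + 8 * t) = p := by
    rw [hf₁ _ (by omega) (by omega)]
    simp [g10, hc, m8, mk, g6]
  have g16 : σ₁.reg 16 = p := by
    rw [hr₁ 16 (by decide) (by decide)]
    simp [g6]
  have hle : r * (2 * changes (fun j => σ₁.mem (4 * T.Z + j)) (q * r) + 2) ≤
      r * (2 * (2 * K) + 2) := by
    rw [hqr]
    exact Nat.mul_le_mul_left r (by omega)
  refine wp_cons (wp_set rfl (wp_cons (wp_set rfl (wp_cons (wp_set rfl (wp_cons (compress_spec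
    (p := σ₁.reg 6) (b := r) (src := 4 * T.Z) (N := q) (dir := p) (Z := T.Z)
    (A := fun j => σ₁.mem (4 * T.Z + j)) ?_ ?_ ?_ ?_ ?_ ?_ ?_ (by omega) (by omega) (by omega)
    (by omega) (by omega) hw ?_)))))))
  · simp [g₁ 3, g3]
  · simp
  · simp [g₁ 19, g19]
  · simp [g₁ 9, g9]
  · simp [g16]
  · intro i hi
    simp
  · rw [hb3]
    omega
  intro σ₂ u₃ hr₂ hp2 hp2' hf₂ hd₂ hch₂ hu₂
  simp at hu₂
  have gf₂ : ∀ a, a < σ₁.reg 6 → a < p ∨ p + q ≤ a → σ₂.mem a = σ₁.mem a := fun a ha h => by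
    rw [hf₂ a (by omega) (by omega)]
    simp
  refine wp_nil (hQ _ _ (fun i hi h1 h2 => ?_) (by omega) (by omega) ?_ ⟨by omega, fun i hi => ?_⟩
    (fun a ha h => ?_) ?_)
  · rw [hr₂ i hi h1, ← hr i hi, ← g₁ i hi h1 h2]
    simp [show i ≠ 20 by omega, show i ≠ 21 by omega, show i ≠ 22 by omega]
  · rw [gf₂ _ (by omega) (by omega), gp₁]
  · have k1 := Nat.mod_lt (i / r) hr0
    have k2 := Nat.mod_lt i hr0
    have k3 := T.div_lt_quo hi
    have k4 : i / r < r * q := Nat.div_lt_of_lt_mul (by rwa [← Nat.mul_assoc])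
    -- Entry `i` is at offset `i % r` of block `i / r`, and the pointer to this block is at offset
    -- `i / r % r` of block `i / (r * r)` of the first directory.
    have k5 : i / (r * r) * r + i / r % r = i / r := by
      rw [← Nat.div_div_eq_div_mul]
      exact Nat.div_add_mod' _ _
    have k6 : i / r * r + i % r = i := Nat.div_add_mod' _ _
    obtain ⟨a1, a2, a3⟩ := hd₂ _ k3
    obtain ⟨b1, b2, b3⟩ := hd₁ _ k4
    refine ⟨_, σ₁.mem (4 * T.Z + i / r), rfl, ?_, ?_, by omega, a2, by omega, by omega⟩
    · rw [a3 _ k1, k5]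
    · rw [gf₂ _ (by omega) (by omega), b3 _ k2, k6]
  · rw [gf₂ a (by omega) (by omega), gf₁ a (by omega) h, hf a (by omega)]
  · have e1 : r * q * (40 * r + 80) = 40 * (r * r * q) + 80 * (r * q) := by ring
    have e2 : q * (40 * r + 80) = 40 * (r * q) + 80 * q := by ring
    rw [e1] at hu₁
    rw [e2] at hu₂
    omega

end Inp
end SSDSO

/-! ### Processing all vertices -/

namespace SSDSO

open Ex Prog

variable {w : ℕ} {O : Oracle}

/-- Write the data of the vertex `r 10`. -/
def process : Prog := block [prologue, tables, farTable, set 10 (r 10 + c 1)]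

/-- Write the data of all vertices. -/
def processAll : Prog := block [set 10 (c 0), while' (lt (r 10) (r 0)) process]

namespace Inp

variable (T : Inp w O)

/-- The data of the vertex `t` are stored below `lim`. -/
structure Stored (mem : ℕ → ℕ) (lim r ρ t : ℕ) : Prop where
  lo : mem (15 + 8 * t) = T.dep t + 1 - r * r
  piv : r * r ≤ T.dep t → mem (13 + 8 * t) = T.piv (r * r) ρ t
  near_base : T.base ≤ mem (11 + 8 * t)
  near_lim : mem (11 + 8 * t) + 2 * (r * r) ≤ lim
  near : T.IsTable mem (mem (11 + 8 * t)) (T.dep t + 1 - r * r) t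
  row : T.dep t % (r * r) = ρ → T.base ≤ mem (12 + 8 * t) ∧ mem (12 + 8 * t) + 2 * T.n ≤ lim ∧
    T.IsTable mem (mem (12 + 8 * t)) 0 t
  far_base : T.base ≤ mem (14 + 8 * t)
  far : T.IsFarTable mem (mem (14 + 8 * t)) lim r ρ t

variable {T}

/-- What is stored for `t` lies in its own record and between `base` and `lim`. Processing later
vertices appends beyond `lim` and writes other records, so it stays valid. -/
theorem Stored.congr {mem mem' : ℕ → ℕ} {lim lim' r ρ t : ℕ} (h : T.Stored mem lim r ρ t)
    (ht : t < T.n) (hr : 1 ≤ r) (hl : lim ≤ lim')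
    (hm : ∀ a, T.base ≤ a → a < lim → mem' a = mem a)
    (hm' : ∀ a, 11 + 8 * t ≤ a → a ≤ 15 + 8 * t → mem' a = mem a) :
    T.Stored mem' lim' r ρ t := by
  have hd := T.dep_lt t ht
  obtain ⟨h1, h2, h3, h4, h5, h6, h7, h8⟩ := h
  have e11 := hm' (11 + 8 * t) (by omega) (by omega)
  have e12 := hm' (12 + 8 * t) (by omega) (by omega)
  have e13 := hm' (13 + 8 * t) (by omega) (by omega)
  have e14 := hm' (14 + 8 * t) (by omega) (by omega)
  have e15 := hm' (15 + 8 * t) (by omega) (by omega)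
  refine ⟨e15.trans h1, fun h => e13.trans (h2 h), by omega, by omega, ?_, fun h => ?_, by omega, ?_⟩
  · rw [e11]
    exact IsTable.congr T h5 (lim := lim) (by omega) fun a _ _ => hm a (by omega) (by omega)
  · rw [e12]
    obtain ⟨k1, k2, k3⟩ := h6 h
    exact ⟨k1, by omega, IsTable.congr T k3 (lim := lim) (by omega)
      fun a _ _ => hm a (by omega) (by omega)⟩
  · rw [e14]
    exact IsFarTable.mono T (IsFarTable.congr T h8 hr fun a _ _ => hm a (by omega) (by omega)) hl

variable (T)

/-- The summand `T.n` in the bound for `Z` leaves room for the block that `compress` copies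
tentatively beyond its output, as `r ≤ T.n`. -/
theorem process_spec {τ : State} {u p : ℕ} {Q : State → ℕ → Prop} {r ρ t : ℕ} (ht : t < T.n)
    (hP : T.Params r ρ) (hG : T.Globals r ρ τ) (h10 : τ.reg 10 = t) (h6 : τ.reg 6 = p)
    (hdep : ∀ c < T.n, τ.mem (9 + 8 * c) = T.dep c) (hdst : ∀ c < T.n, τ.mem (10 + 8 * c) = T.dst c)
    (hp : T.base ≤ p) (hpZ : p + (T.tableCost r ρ t + T.farCost r ρ t) + T.n ≤ T.Z)
    (hQ : ∀ τ' u', T.Globals r ρ τ' → τ'.reg 10 = t + 1 → p ≤ τ'.reg 6 →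
      τ'.reg 6 ≤ p + (T.tableCost r ρ t + T.farCost r ρ t) →
      T.Stored τ'.mem (τ'.reg 6) r ρ t →
      (∀ a < p, a < 11 + 8 * t ∨ 15 + 8 * t < a → τ'.mem a = τ.mem a) →
      u' ≤ u + 2000 * T.n → Q τ' u') :
    wp w O process τ u Q := by
  have hd := T.dep_lt t ht
  have hZ := T.le_Z
  have hZw := T.Z_bound
  have hr0 := hP.pos
  obtain ⟨hr1, hrr, -⟩ := hP.bounds
  have hn := hP.le
  have hbase : T.base = 8 + 8 * T.n := rfl
  have hc : ∀ k < 64, k % 2 ^ w = k := fun k hk => Nat.mod_eq_of_lt (by omega)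
  have m1 : (t + 1) % 2 ^ w = t + 1 := Nat.mod_eq_of_lt (by omega)
  refine wp_cons (T.prologue_spec ht hP hG h10 hdep hdst ?_)
  intro τ₁ u₁ hr₁ h11₁ h14₁ h12₁ h13₁ hV₁ hpiv₁ hlo₁ hf₁ hu₁
  have hG₁ : T.Globals r ρ τ₁ := hG.congr fun i hi h => hr₁ i hi (by omega)
  refine wp_cons (T.tables_spec ht hP hG₁ ((hr₁ 10 (by decide) (by decide)).trans h10)
    ((hr₁ 6 (by decide) (by decide)).trans h6) h11₁ h14₁ hV₁ hp (by omega) ?_)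
  intro τ₂ u₂ hr₂ h6₂ hnp₂ hnear₂ hrow₂ hf₂ hu₂
  have hG₂ : T.Globals r ρ τ₂ := hG₁.congr fun i hi h => hr₂ i hi (by omega)
  refine wp_cons (T.farTable_spec ht hP hG₂
    ((hr₂ 10 (by decide) (by decide)).trans ((hr₁ 10 (by decide) (by decide)).trans h10))
    h6₂ ((hr₂ 14 (by decide) (by decide)).trans h14₁)
    (fun h => (hr₂ 12 (by decide) (by decide)).trans (h12₁ h))
    (fun h => (hr₂ 13 (by decide) (by decide)).trans (h13₁ h)) (fun i hi => ?_) (by omega)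
    (by omega) ?_)
  · rw [hf₂ _ (by omega) (by omega) (by omega), hV₁ i hi]
  intro τ₃ u₃ hr₃ h6₃ h6₃' htp₃ hfar₃ hf₃ hu₃
  have hG₃ : T.Globals r ρ τ₃ := hG₂.congr fun i hi h => hr₃ i hi (by omega) (by omega)
  have h10₃ : τ₃.reg 10 = t := (hr₃ 10 (by decide) (by decide) (by decide)).trans
    ((hr₂ 10 (by decide) (by decide)).trans ((hr₁ 10 (by decide) (by decide)).trans h10))
  have htc : 2 * (r * r) ≤ T.tableCost r ρ t := by unfold tableCost; omega
  have e11 : τ₃.mem (11 + 8 * t) = p := by rw [hf₃ _ (by omega) (by omega), hnp₂]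
  refine wp_cons (wp_set rfl (wp_nil (hQ _ _ (hG₃.congr fun i hi h => ?_) ?_ ?_ ?_
    ⟨?_, fun h => ?_, ?_, ?_, ?_, fun h => ?_, ?_, ?_⟩ (fun a ha h => ?_) ?_)))
  · simp [show i ≠ 10 by omega]
  · simp [h10₃, hc, m1]
  · simp
    omega
  · simp
    omega
  · simp only [State.setReg_mem]
    rw [hf₃ _ (by omega) (by omega), hf₂ _ (by omega) (by omega) (by omega), hlo₁]
  · simp only [State.setReg_mem]
    rw [hf₃ _ (by omega) (by omega), hf₂ _ (by omega) (by omega) (by omega), hpiv₁ h]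
  · simp only [State.setReg_mem]
    omega
  · simp only [State.setReg_mem, State.setReg_reg, Nat.reduceEqDiff, if_false]
    omega
  · simp only [State.setReg_mem]
    rw [e11]
    exact IsTable.congr T hnear₂ (lim := p + T.tableCost r ρ t) (by omega)
      fun a _ _ => hf₃ a (by omega) (by omega)
  · obtain ⟨k1, k2⟩ := hrow₂ h
    have e12 : τ₃.mem (12 + 8 * t) = p + 2 * (r * r) := by
      rw [hf₃ _ (by omega) (by omega), k1]
    have htc' : T.tableCost r ρ t = 2 * (r * r) + 2 * T.n := by unfold tableCost; rw [if_pos h]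
    simp only [State.setReg_mem, State.setReg_reg, Nat.reduceEqDiff, if_false]
    rw [e12]
    exact ⟨by omega, by omega, IsTable.congr T k2 (lim := p + T.tableCost r ρ t) (by omega)
      fun a _ _ => hf₃ a (by omega) (by omega)⟩
  · simp only [State.setReg_mem]
    omega
  · simp only [State.setReg_mem, State.setReg_reg, Nat.reduceEqDiff, if_false]
    rw [htp₃]
    exact hfar₃
  · simp only [State.setReg_mem]
    rw [hf₃ _ (by omega) (by omega), hf₂ _ (by omega) (by omega) (by omega),
      hf₁ _ (by omega) (by omega) (by omega)]
  · simp
    omega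

/-- A bound for the length of the output. -/
noncomputable def total (r ρ k : ℕ) : ℕ :=
  T.base + ∑ t ∈ Finset.range k, (T.tableCost r ρ t + T.farCost r ρ t)

theorem total_succ (r ρ k : ℕ) :
    T.total r ρ (k + 1) = T.total r ρ k + (T.tableCost r ρ k + T.farCost r ρ k) := by
  unfold total
  rw [Finset.sum_range_succ, Nat.add_assoc]

theorem total_mono (r ρ : ℕ) : Monotone (T.total r ρ) :=
  monotone_nat_of_le_succ fun k => by rw [total_succ]; omega

/-- A cubic bound suffices here: it only has to separate the output from the scratch memory. The
true bound for the space is `total_mul_le`. -/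
theorem total_le {r ρ : ℕ} (hP : T.Params r ρ) : T.total r ρ T.n + T.n ≤ T.Z := by
  obtain ⟨hr1, hrr, hN1, hN, hN', hN''⟩ := hP.bounds
  have hn := hP.le
  have h1 : ∀ t ∈ Finset.range T.n, T.tableCost r ρ t + T.farCost r ρ t ≤
      10 * T.n + 6 * T.n ^ 2 := fun t ht => by
    have h2 : T.tableCost r ρ t ≤ 4 * T.n := by unfold tableCost; split_ifs <;> omega
    have h3 := T.changes_far_le (L := r * r) (ρ := ρ) (Finset.mem_range.1 ht) (r * r * T.quo r)
    have h4 : T.farCost r ρ t ≤ 2 * T.n + T.n * (6 * T.n + 4) := by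
      unfold farCost
      exact Nat.add_le_add hN'' (Nat.mul_le_mul (by omega) (by omega))
    have h5 : T.n * (6 * T.n + 4) = 6 * T.n ^ 2 + 4 * T.n := by ring
    omega
  have h2 := Finset.sum_le_sum h1
  rw [Finset.sum_const, Finset.card_range, smul_eq_mul] at h2
  have h3 : T.n * (10 * T.n + 6 * T.n ^ 2) + 8 + 10 * T.n ≤ 64 * (T.n + 1) ^ 3 := by nlinarith
  unfold total Z base
  omega

theorem processAll_spec {τ : State} {u : ℕ} {Q : State → ℕ → Prop} {r ρ : ℕ}
    (hP : T.Params r ρ) (hG : T.Globals r ρ τ) (h6 : τ.reg 6 = T.base)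
    (hdep : ∀ c < T.n, τ.mem (9 + 8 * c) = T.dep c) (hdst : ∀ c < T.n, τ.mem (10 + 8 * c) = T.dst c)
    (hQ : ∀ τ' u', T.Globals r ρ τ' → T.base ≤ τ'.reg 6 → τ'.reg 6 ≤ T.total r ρ T.n →
      (∀ t < T.n, T.Stored τ'.mem (τ'.reg 6) r ρ t) →
      (∀ a < T.base, (∀ t < T.n, a < 11 + 8 * t ∨ 15 + 8 * t < a) → τ'.mem a = τ.mem a) →
      u' ≤ u + 3000 * T.n ^ 2 → Q τ' u') :
    wp w O processAll τ u Q := by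
  have hZ := T.le_Z
  have hZw := T.Z_bound
  have hn := T.n_pos
  have w1 : 1 % 2 ^ w = 1 := Nat.mod_eq_of_lt (by omega)
  refine wp_cons (wp_set rfl (wp_cons ?_))
  refine wp_while (fun j σ => T.Globals r ρ σ ∧ σ.reg 10 = j ∧ T.base ≤ σ.reg 6 ∧
      σ.reg 6 ≤ T.total r ρ j ∧ (∀ t < j, T.Stored σ.mem (σ.reg 6) r ρ t) ∧
      (∀ a < T.base, (∀ t < T.n, a < 11 + 8 * t ∨ 15 + 8 * t < a) → σ.mem a = τ.mem a))
    T.n (2000 * T.n) rfl ?_ ?_ ?_ ?_ ?_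
  · refine ⟨hG.congr fun i hi h => ?_, ?_⟩
    · simp [show i ≠ 10 by omega]
    · simp [h6, total]
  · rintro j σ hj ⟨hGσ, h10, -⟩
    simp [h10, hGσ.r0, hj, w1]
  · rintro σ ⟨hGσ, h10, -⟩
    simp [h10, hGσ.r0]
  · rintro j σ u' hj ⟨hGσ, h10, hb, htot, hst, hm⟩
    have h1 := T.total_succ r ρ j
    have h2 := T.total_mono r ρ (show j + 1 ≤ T.n from hj)
    have h3 := T.total_le hP
    have hbase : T.base = 8 + 8 * T.n := rfl
    refine T.process_spec hj hP hGσ h10 rfl (fun c hc => ?_) (fun c hc => ?_) hb (by omega) ?_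
    · rw [hm _ (by omega) (by omega), hdep c hc]
    · rw [hm _ (by omega) (by omega), hdst c hc]
    intro σ' u'' hG' h10' hle hle' hst' hm' hu
    refine ⟨⟨hG', h10', by omega, by omega, fun t ht => ?_, fun a ha h => ?_⟩, hu⟩
    · rcases Nat.lt_succ_iff_lt_or_eq.1 ht with ht | rfl
      · exact (hst t ht).congr (ht.trans hj) hP.pos hle (fun a h1 h2 => hm' a h2 (by omega))
          fun a h1 h2 => hm' a (by omega) (by omega)
      · exact hst'
    · rw [hm' a (by omega) (h j hj), hm a ha h]
  · rintro σ u' ⟨hGσ, h10, hb, htot, hst, hm⟩ hu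
    refine wp_nil (hQ σ _ hGσ hb htot hst hm ?_)
    simp at hu
    have : T.n * (2000 * T.n + 3 + 1) = 2000 * T.n ^ 2 + 4 * T.n := by ring
    nlinarith

end Inp
end SSDSO

namespace SSDSO

open Ex Prog

variable {w : ℕ} {O : Oracle}

/-! ### The preprocessing -/

/-- Compute the block length. -/
def blockLength : Prog := block [
  set 3 (c 1),
  while' (lt ((r 3 + c 1) * (r 3 + c 1) * (r 3 + c 1) *
      ((r 3 + c 1) * (r 3 + c 1) * (r 3 + c 1)) * r 1) (r 0 + c 1)) (set 3 (r 3 + c 1))]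

/-- Compute the constants. -/
def constants : Prog := block [
  set 4 (r 3 * r 3),
  set 7 (c 64 * ((r 0 + c 1) * (r 0 + c 1) * (r 0 + c 1))),
  -- The word for `∞`, obtained by wrapping around.
  set 8 (c 0 - c 1),
  set 9 (r 0 / r 4 + c 1),
  set 6 (c 8 + c 8 * r 0),
  set 17 (c 2 * r 7),
  set 18 (c 3 * r 7),
  set 19 (c 4 * r 7),
  put (c 0) (r 3)]

/-- Walk from `r 10` to the root and compute the depth and the distance. -/
def climb : Prog := block [
  set 20 (r 10), set 21 (c 0), set 22 (c 0), query .parent 23 (r 20) (c 0),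
  while' (lt (r 23) (r 0)) (block [
    query .weight 24 (r 20) (c 0),
    set 22 (r 22 + r 24),
    set 20 (r 23),
    set 21 (r 21 + c 1),
    query .parent 23 (r 20) (c 0)])]

/-- Write the parents, depths and distances of all vertices, and the frequencies of the residues of
the depths. -/
def distances : Prog := block [
  set 10 (c 0),
  while' (lt (r 10) (r 0)) (block [
    climb,
    put (c 9 + c 8 * r 10) (r 21),
    query .parent 23 (r 10) (c 0),
    put (c 8 + c 8 * r 10) (r 23),
    -- Register `20` holds the root that was reached. It differs from `s` exactly if the vertex
    -- cannot be reached from `s`.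
    cond (eq (r 20) (r 2)) skip (set 22 (r 8)),
    put (c 10 + c 8 * r 10) (r 22),
    put (r 7 + r 21 % r 4) (ld (r 7 + r 21 % r 4) + c 1),
    set 10 (r 10 + c 1)])]

/-- Find the least frequent residue. -/
def leastResidue : Prog := block [
  set 5 (c 0), set 20 (c 1),
  while' (lt (r 20) (r 4)) (block [
    cond (lt (ld (r 7 + r 20)) (ld (r 7 + r 5))) (set 5 (r 20)) skip,
    set 20 (r 20 + c 1)])]

/-- The preprocessing. -/
def preprocess : Prog :=
  block [blockLength, constants, distances, leastResidue, processAll, set 0 (r 6)]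

/-! ### Correctness of the preprocessing -/

namespace Inp

variable (T : Inp w O)

/-- The number of vertices below `k` whose depth has the residue `q` modulo `L`. -/
def count (L k q : ℕ) : ℕ := ((Finset.range k).filter fun t => T.dep t % L = q).card

theorem count_succ (L k q : ℕ) :
    T.count L (k + 1) q = T.count L k q + if T.dep k % L = q then 1 else 0 := by
  unfold count
  rw [Finset.range_add_one, Finset.filter_insert]
  split_ifs with h
  · rw [Finset.card_insert_of_notMem (by simp)]
  · simp

theorem count_le (L k q : ℕ) : T.count L k q ≤ k := by
  simpa [count] using Finset.card_filter_le (Finset.range k) fun t => T.dep t % L = q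

/-- The residue classes partition the vertices, and the class of `ρ` is a smallest one; so the
pivots number at most `k / L`. -/
theorem mul_count_le {L k ρ : ℕ} (hL : 1 ≤ L) (h : ∀ i < L, T.count L k ρ ≤ T.count L k i) :
    L * T.count L k ρ ≤ k := by
  have h1 : (Finset.range k).card = ∑ q ∈ Finset.range L, T.count L k q :=
    Finset.card_eq_sum_card_fiberwise fun t _ => Finset.mem_coe.2 (Finset.mem_range.2 (Nat.mod_lt _ hL))
  have h2 : ∑ q ∈ Finset.range L, T.count L k ρ ≤ ∑ q ∈ Finset.range L, T.count L k q :=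
    Finset.sum_le_sum fun i hi => h i (Finset.mem_range.1 hi)
  rw [Finset.sum_const, Finset.card_range, smul_eq_mul] at h2
  rw [Finset.card_range] at h1
  omega

/-- Excludes overflow in the intermediate products of the test in `blockLength` and in the
computation of `Z`. -/
theorem cube_bound {a : ℕ} (ha : a ≤ T.n + 1) :
    a * a < 2 ^ w ∧ a * a * a < 2 ^ w ∧ a * a * a * (a * a * a) < 2 ^ w ∧
      a * a * a * (a * a * a) * T.M < 2 ^ w := by
  have hx := T.pow_bound 2 1 7 (by norm_num) (by norm_num)
  have hM := T.hM
  set x := T.n + T.M + 1 with hxd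
  have h1 : a ≤ x := by omega
  have h2 : 1 ≤ x := by omega
  have h7 : 0 < x ^ 7 := by positivity
  have key : ∀ k ≤ 7, a ^ k < 2 ^ w := fun k hk => by
    have := (Nat.pow_le_pow_left h1 k).trans (Nat.pow_le_pow_right h2 hk)
    omega
  refine ⟨?_, ?_, ?_, ?_⟩
  · convert key 2 (by norm_num) using 1; ring
  · convert key 3 (by norm_num) using 1; ring
  · convert key 6 (by norm_num) using 1; ring
  · have : a * a * a * (a * a * a) * T.M ≤ x ^ 6 * x := by
      refine Nat.mul_le_mul ?_ (by omega)
      calc a * a * a * (a * a * a) = a ^ 6 := by ring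
        _ ≤ x ^ 6 := Nat.pow_le_pow_left h1 6
    have e : x ^ 6 * x = x ^ 7 := by ring
    omega

theorem blockLength_spec {τ : State} {u : ℕ} {Q : State → ℕ → Prop} (h0 : τ.reg 0 = T.n)
    (h1 : τ.reg 1 = T.M)
    (hQ : ∀ τ' u' r, (∀ i < 20, i ≠ 3 → τ'.reg i = τ.reg i) → τ'.mem = τ.mem → τ'.reg 3 = r →
      1 ≤ r → (r = 1 ∨ r ^ 6 * T.M ≤ T.n) → T.n < (r + 1) ^ 6 * T.M → r ≤ T.n →
      u' ≤ u + (60 * T.n + 60) → Q τ' u') :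
    wp w O blockLength τ u Q := by
  have hM := T.hM
  have hn := T.n_pos
  have hlb := T.len_bound
  have w1 : 1 % 2 ^ w = 1 := Nat.mod_eq_of_lt (by omega)
  -- The loop ends with block length `N + 1`, where `N` is least such that the next candidate `N +
  -- 2` is too large. If it never runs, the length is `1`, for which the upper bound on `r ^ 6 * M`
  -- may fail.
  have hex : ∃ j, T.n < (j + 2) ^ 6 * T.M := ⟨T.n, by
    have : T.n + 2 ≤ (T.n + 2) ^ 6 := Nat.le_self_pow (by norm_num) _
    have := Nat.mul_le_mul this hM
    omega⟩
  classical
  set N := Nat.find hex with hN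
  have hNs : T.n < (N + 2) ^ 6 * T.M := Nat.find_spec hex
  have hNm : ∀ j < N, (j + 2) ^ 6 * T.M ≤ T.n := fun j hj => not_lt.1 (Nat.find_min hex hj)
  have hNn : N + 1 ≤ T.n := by
    by_contra hc
    have h2 := hNm (T.n - 1) (by omega)
    have h3 : T.n - 1 + 2 ≤ (T.n - 1 + 2) ^ 6 := Nat.le_self_pow (by norm_num) _
    have := Nat.mul_le_mul h3 hM
    omega
  have hcond : ∀ j ≤ N, ∀ σ : State, (∀ i < 20, i ≠ 3 → σ.reg i = τ.reg i) → σ.reg 3 = j + 1 →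
      (lt ((r 3 + c 1) * (r 3 + c 1) * (r 3 + c 1) *
      ((r 3 + c 1) * (r 3 + c 1) * (r 3 + c 1)) * r 1) (r 0 + c 1)).eval w σ =
      if (j + 2) ^ 6 * T.M < T.n + 1 then 1 else 0 := by
    intro j hj σ hr h3
    obtain ⟨b1, b2, b3, b4⟩ := T.cube_bound (show j + 2 ≤ T.n + 1 by omega)
    have e : (j + 2) ^ 6 * T.M =
      (j + 2) * (j + 2) * (j + 2) * ((j + 2) * (j + 2) * (j + 2)) * T.M := by ring
    simp only [eval_lt, eval_mul, eval_add, eval_r, eval_c, h3, w1, hr 0 (by decide) (by decide),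
      hr 1 (by decide) (by decide), h0, h1, Nat.mod_eq_of_lt (show j + 1 + 1 < 2 ^ w by omega),
      Nat.mod_eq_of_lt (show T.n + 1 < 2 ^ w by omega), Nat.add_assoc, Nat.reduceAdd,
      Nat.mod_eq_of_lt b1, Nat.mod_eq_of_lt b2, Nat.mod_eq_of_lt b3, Nat.mod_eq_of_lt b4, e]
  refine wp_cons (wp_set rfl (wp_cons ?_))
  refine wp_while (fun j σ => (∀ i < 20, i ≠ 3 → σ.reg i = τ.reg i) ∧ σ.mem = τ.mem ∧
      σ.reg 3 = j + 1) N 5 rfl ?_ ?_ ?_ ?_ ?_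
  · refine ⟨fun i hi h => ?_, rfl, ?_⟩
    · simp [h]
    · simp [w1]
  · rintro j σ hj ⟨hr, -, h3⟩
    rw [hcond j hj.le σ hr h3, if_pos (by have := hNm j hj; omega)]
    exact one_ne_zero
  · rintro σ ⟨hr, -, h3⟩
    rw [hcond N le_rfl σ hr h3, if_neg (by omega)]
  · rintro j σ u' hj ⟨hr, hm, h3⟩
    refine wp_set rfl ⟨⟨fun i hi h => ?_, hm, ?_⟩, ?_⟩
    · simp [h, hr i hi h]
    · simp [h3, w1, Nat.mod_eq_of_lt (show j + 1 + 1 < 2 ^ w by omega)]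
    · simp
  · rintro σ u' ⟨hr, hm, h3⟩ hu
    refine wp_nil (hQ σ _ (N + 1) hr hm h3 (by omega) ?_ hNs hNn ?_)
    · rcases Nat.eq_zero_or_pos N with h | h
      · left; omega
      · right
        have := hNm (N - 1) (by omega)
        rwa [show N - 1 + 2 = N + 1 by omega] at this
    · simp at hu
      omega

theorem constants_spec {τ : State} {u : ℕ} {Q : State → ℕ → Prop} {r₀ : ℕ} (h0 : τ.reg 0 = T.n)
    (h3 : τ.reg 3 = r₀) (hrn : r₀ * r₀ ≤ T.n)
    (hQ : ∀ τ' u', T.Globals r₀ (τ'.reg 5) τ' → τ'.reg 2 = τ.reg 2 → τ'.reg 6 = T.base →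
      τ'.reg 7 = T.Z → (∀ a, τ'.mem a = if a = 0 then r₀ else τ.mem a) → u' ≤ u + 100 → Q τ' u') :
    wp w O constants τ u Q := by
  have hZ := T.le_Z
  have hZw := T.Z_bound
  have hn := T.n_pos
  obtain ⟨b1, b2, -, -⟩ := T.cube_bound le_rfl
  have hZe : 64 * ((T.n + 1) * (T.n + 1) * (T.n + 1)) = T.Z := by unfold Z; ring
  have hc : ∀ k < 64, k % 2 ^ w = k := fun k hk => Nat.mod_eq_of_lt (by omega)
  have hc64 : 64 % 2 ^ w = 64 := Nat.mod_eq_of_lt (by omega)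
  have m1 : (T.n + 1) % 2 ^ w = T.n + 1 := Nat.mod_eq_of_lt (by omega)
  have m2 : r₀ * r₀ % 2 ^ w = r₀ * r₀ := Nat.mod_eq_of_lt (by omega)
  have m3 : T.Z % 2 ^ w = T.Z := Nat.mod_eq_of_lt (by omega)
  have m4 : (2 ^ w - 1) % 2 ^ w = T.inf := Nat.mod_eq_of_lt (by omega)
  have hdiv : T.n / (r₀ * r₀) ≤ T.n := Nat.div_le_self _ _
  have m5 : (T.n / (r₀ * r₀) + 1) % 2 ^ w = T.quo r₀ := Nat.mod_eq_of_lt (by omega)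
  have m6 : 8 * T.n % 2 ^ w = 8 * T.n := Nat.mod_eq_of_lt (by omega)
  have m7 : (8 + 8 * T.n) % 2 ^ w = T.base := Nat.mod_eq_of_lt (by omega)
  have m8 : 2 * T.Z % 2 ^ w = 2 * T.Z := Nat.mod_eq_of_lt (by omega)
  have m9 : 3 * T.Z % 2 ^ w = 3 * T.Z := Nat.mod_eq_of_lt (by omega)
  have m10 : 4 * T.Z % 2 ^ w = 4 * T.Z := Nat.mod_eq_of_lt (by omega)
  refine wp_cons (wp_set rfl (wp_cons (wp_set rfl (wp_cons (wp_set rfl (wp_cons (wp_set rfl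
    (wp_cons (wp_set rfl (wp_cons (wp_set rfl (wp_cons (wp_set rfl (wp_cons (wp_set rfl
    (wp_cons (wp_put rfl rfl (wp_nil (hQ _ _ ?_ ?_ ?_ ?_ ?_ ?_)))))))))))))))))))
  · constructor <;> simp only [State.setReg_reg, State.setMem_reg, Nat.reduceEqDiff, if_false,
      reduceIte, eval_r, eval_c, eval_mul, eval_add, eval_sub, eval_div, h0, h3, m1, m2, hc 1, hc 0,
      hc 2, hc 3, hc 4, hc 8, hc64, Nat.mod_eq_of_lt b1, Nat.mod_eq_of_lt b2, hZe, m3, m4, m5,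
      m8, m9, m10, Nat.zero_add, Nat.reduceLT]
  · simp
  · simp [h0, hc, m6, m7]
  · simp [h0, hc, m1, Nat.mod_eq_of_lt b1, Nat.mod_eq_of_lt b2, hZe, m3, hc64]
  · intro a
    simp [hc, h3]
  · simp

/-- Every vertex climbs to its root separately; the depths are below `n`, so quadratic time in all
is enough and no order of the vertices is needed. -/
theorem climb_spec {τ : State} {u : ℕ} {Q : State → ℕ → Prop} {t : ℕ} (ht : t < T.n)
    (h0 : τ.reg 0 = T.n) (h10 : τ.reg 10 = t)
    (hQ : ∀ τ' u', (∀ i < 20, τ'.reg i = τ.reg i) → τ'.mem = τ.mem →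
      τ'.reg 20 = T.anc t 0 → τ'.reg 21 = T.dep t → τ'.reg 22 = T.len t →
      u' ≤ u + (40 * T.n + 40) → Q τ' u') :
    wp w O climb τ u Q := by
  have hd := T.dep_lt t ht
  have hlb := T.len_bound
  have w1 : 1 % 2 ^ w = 1 := Nat.mod_eq_of_lt (by omega)
  have hup : ∀ j < T.dep t, T.up t (j + 1) < T.n := fun j hj => T.up_lt ht hj
  refine wp_cons (wp_set rfl (wp_cons (wp_set rfl (wp_cons (wp_set rfl (wp_cons
    (wp_query rfl rfl (wp_cons ?_))))))))
  refine wp_while (fun j σ => (∀ i < 20, σ.reg i = τ.reg i) ∧ σ.mem = τ.mem ∧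
      σ.reg 20 = T.up t j ∧ σ.reg 21 = j ∧ σ.reg 22 = ∑ i ∈ Finset.range j, T.wgt (T.up t i) ∧
      σ.reg 23 = T.up t (j + 1)) (T.dep t) 25 rfl ?_ ?_ ?_ ?_ ?_
  · refine ⟨fun i hi => ?_, ?_⟩
    · simp [show i ≠ 20 by omega, show i ≠ 21 by omega, show i ≠ 22 by omega,
        show i ≠ 23 by omega]
    · simp [h10, up_zero, T.ask_par t ht, up_succ]
  · rintro j σ hj ⟨hr, -, -, -, -, h23⟩
    simp [h23, hr 0, h0, hup j hj, w1]
  · rintro σ ⟨hr, -, -, -, -, h23⟩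
    simp [h23, hr 0, h0, up_succ, T.par_up_dep ht]
  · rintro j σ u' hj ⟨hr, hm, h20, h21, h22, h23⟩
    have hsum : ∑ i ∈ Finset.range j, T.wgt (T.up t i) + T.wgt (T.up t j) ≤ T.n * T.M := by
      rw [← Finset.sum_range_succ]
      have := T.len_up ht (show j + 1 ≤ T.dep t from hj)
      have := T.len_le t ht
      omega
    have m1 : (∑ i ∈ Finset.range j, T.wgt (T.up t i) + T.wgt (T.up t j)) % 2 ^ w =
        ∑ i ∈ Finset.range j, T.wgt (T.up t i) + T.wgt (T.up t j) := Nat.mod_eq_of_lt (by omega)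
    have m2 : (j + 1) % 2 ^ w = j + 1 := Nat.mod_eq_of_lt (by omega)
    have ask1 := T.ask_wgt _ (T.up_lt ht hj.le)
    have ask2 := T.ask_par _ (hup j hj)
    refine wp_cons (wp_query rfl rfl (wp_cons (wp_set rfl (wp_cons (wp_set rfl (wp_cons
      (wp_set rfl (wp_cons (wp_query rfl rfl (wp_nil
      ⟨⟨fun i hi => ?_, hm, ?_, ?_, ?_, ?_⟩, ?_⟩))))))))))
    · simp [show i ≠ 20 by omega, show i ≠ 21 by omega, show i ≠ 22 by omega,
        show i ≠ 23 by omega, show i ≠ 24 by omega, hr i hi]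
    · simp [h23]
    · simp [h21, w1, m2]
    · simp [h22, h20, ask1, m1, Finset.sum_range_succ]
    · simp only [State.setReg_reg, Nat.reduceEqDiff, if_false, reduceIte, eval_r, h23, ask2]
      exact (T.up_succ t (j + 1)).symm
    · simp
  · rintro σ u' ⟨hr, hm, h20, h21, h22, h23⟩ hu
    refine wp_nil (hQ σ _ hr hm ?_ h21 (by rw [h22, T.sum_wgt_up ht]) ?_)
    · simpa [anc] using h20
    · simp at hu
      omega

/-- The parents, depths and distances of the vertices below `k` are stored. -/
def Basic (mem : ℕ → ℕ) (k : ℕ) : Prop :=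
  ∀ t < k, mem (8 + 8 * t) = T.par t ∧ mem (9 + 8 * t) = T.dep t ∧ mem (10 + 8 * t) = T.dst t

theorem distances_spec {τ : State} {u : ℕ} {Q : State → ℕ → Prop} {r₀ ρ : ℕ}
    (hG : T.Globals r₀ ρ τ) (h2 : τ.reg 2 = T.s) (h7 : τ.reg 7 = T.Z) (hr1 : 1 ≤ r₀ * r₀)
    (hrn : r₀ * r₀ ≤ T.n) (hmZ : ∀ a, T.Z ≤ a → τ.mem a = 0)
    (hQ : ∀ τ' u', (∀ i < 20, i ≠ 10 → τ'.reg i = τ.reg i) → T.Basic τ'.mem T.n →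
      (∀ q < r₀ * r₀, τ'.mem (T.Z + q) = T.count (r₀ * r₀) T.n q) → τ'.mem 0 = τ.mem 0 →
      u' ≤ u + 300 * T.n ^ 2 → Q τ' u') :
    wp w O distances τ u Q := by
  have hZ := T.le_Z
  have hZw := T.Z_bound
  have hn := T.n_pos
  have hc : ∀ k < 64, k % 2 ^ w = k := fun k hk => Nat.mod_eq_of_lt (by omega)
  refine wp_cons (wp_set rfl (wp_cons ?_))
  refine wp_while (fun j σ => (∀ i < 20, i ≠ 10 → σ.reg i = τ.reg i) ∧ σ.reg 10 = j ∧
      T.Basic σ.mem j ∧ (∀ q < r₀ * r₀, σ.mem (T.Z + q) = T.count (r₀ * r₀) j q) ∧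
      σ.mem 0 = τ.mem 0) T.n (40 * T.n + 120) rfl ?_ ?_ ?_ ?_ ?_
  · refine ⟨fun i hi h => ?_, ?_, ?_, ?_, ?_⟩
    · simp [h]
    · simp
    · simp [Basic]
    · intro q hq
      simp [hmZ, count]
    · rfl
  · rintro j σ hj ⟨hr, h10, -⟩
    simp [h10, hr 0, hG.r0, hj, hc]
  · rintro σ ⟨hr, h10, -⟩
    simp [h10, hr 0, hG.r0]
  · rintro j σ u' hj ⟨hr, h10, hb, hcnt, hm0⟩
    refine wp_cons (T.climb_spec hj ((hr 0 (by decide) (by decide)).trans hG.r0) h10 ?_)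
    intro σ₁ u₁ hr₁ hm₁ h20 h21 h22 hu₁
    have g : ∀ i < 20, i ≠ 10 → σ₁.reg i = τ.reg i := fun i hi h => (hr₁ i hi).trans (hr i hi h)
    have g10 : σ₁.reg 10 = j := (hr₁ 10 (by decide)).trans h10
    have g4 : σ₁.reg 4 = r₀ * r₀ := (g 4 (by decide) (by decide)).trans hG.r4
    have g7 : σ₁.reg 7 = T.Z := (g 7 (by decide) (by decide)).trans h7
    have g8 : σ₁.reg 8 = T.inf := (g 8 (by decide) (by decide)).trans hG.r8
    have g2 : σ₁.reg 2 = T.s := (g 2 (by decide) (by decide)).trans h2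
    have m8 : 8 * j % 2 ^ w = 8 * j := Nat.mod_eq_of_lt (by omega)
    have mk : ∀ k < 64, (k + 8 * j) % 2 ^ w = k + 8 * j := fun k hk => Nat.mod_eq_of_lt (by omega)
    have m1 : (j + 1) % 2 ^ w = j + 1 := Nat.mod_eq_of_lt (by omega)
    set q := T.dep j % (r₀ * r₀) with hq
    have hqlt : q < r₀ * r₀ := Nat.mod_lt _ hr1
    have m2 : (T.Z + q) % 2 ^ w = T.Z + q := Nat.mod_eq_of_lt (by omega)
    have m3 : (T.count (r₀ * r₀) j q + 1) % 2 ^ w = T.count (r₀ * r₀) j q + 1 := by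
      have := T.count_le (r₀ * r₀) j q
      exact Nat.mod_eq_of_lt (by omega)
    have ask1 := T.ask_par j hj
    -- Reachable and unreachable vertices are treated alike once register `22` holds `dst`.
    have tail : ∀ σ₂ u₂, (∀ i < 22, σ₂.reg i = σ₁.reg i) → σ₂.reg 22 = T.dst j →
        (∀ a, σ₂.mem a = if a = 8 + 8 * j then T.par j else
          if a = 9 + 8 * j then T.dep j else σ.mem a) → u₂ ≤ u₁ + 50 →
        wp w O (block [put (c 10 + c 8 * r 10) (r 22),
          put (r 7 + r 21 % r 4) (ld (r 7 + r 21 % r 4) + c 1),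
          set 10 (r 10 + c 1)]) σ₂ u₂ fun σ' u'' => ((∀ i < 20, i ≠ 10 → σ'.reg i = τ.reg i) ∧
            σ'.reg 10 = j + 1 ∧ T.Basic σ'.mem (j + 1) ∧
            (∀ q < r₀ * r₀, σ'.mem (T.Z + q) = T.count (r₀ * r₀) (j + 1) q) ∧
            σ'.mem 0 = τ.mem 0) ∧ u'' ≤ u' + (40 * T.n + 120) := by
      intro σ₂ u₂ hr₂ h22₂ hm₂ hu₂
      have hlook : σ₂.mem (T.Z + q) = T.count (r₀ * r₀) j q := by
        rw [hm₂, if_neg (by omega), if_neg (by omega), hcnt q hqlt]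
      have e10 := (hr₂ 10 (by decide)).trans g10
      have e21 := (hr₂ 21 (by decide)).trans h21
      have e4 := (hr₂ 4 (by decide)).trans g4
      have e7 := (hr₂ 7 (by decide)).trans g7
      have hne : T.Z + q ≠ 10 + 8 * j := by omega
      have hmem : ∀ a, (if a = T.Z + q then T.count (r₀ * r₀) j q + 1 else
          if a = 10 + 8 * j then T.dst j else σ₂.mem a) =
          if a = T.Z + q then T.count (r₀ * r₀) j q + 1 else
          if a = 10 + 8 * j then T.dst j else if a = 8 + 8 * j then T.par j else
          if a = 9 + 8 * j then T.dep j else σ.mem a := fun a => by rw [hm₂]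
      refine wp_cons (wp_put rfl rfl (wp_cons (wp_put rfl rfl (wp_cons (wp_set rfl (wp_nil
        ⟨⟨fun i hi h => ?_, ?_, fun t ht => ?_, fun i hi => ?_, ?_⟩, ?_⟩))))))
      · simp [h, hr₂ i (by omega), g i hi h]
      · simp [e10, hc, m1]
      · simp only [State.setReg_mem, State.setMem_mem, State.setMem_reg, eval_add, eval_mul,
          eval_r, eval_c, eval_mod, eval_ld, e10, e21, e4, e7, ← hq, hc 8, hc 10, hc 1, m8, mk, m2,
          Nat.reduceLT, h22₂, hne, if_false, hlook, m3, hmem]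
        rcases Nat.lt_succ_iff_lt_or_eq.1 ht with ht | rfl
        · obtain ⟨k1, k2, k3⟩ := hb t ht
          simp [show 8 + 8 * t ≠ T.Z + q by omega, show 9 + 8 * t ≠ T.Z + q by omega,
            show 10 + 8 * t ≠ T.Z + q by omega, show 8 + 8 * t ≠ 10 + 8 * j by omega,
            show 8 + 8 * t ≠ 9 + 8 * j by omega, show 9 + 8 * t ≠ 10 + 8 * j by omega,
            show 9 + 8 * t ≠ 8 + 8 * j by omega, show 10 + 8 * t ≠ 8 + 8 * j by omega,
            show 10 + 8 * t ≠ 9 + 8 * j by omega, show t ≠ j by omega, k1, k2, k3]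
        · simp [show 8 + 8 * t ≠ T.Z + q by omega, show 9 + 8 * t ≠ T.Z + q by omega,
            show 10 + 8 * t ≠ T.Z + q by omega]
      · simp only [State.setReg_mem, State.setMem_mem, State.setMem_reg, eval_add, eval_mul,
          eval_r, eval_c, eval_mod, eval_ld, e10, e21, e4, e7, ← hq, hc 8, hc 10, hc 1, m8, mk, m2,
          Nat.reduceLT, h22₂, hne, if_false, hlook, m3, hmem, count_succ]
        by_cases hiq : i = q
        · subst hiq
          simp
        · rw [if_neg (by omega), if_neg (by omega), if_neg (by omega), if_neg (by omega),
            hcnt i hi, if_neg (by omega), Nat.add_zero]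
      · simp only [State.setReg_mem, State.setMem_mem, State.setMem_reg, eval_add, eval_mul,
          eval_r, eval_c, eval_mod, eval_ld, e10, e21, e4, e7, ← hq, hc 8, hc 10, hc 1, m8, mk, m2,
          Nat.reduceLT, h22₂, hne, if_false, hlook, m3, hmem]
        rw [if_neg (by omega), if_neg (by omega), if_neg (by omega), if_neg (by omega), hm0]
      · simp
        omega
    refine wp_cons (wp_put rfl rfl (wp_cons (wp_query rfl rfl (wp_cons (wp_put rfl rfl (wp_cons
      (wp_cond rfl (fun h => wp_skip (tail _ _ ?_ ?_ ?_ ?_))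
      fun h => wp_set rfl (tail _ _ ?_ ?_ ?_ ?_))))))))
    · intro i hi
      simp [show i ≠ 23 by omega]
    · simp [h20, g2, hc] at h
      simp [h22, dst, h]
    · intro a
      simp [g10, hc, m8, mk, h21, ask1, hm₁]
    · simp
    · intro i hi
      simp [show i ≠ 23 by omega, show i ≠ 22 by omega]
    · simp [h20, g2, hc] at h
      simp [g8, dst, h]
    · intro a
      simp [g10, hc, m8, mk, h21, ask1, hm₁]
    · simp
  · rintro σ u' ⟨hr, h10, hb, hcnt, hm0⟩ hu
    refine wp_nil (hQ σ _ hr hb hcnt hm0 ?_)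
    simp at hu
    have : T.n * (40 * T.n + 120 + 3 + 1) = 40 * T.n ^ 2 + 124 * T.n := by ring
    nlinarith

theorem leastResidue_spec {τ : State} {u : ℕ} {Q : State → ℕ → Prop} {r₀ ρ : ℕ}
    (hG : T.Globals r₀ ρ τ) (h7 : τ.reg 7 = T.Z) (hr1 : 1 ≤ r₀ * r₀)
    (hrn : r₀ * r₀ ≤ T.n) (hcnt : ∀ q < r₀ * r₀, τ.mem (T.Z + q) = T.count (r₀ * r₀) T.n q)
    (hQ : ∀ τ' u', (∀ i < 20, i ≠ 5 → τ'.reg i = τ.reg i) → τ'.mem = τ.mem →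
      τ'.reg 5 < r₀ * r₀ → r₀ * r₀ * T.count (r₀ * r₀) T.n (τ'.reg 5) ≤ T.n →
      u' ≤ u + (40 * T.n + 40) → Q τ' u') :
    wp w O leastResidue τ u Q := by
  have hZ := T.le_Z
  have hZw := T.Z_bound
  have hc : ∀ k < 64, k % 2 ^ w = k := fun k hk => Nat.mod_eq_of_lt (by omega)
  refine wp_cons (wp_set rfl (wp_cons (wp_set rfl (wp_cons ?_))))
  refine wp_while (fun j σ => (∀ i < 20, i ≠ 5 → σ.reg i = τ.reg i) ∧ σ.mem = τ.mem ∧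
      σ.reg 20 = j + 1 ∧ σ.reg 5 ≤ j ∧ ∀ i ≤ j, T.count (r₀ * r₀) T.n (σ.reg 5) ≤
        T.count (r₀ * r₀) T.n i) (r₀ * r₀ - 1) 25 rfl ?_ ?_ ?_ ?_ ?_
  · refine ⟨fun i hi h => ?_, rfl, ?_, ?_, ?_⟩
    · simp [h, show i ≠ 20 by omega]
    · simp [hc]
    · simp [hc]
    · simp [hc]
  · rintro j σ hj ⟨hr, -, h20, -⟩
    simp [h20, hr 4, hG.r4, hc, show j + 1 < r₀ * r₀ by omega]
  · rintro σ ⟨hr, -, h20, -⟩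
    simp [h20, hr 4, hG.r4, show ¬ r₀ * r₀ - 1 + 1 < r₀ * r₀ by omega]
  · rintro j σ u' hj ⟨hr, hm, h20, h5, hmin⟩
    have e7 : σ.reg 7 = T.Z := (hr 7 (by decide) (by decide)).trans h7
    have m1 : (T.Z + (j + 1)) % 2 ^ w = T.Z + (j + 1) := Nat.mod_eq_of_lt (by omega)
    have m2 : (T.Z + σ.reg 5) % 2 ^ w = T.Z + σ.reg 5 := Nat.mod_eq_of_lt (by omega)
    have m3 : (j + 1 + 1) % 2 ^ w = j + 1 + 1 := Nat.mod_eq_of_lt (by omega)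
    have c1 : σ.mem (T.Z + (j + 1)) = T.count (r₀ * r₀) T.n (j + 1) := by
      rw [hm, hcnt _ (by omega)]
    have c2 : σ.mem (T.Z + σ.reg 5) = T.count (r₀ * r₀) T.n (σ.reg 5) := by
      rw [hm, hcnt _ (by omega)]
    refine wp_cons (wp_cond rfl (fun h => wp_set rfl (wp_cons (wp_set rfl (wp_nil
      ⟨⟨fun i hi hi5 => ?_, hm, ?_, ?_, fun i hi => ?_⟩, ?_⟩)))) fun h => wp_skip (wp_cons
      (wp_set rfl (wp_nil ⟨⟨fun i hi hi5 => ?_, hm, ?_, ?_, fun i hi => ?_⟩, ?_⟩))))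
    · simp [hi5, show i ≠ 20 by omega, hr i hi hi5]
    · simp [h20, hc, m3]
    · simp [h20]
    · simp [h20, e7, m1, m2, c1, c2, hc] at h ⊢
      rcases Nat.lt_succ_iff_lt_or_eq.1 (Nat.lt_succ_of_le hi) with hi | rfl
      · exact h.le.trans (hmin i (by omega))
      · exact le_rfl
    · simp
    · simp [show i ≠ 20 by omega, hr i hi hi5]
    · simp [h20, hc, m3]
    · simp
      omega
    · simp [h20, e7, m1, m2, c1, c2, hc] at h ⊢
      rcases Nat.lt_succ_iff_lt_or_eq.1 (Nat.lt_succ_of_le hi) with hi | rfl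
      · exact hmin i (by omega)
      · exact h
    · simp
  · rintro σ u' ⟨hr, hm, h20, h5, hmin⟩ hu
    refine wp_nil (hQ σ _ hr hm (by omega) (T.mul_count_le hr1 fun i hi => hmin i (by omega)) ?_)
    simp at hu
    omega

/-- The result of the preprocessing. -/
structure Result (r₀ ρ lim : ℕ) (mem : ℕ → ℕ) : Prop where
  params : T.Params r₀ ρ
  small : r₀ = 1 ∨ r₀ ^ 6 * T.M ≤ T.n
  large : T.n < (r₀ + 1) ^ 6 * T.M
  count : r₀ * r₀ * T.count (r₀ * r₀) T.n ρ ≤ T.n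
  base_le : T.base ≤ lim
  le_total : lim ≤ T.total r₀ ρ T.n
  head : mem 0 = r₀
  basic : T.Basic mem T.n
  stored : ∀ t < T.n, T.Stored mem lim r₀ ρ t

theorem preprocess_spec : ∃ σ t r₀ ρ, Exec w O preprocess (.init [T.n, T.M, T.s] []) σ t ∧
    t ≤ 5000 * T.n ^ 2 ∧ T.Result r₀ ρ (σ.reg 0) σ.mem := by
  have hn := T.n_pos
  have hZ := T.le_Z
  have hbase : T.base = 8 + 8 * T.n := rfl
  suffices h : wp w O preprocess (.init [T.n, T.M, T.s] []) 0 fun σ t =>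
      t ≤ 5000 * T.n ^ 2 ∧ ∃ r₀ ρ, T.Result r₀ ρ (σ.reg 0) σ.mem by
    obtain ⟨σ, τ, t, he, hs, ht, r₀, ρ, hres⟩ := h _ (State.Sim.refl _)
    refine ⟨σ, t, r₀, ρ, he, by simpa using ht, ?_⟩
    rw [hs.1, hs.2 0 (by decide)]
    exact hres
  refine wp_cons (T.blockLength_spec rfl rfl ?_)
  intro τ₁ u₁ r₀ hr₁ hm₁ h3₁ hr1 hsmall hlarge hrn hu₁
  have hrr : r₀ * r₀ ≤ T.n := by
    rcases hsmall with rfl | h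
    · exact hn
    · calc r₀ * r₀ = r₀ ^ 2 := (sq r₀).symm
        _ ≤ r₀ ^ 6 := Nat.pow_le_pow_right hr1 (by norm_num)
        _ ≤ r₀ ^ 6 * T.M := Nat.le_mul_of_pos_right _ T.hM
        _ ≤ T.n := h
  have hrr1 : 1 ≤ r₀ * r₀ := Nat.mul_pos hr1 hr1
  refine wp_cons (T.constants_spec (hr₁ 0 (by decide) (by decide)) h3₁ hrr ?_)
  intro τ₂ u₂ hG₂ h2₂ h6₂ h7₂ hm₂ hu₂
  have hs₂ : τ₂.reg 2 = T.s := h2₂.trans (hr₁ 2 (by decide) (by decide))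
  refine wp_cons (T.distances_spec hG₂ hs₂ h7₂ hrr1 hrr (fun a ha => ?_) ?_)
  · rw [hm₂, if_neg (by omega), hm₁]
    simp [State.init]
  intro τ₃ u₃ hr₃ hb₃ hc₃ hm₃ hu₃
  have hG₃ : T.Globals r₀ (τ₂.reg 5) τ₃ := hG₂.congr fun i hi h => hr₃ i hi (by omega)
  refine wp_cons (T.leastResidue_spec hG₃ ((hr₃ 7 (by decide) (by decide)).trans h7₂) hrr1 hrr
    hc₃ ?_)
  intro τ₄ u₄ hr₄ hm₄ hρ hcount hu₄
  have hG₄ : T.Globals r₀ (τ₄.reg 5) τ₄ := by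
    obtain ⟨k0, k3, k4, k5, k8, k9, k17, k18, k19⟩ := hG₃
    constructor
    · rw [hr₄ _ (by decide) (by decide), k0]
    · rw [hr₄ _ (by decide) (by decide), k3]
    · rw [hr₄ _ (by decide) (by decide), k4]
    · rfl
    · rw [hr₄ _ (by decide) (by decide), k8]
    · rw [hr₄ _ (by decide) (by decide), k9]
    · rw [hr₄ _ (by decide) (by decide), k17]
    · rw [hr₄ _ (by decide) (by decide), k18]
    · rw [hr₄ _ (by decide) (by decide), k19]
  have hP : T.Params r₀ (τ₄.reg 5) := ⟨hr1, hrr, hρ⟩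
  have h6₄ : τ₄.reg 6 = T.base := (hr₄ 6 (by decide) (by decide)).trans
    ((hr₃ 6 (by decide) (by decide)).trans h6₂)
  refine wp_cons (T.processAll_spec hP hG₄ h6₄ (fun t ht => ?_) (fun t ht => ?_) ?_)
  · rw [hm₄, (hb₃ t ht).2.1]
  · rw [hm₄, (hb₃ t ht).2.2]
  intro τ₅ u₅ hG₅ hle hle' hst hm₅ hu₅
  refine wp_cons (wp_set rfl (wp_nil ⟨?_, r₀, τ₄.reg 5, hP, hsmall, hlarge, hcount, ?_, ?_, ?_,
    fun t ht => ?_, fun t ht => ?_⟩))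
  · simp
    nlinarith
  · simpa using hle
  · simpa using hle'
  · simp only [State.setReg_mem]
    rw [hm₅ 0 (by omega) (by omega), hm₄, hm₃, hm₂, if_pos rfl]
  · obtain ⟨k1, k2, k3⟩ := hb₃ t ht
    simp only [State.setReg_mem]
    rw [hm₅ _ (by omega) (by omega), hm₅ _ (by omega) (by omega), hm₅ _ (by omega) (by omega), hm₄]
    exact ⟨k1, k2, k3⟩
  · simpa using hst t ht

end Inp
end SSDSO

namespace SSDSO

open Ex Prog

variable {w : ℕ} {O : Oracle}

/-! ### The query -/

/-- The answer for the vertex `r 0` and the failure at depth `r 4` if this is near `r 0`. -/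
def lookupNear : Prog := block [
  set 10 (ld (c 11 + c 8 * r 0) + c 2 * (r 4 - ld (c 15 + c 8 * r 0))),
  cond (eq (ld (r 10)) (r 1)) (set 0 (ld (r 10 + c 1))) (set 0 (r 5))]

/-- The answer for the vertex `r 0` and the failure at depth `r 4` if this is far from `r 0`. -/
def lookupFar : Prog := block [
  set 9 (ld (c 13 + c 8 * r 0)),
  set 10 (ld (c 12 + c 8 * r 9) + c 2 * r 4),
  -- The row of the pivot also names its ancestor at this depth. Above the pivot the paths to the
  -- pivot and to `t` agree, so the comparison decides whether the failure is on the path to `t`.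
  cond (eq (ld (r 10)) (r 1)) (block [
    set 11 (ld (r 10 + c 1)),
    cond (eq (r 11) (r 7)) skip (set 11 (r 11 + (r 5 - ld (c 10 + c 8 * r 9)))),
    set 12 (ld (ld (c 14 + c 8 * r 0) + r 4 / (r 8 * r 8))),
    set 12 (ld (r 12 + r 4 / r 8 % r 8)),
    set 12 (ld (r 12 + r 4 % r 8)),
    cond (lt (r 11) (r 12)) (set 0 (r 11)) (set 0 (r 12))]) (set 0 (r 5))]

/-- The answer for the vertex `r 0` and the failure at the vertex `r 1` or at the edge to its
parent. -/
def lookup : Prog := block [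
  set 3 (ld (c 9 + c 8 * r 0)),
  set 4 (ld (c 9 + c 8 * r 1)),
  set 5 (ld (c 10 + c 8 * r 0)),
  set 7 (c 0 - c 1),
  set 8 (ld (c 0)),
  cond (lt (r 3) (r 4)) (set 0 (r 5))
    (cond (lt (r 4) (ld (c 15 + c 8 * r 0))) lookupFar lookupNear)]

/-- The query for the failure of the edge between `r 1` and `r 2`. -/
def edgeLookup : Prog :=
  cond (eq (ld (c 8 + c 8 * r 2)) (r 1)) (block [set 1 (r 2), lookup])
    (cond (eq (ld (c 8 + c 8 * r 1)) (r 2)) lookup (set 0 (ld (c 10 + c 8 * r 0))))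

/-! ### Correctness of the query -/

namespace Inp

variable (T : Inp w O)

/-- The answer for the vertex `t` and the failure at the vertex `v` or at the edge to its parent. -/
noncomputable def ans (L ρ t v : ℕ) : ℕ :=
  if T.dep t < T.dep v then T.dst t
  else if T.anc t (T.dep v) = v then
    if T.dep v < T.dep t + 1 - L then min (T.via L ρ t (T.dep v)) (T.far L ρ t (T.dep v))
    else T.val t v
  else T.dst t

/-- The data structure. -/
structure Represents (r₀ ρ lim : ℕ) (mem : ℕ → ℕ) : Prop where
  params : T.Params r₀ ρ
  lim_le : lim ≤ T.Z
  head : mem 0 = r₀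
  basic : T.Basic mem T.n
  stored : ∀ t < T.n, T.Stored mem lim r₀ ρ t

variable {T}

/-- Everything a query reads lies below `lim`, so the output alone determines the answers; the
scratch memory may be discarded. -/
theorem Result.represents {r₀ ρ lim : ℕ} {mem mem' : ℕ → ℕ} (h : T.Result r₀ ρ lim mem)
    (hm : ∀ a < lim, mem' a = mem a) : T.Represents r₀ ρ lim mem' := by
  have hb := h.base_le
  have hbase : T.base = 8 + 8 * T.n := rfl
  refine ⟨h.params, ?_, ?_, fun t ht => ?_, fun t ht => ?_⟩
  · have := T.total_le h.params
    have := h.le_total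
    omega
  · rw [hm _ (by omega), h.head]
  · rw [hm _ (by omega), hm _ (by omega), hm _ (by omega)]
    exact h.basic t ht
  · exact (h.stored t ht).congr ht h.params.pos le_rfl (fun a _ ha => hm a ha)
      fun a h1 h2 => hm a (by omega)

variable (T)

theorem lookup_spec {O' : Oracle} {τ : State} {u : ℕ} {Q : State → ℕ → Prop}
    {r₀ ρ lim t v : ℕ} (ht : t < T.n) (hv : v < T.n) (h : T.Represents r₀ ρ lim τ.mem)
    (h0 : τ.reg 0 = t) (h1 : τ.reg 1 = v)
    (hQ : ∀ τ' u', τ'.reg 0 = T.ans (r₀ * r₀) ρ t v → u' ≤ u + 200 → Q τ' u') :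
    wp w O' lookup τ u Q := by
  have hZ := T.le_Z
  have hZw := T.Z_bound
  have hlim := h.lim_le
  have hP := h.params
  obtain ⟨hr1, hrr, hN1, hN, hN', hN''⟩ := hP.bounds
  have hrn := hP.le
  have hr0 := hP.pos
  have hdt := T.dep_lt t ht
  have hdv := T.dep_lt v hv
  have hc : ∀ k < 64, k % 2 ^ w = k := fun k hk => Nat.mod_eq_of_lt (by omega)
  have m8 : ∀ t < T.n, 8 * t % 2 ^ w = 8 * t := fun t ht => Nat.mod_eq_of_lt (by omega)
  have mk : ∀ k < 64, ∀ t < T.n, (k + 8 * t) % 2 ^ w = k + 8 * t :=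
    fun k hk t ht => Nat.mod_eq_of_lt (by omega)
  have hinf : (2 ^ w - 1) % 2 ^ w = T.inf := Nat.mod_eq_of_lt (by omega)
  have hinf' : T.inf = 2 ^ w - 1 := rfl
  obtain ⟨-, bt2, bt3⟩ := h.basic t ht
  obtain ⟨-, bv2, -⟩ := h.basic v hv
  have hst := h.stored t ht
  refine wp_cons (wp_set rfl (wp_cons (wp_set rfl (wp_cons (wp_set rfl (wp_cons (wp_set rfl
    (wp_cons (wp_set rfl (wp_cons ?_))))))))))
  generalize hσ : ((((τ.setReg 3 _).setReg 4 _).setReg 5 _).setReg 7 _).setReg 8 _ = σ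
  have g0 : σ.reg 0 = t := by rw [← hσ]; simp [h0]
  have g1 : σ.reg 1 = v := by rw [← hσ]; simp [h1]
  have g3 : σ.reg 3 = T.dep t := by rw [← hσ]; simp [h0, hc, m8 t ht, mk _ _ t ht, bt2]
  have g4 : σ.reg 4 = T.dep v := by rw [← hσ]; simp [h1, hc, m8 v hv, mk _ _ v hv, bv2]
  have g5 : σ.reg 5 = T.dst t := by rw [← hσ]; simp [h0, hc, m8 t ht, mk _ _ t ht, bt3]
  have g7 : σ.reg 7 = T.inf := by rw [← hσ]; simp [hc, hinf]
  have g8 : σ.reg 8 = r₀ := by rw [← hσ]; simp [h.head]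
  have gm : σ.mem = τ.mem := by rw [← hσ]; simp
  rw [← gm] at bt3 hst h
  have glo := hst.lo
  refine wp_cond rfl (fun hlt => wp_set rfl (wp_nil (hQ _ _ ?_ ?_))) fun hge => wp_cond rfl
    (fun hfar => ?_) fun hnear => ?_
  · have hlt' : T.dep t < T.dep v := by
      by_contra hcon
      simp [g3, g4, hcon] at hlt
    simp [g5, ans, hlt']
  · simp
  · have hle : T.dep v ≤ T.dep t := by
      by_contra hcon
      simp [g3, g4, not_le.1 hcon, hc] at hge
    have hlo : T.dep v < T.dep t + 1 - r₀ * r₀ := by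
      by_contra hcon
      simp [g0, g4, hc, m8 t ht, mk _ _ t ht, glo, hcon] at hfar
    have hρ := hP.lt
    have hx : T.piv (r₀ * r₀) ρ t < T.n := T.piv_lt ht
    have hmodlt : (T.dep t - ρ) % (r₀ * r₀) < r₀ * r₀ := Nat.mod_lt _ (by omega)
    have hxd : T.dep (T.piv (r₀ * r₀) ρ t) = T.dep t - (T.dep t - ρ) % (r₀ * r₀) :=
      T.dep_anc ht (Nat.sub_le _ _)
    -- The chosen vertex really has the residue `ρ`, and therefore a full row was stored for it.
    have hxmod : T.dep (T.piv (r₀ * r₀) ρ t) % (r₀ * r₀) = ρ := by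
      rw [hxd]
      have := Nat.div_add_mod (T.dep t - ρ) (r₀ * r₀)
      rw [show T.dep t - (T.dep t - ρ) % (r₀ * r₀) = ρ + r₀ * r₀ * ((T.dep t - ρ) / (r₀ * r₀)) by
        omega, Nat.add_mul_mod_self_left, Nat.mod_eq_of_lt hρ]
    -- The pivot is fewer than `r₀ * r₀` levels above `t` and the failure at least that many. So the
    -- row covers the depth of `v`, with the same ancestor there as for `t`.
    have hvx : T.dep v ≤ T.dep (T.piv (r₀ * r₀) ρ t) := by omega
    have hancx : T.anc (T.piv (r₀ * r₀) ρ t) (T.dep v) = T.anc t (T.dep v) := by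
      rw [hxd] at hvx
      exact T.anc_anc ht (Nat.sub_le _ _) hvx
    have hpv := hst.piv (by omega)
    obtain ⟨row1, row2, row3⟩ := (h.stored _ hx).row hxmod
    obtain ⟨e1, e2⟩ := row3 _ hvx (Nat.zero_le _)
    rw [Nat.sub_zero, hancx] at e1 e2
    obtain ⟨-, -, bx3⟩ := h.basic _ hx
    set x := T.piv (r₀ * r₀) ρ t with hxdef
    -- `quo` is the rounded quotient plus one, so the padded array is longer than `n` and every
    -- depth is an index.
    have hidx : T.dep v < r₀ * r₀ * T.quo r₀ := by
      unfold quo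
      have := Nat.div_add_mod T.n (r₀ * r₀)
      have := Nat.mod_lt T.n (show 0 < r₀ * r₀ by omega)
      rw [Nat.mul_add]
      omega
    obtain ⟨a, b, f1, f2, f3, f4, f5, f6, f7⟩ := hst.far.2 _ hidx
    have hdq := T.div_lt_quo hidx
    have hfl := hst.far.1
    have k1 := Nat.mod_lt (T.dep v / r₀) hr0
    have k2 := Nat.mod_lt (T.dep v) hr0
    have m1 : 2 * T.dep v % 2 ^ w = 2 * T.dep v := Nat.mod_eq_of_lt (by omega)
    have m2 : (σ.mem (12 + 8 * x) + 2 * T.dep v) % 2 ^ w = σ.mem (12 + 8 * x) + 2 * T.dep v :=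
      Nat.mod_eq_of_lt (by omega)
    have m3 : (σ.mem (12 + 8 * x) + 2 * T.dep v + 1) % 2 ^ w =
        σ.mem (12 + 8 * x) + 2 * T.dep v + 1 := Nat.mod_eq_of_lt (by omega)
    have m4 : r₀ * r₀ % 2 ^ w = r₀ * r₀ := Nat.mod_eq_of_lt (by omega)
    have m5 : (σ.mem (14 + 8 * t) + T.dep v / (r₀ * r₀)) % 2 ^ w =
        σ.mem (14 + 8 * t) + T.dep v / (r₀ * r₀) := Nat.mod_eq_of_lt (by omega)
    have m6 : (a + T.dep v / r₀ % r₀) % 2 ^ w = a + T.dep v / r₀ % r₀ :=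
      Nat.mod_eq_of_lt (by omega)
    have m7 : (b + T.dep v % r₀) % 2 ^ w = b + T.dep v % r₀ := Nat.mod_eq_of_lt (by omega)
    have m9 : (T.dst t + 2 ^ w - T.dst x) % 2 ^ w = T.dst t - T.dst x := by
      refine Nat.add_sub_mod_of_le (T.dst_sub_le ht _).1 ?_
      have := T.len_bound
      have h1 := T.len_le t ht
      unfold dst
      split_ifs <;> omega
    refine wp_cons (wp_set rfl (wp_cons (wp_set rfl (wp_cons (wp_cond rfl (fun heq => ?_)
      fun hne => wp_set rfl (wp_nil (wp_nil (hQ _ _ ?_ ?_))))))))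
    · have hanc : T.anc t (T.dep v) = v := by
        by_contra hcon
        simp [g0, g1, g4, hc, m8 t ht, m8 x hx, mk _ _ t ht, mk _ _ x hx, hpv, m1, m2, e1,
          hcon] at heq
      have hans : T.ans (r₀ * r₀) ρ t v =
          min (T.via (r₀ * r₀) ρ t (T.dep v)) (T.far (r₀ * r₀) ρ t (T.dep v)) := by
        rw [ans, if_neg (by omega), if_pos hanc, if_pos hlo]
      have tail : ∀ σ' u', (∀ i < 10, i ≠ 9 → σ'.reg i = σ.reg i) → σ'.mem = σ.mem →
          σ'.reg 11 = T.via (r₀ * r₀) ρ t (T.dep v) → u' ≤ u + 100 →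
          wp w O' (block [
            set 12 (ld (ld (c 14 + c 8 * r 0) + r 4 / (r 8 * r 8))),
            set 12 (ld (r 12 + r 4 / r 8 % r 8)),
            set 12 (ld (r 12 + r 4 % r 8)),
            cond (lt (r 11) (r 12)) (set 0 (r 11)) (set 0 (r 12))]) σ' u'
            fun τ' t' => wp w O' (block []) τ' t' fun τ' t' => wp w O' (block []) τ' t' Q := by
        intro σ' u' hr hm h11 hu
        have k0 := (hr 0 (by decide) (by decide)).trans g0
        have k4 := (hr 4 (by decide) (by decide)).trans g4
        have k8 := (hr 8 (by decide) (by decide)).trans g8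
        refine wp_cons (wp_set rfl (wp_cons (wp_set rfl (wp_cons (wp_set rfl (wp_cons
          (wp_cond rfl (fun hlt => wp_set rfl (wp_nil (wp_nil (wp_nil (hQ _ _ ?_ ?_)))))
          fun hlt => wp_set rfl (wp_nil (wp_nil (wp_nil (hQ _ _ ?_ ?_)))))))))))
        · simp [k0, k4, k8, hm, hc, m8 t ht, mk _ _ t ht, m4, m5, m6, m7, f1, f2, f3, h11]
            at hlt ⊢
          rw [hans, min_eq_left hlt.le]
        · simp
          omega
        · simp [k0, k4, k8, hm, hc, m8 t ht, mk _ _ t ht, m4, m5, m6, m7, f1, f2, f3, h11]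
            at hlt ⊢
          rw [hans, min_eq_right hlt]
        · simp
          omega
      have hval := T.val_le _ hx _ (T.anc_lt ht (T.dep v))
      have hdst : T.dst t - T.dst x ≤ T.n * T.M := (T.dst_sub_le ht _).2
      have hlb := T.len_bound
      refine wp_cons (wp_set rfl (wp_cons (wp_cond rfl (fun h => wp_skip (tail _ _ ?_ ?_ ?_ ?_))
        fun h => wp_set rfl (tail _ _ ?_ ?_ ?_ ?_))))
      · intro i hi hi9
        simp [show i ≠ 10 by omega, show i ≠ 11 by omega, hi9]
      · simp
      · simp [g0, g4, g7, hc, m8 t ht, m8 x hx, mk _ _ t ht, mk _ _ x hx, hpv, m1, m2, m3, e2]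
          at h ⊢
        rw [via, if_pos h, h]
      · simp
      · intro i hi hi9
        simp [show i ≠ 10 by omega, show i ≠ 11 by omega, hi9]
      · simp
      · simp [g0, g4, g5, g7, hc, m8 t ht, m8 x hx, mk _ _ t ht, mk _ _ x hx, hpv, m1, m2, m3, e2,
          bx3, m9] at h ⊢
        rw [via, if_neg h, Nat.mod_eq_of_lt (by omega)]
      · simp
    · have hanc : T.anc t (T.dep v) ≠ v := by
        intro hcon
        simp [g0, g1, g4, hc, m8 t ht, m8 x hx, mk _ _ t ht, mk _ _ x hx, hpv, m1, m2, e1,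
          hcon] at hne
      rw [ans, if_neg (by omega), if_neg hanc]
      simp [g5]
    · simp
  · have hle : T.dep v ≤ T.dep t := by
      by_contra hcon
      simp [g3, g4, not_le.1 hcon, hc] at hge
    have hlo : T.dep t + 1 - r₀ * r₀ ≤ T.dep v := by
      by_contra hcon
      simp [g0, g4, hc, m8 t ht, mk _ _ t ht, glo, not_le.1 hcon] at hnear
    obtain ⟨e1, e2⟩ := hst.near _ hle hlo
    have hnl := hst.near_lim
    have m1 : (T.dep v + 2 ^ w - (T.dep t + 1 - r₀ * r₀)) % 2 ^ w =
        T.dep v - (T.dep t + 1 - r₀ * r₀) := Nat.add_sub_mod_of_le hlo (by omega)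
    have m2 : 2 * (T.dep v - (T.dep t + 1 - r₀ * r₀)) % 2 ^ w =
        2 * (T.dep v - (T.dep t + 1 - r₀ * r₀)) := Nat.mod_eq_of_lt (by omega)
    have m3 : (σ.mem (11 + 8 * t) + 2 * (T.dep v - (T.dep t + 1 - r₀ * r₀))) % 2 ^ w =
        σ.mem (11 + 8 * t) + 2 * (T.dep v - (T.dep t + 1 - r₀ * r₀)) :=
      Nat.mod_eq_of_lt (by omega)
    have m4 : (σ.mem (11 + 8 * t) + 2 * (T.dep v - (T.dep t + 1 - r₀ * r₀)) + 1) % 2 ^ w =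
        σ.mem (11 + 8 * t) + 2 * (T.dep v - (T.dep t + 1 - r₀ * r₀)) + 1 :=
      Nat.mod_eq_of_lt (by omega)
    refine wp_cons (wp_set rfl (wp_cons (wp_cond rfl (fun heq => wp_set rfl (wp_nil (wp_nil
      (hQ _ _ ?_ ?_)))) fun hne => wp_set rfl (wp_nil (wp_nil (hQ _ _ ?_ ?_))))))
    · have hanc : T.anc t (T.dep v) = v := by
        by_contra hcon
        simp [g0, g1, g4, hc, m8 t ht, mk _ _ t ht, glo, m1, m2, m3, e1, hcon] at heq
      rw [ans, if_neg (by omega), if_pos hanc, if_neg (by omega)]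
      rw [hanc] at e2
      simp [g0, g4, hc, m8 t ht, mk _ _ t ht, glo, m1, m2, m3, m4, e2]
    · simp
    · have hanc : T.anc t (T.dep v) ≠ v := by
        intro hcon
        simp [g0, g1, g4, hc, m8 t ht, mk _ _ t ht, glo, m1, m2, m3, e1, hcon] at hne
      rw [ans, if_neg (by omega), if_neg hanc]
      simp [g5]
    · simp

/-- The endpoints come in either order, so each is tried as the child of the other. If both attempts
fail, no tree edge is lost and the plain distance is returned. -/
theorem edgeLookup_spec {O' : Oracle} {τ : State} {x : ℕ} {Q : State → ℕ → Prop}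
    {r₀ ρ lim t u v : ℕ} (ht : t < T.n) (hu : u < T.n) (hv : v < T.n)
    (h : T.Represents r₀ ρ lim τ.mem) (h0 : τ.reg 0 = t) (h1 : τ.reg 1 = u) (h2 : τ.reg 2 = v)
    (hQ : ∀ τ' x', τ'.reg 0 = (if T.par v = u then T.ans (r₀ * r₀) ρ t v
      else if T.par u = v then T.ans (r₀ * r₀) ρ t u else T.dst t) → x' ≤ x + 300 → Q τ' x') :
    wp w O' edgeLookup τ x Q := by
  have hZ := T.le_Z
  have hZw := T.Z_bound
  have hc : ∀ k < 64, k % 2 ^ w = k := fun k hk => Nat.mod_eq_of_lt (by omega)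
  have m8 : ∀ t < T.n, 8 * t % 2 ^ w = 8 * t := fun t ht => Nat.mod_eq_of_lt (by omega)
  have mk : ∀ k < 64, ∀ t < T.n, (k + 8 * t) % 2 ^ w = k + 8 * t :=
    fun k hk t ht => Nat.mod_eq_of_lt (by omega)
  have bu := (h.basic u hu).1
  have bv := (h.basic v hv).1
  have bt := (h.basic t ht).2.2
  refine wp_cond rfl (fun hvu => wp_cons (wp_set rfl (wp_cons
    (T.lookup_spec ht hv (by simpa using h) (by simp [h0]) (by simp [h2]) fun τ' x' hr hx =>
      wp_nil (hQ _ _ ?_ ?_))))) fun hvu => wp_cond rfl (fun huv =>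
    T.lookup_spec ht hu h h0 h1 fun τ' x' hr hx => hQ _ _ ?_ ?_) fun huv =>
      wp_set rfl (hQ _ _ ?_ ?_)
  all_goals simp only [eval_eq, eval_ld, eval_add, eval_mul, eval_c, eval_r, h1, h2,
    hc _ (by decide : 8 < 64), m8 v hv, mk 8 (by decide) v hv, bv] at hvu
  · rw [if_pos (by by_contra hcon; simp [hcon] at hvu), hr]
  · simp at hx
    omega
  all_goals simp only [eval_eq, eval_ld, eval_add, eval_mul, eval_c, eval_r, h1, h2,
    hc _ (by decide : 8 < 64), m8 u hu, mk 8 (by decide) u hu, bu] at huv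
  · rw [if_neg (by intro hcon; simp [hcon, hc] at hvu),
      if_pos (by by_contra hcon; simp [hcon] at huv), hr]
  · simp at hx
    omega
  · rw [if_neg (by intro hcon; simp [hcon, hc] at hvu),
      if_neg (by intro hcon; simp [hcon, hc] at huv)]
    simp [h0, hc, m8 t ht, mk _ _ t ht, bt]
  · simp

end Inp
end SSDSO

namespace SSDSO

/-! ### Shortest path trees -/

namespace IsShortestPathTree

variable {n : ℕ} {G : SimpleGraph (Fin n)} {wt : Sym2 (Fin n) → ℕ} {s : Fin n}
  {par : Fin n → Option (Fin n)}

theorem reachable_of_par (h : IsShortestPathTree G wt s par) {t u : Fin n} (hu : par t = some u) :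
    G.Reachable s t := by
  by_cases hts : t = s
  · exact hts ▸ .rfl
  · exact (h.isSome_iff t hts).1 (by simp [hu])

theorem par_eq_none (h : IsShortestPathTree G wt s par) {t : Fin n} (ht : ¬ G.Reachable s t) :
    par t = none := by
  by_contra hc
  obtain ⟨u, hu⟩ := Option.ne_none_iff_exists'.1 hc
  exact ht (h.reachable_of_par hu)

theorem eq_root (h : IsShortestPathTree G wt s par) {t : Fin n} (ht : G.Reachable s t)
    (hp : par t = none) : t = s := by
  by_contra hts
  have := (h.isSome_iff t hts).2 ht
  simp [hp] at this

theorem reachable_parent (h : IsShortestPathTree G wt s par) {t u : Fin n} (hu : par t = some u) :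
    G.Reachable s u := (h.reachable_of_par hu).trans (h.adj t u hu).symm.reachable

end IsShortestPathTree

theorem sdist_ne_top {V : Type} {G : SimpleGraph V} {wt : Sym2 V → ℕ} {s t : V}
    (h : G.Reachable s t) : sdist G wt s t ≠ ⊤ := by
  obtain ⟨p⟩ := h
  exact ne_top_of_le_ne_top (ENat.natCast_ne_top _) (sdist_le_walkWeight p)

theorem sdist_self {V : Type} {G : SimpleGraph V} {wt : Sym2 V → ℕ} {s : V} :
    sdist G wt s s = 0 := by
  have := sdist_le_walkWeight (wt := wt) (SimpleGraph.Walk.nil : G.Walk s s)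
  simpa using this

theorem toNat_sdist_le {V : Type} [Fintype V] {G : SimpleGraph V} {wt : Sym2 V → ℕ} {M : ℕ}
    (hM : ∀ e ∈ G.edgeSet, wt e ≤ M) (s t : V) :
    (sdist G wt s t).toNat ≤ Fintype.card V * M := by
  by_cases h : G.Reachable s t
  · obtain ⟨p⟩ := h
    have hp : Avoids (∅ : Set (Sym2 V)) ∅ p := ⟨by simp, by simp⟩
    have h1 : avoidDist G wt ∅ ∅ s t ≠ ⊤ :=
      ne_top_of_le_ne_top (ENat.natCast_ne_top _) (avoidDist_le hp)
    exact ENat.toNat_le_of_le_natCast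
      ((sdist_le_avoidDist ∅ ∅ s t).trans (avoidDist_le_card_mul hM h1))
  · simp [sdist_eq_top h]

namespace IsShortestPathTree

variable {n : ℕ} {G : SimpleGraph (Fin n)} {wt : Sym2 (Fin n) → ℕ} {s : Fin n}
  {par : Fin n → Option (Fin n)}

theorem toNat_sdist_succ (h : IsShortestPathTree G wt s par) {t u : Fin n} (hu : par t = some u) :
    (sdist G wt s t).toNat = (sdist G wt s u).toNat + wt s(u, t) := by
  rw [h.dist_eq t u hu, ENat.toNat_add (sdist_ne_top (h.reachable_parent hu)) (ENat.natCast_ne_top _),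
    ENat.toNat_natCast]

/-- The number of proper ancestors. -/
theorem exists_depth (h : IsShortestPathTree G wt s par) (hwt : ∀ e ∈ G.edgeSet, 1 ≤ wt e) :
    ∃ dep : Fin n → ℕ, (∀ t, dep t < n) ∧ (∀ t, par t = none → dep t = 0) ∧
      ∀ t u, par t = some u → dep t = dep u + 1 := by
  classical
  let R : Fin n → Fin n → Prop := fun u t => par t = some u
  -- Positive weights make the distance grow along tree edges, so no vertex is its own proper
  -- ancestor. The number of proper ancestors is then less than `n` and goes up by one with each
  -- edge.
  have hlt : ∀ u t, Relation.TransGen R u t →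
      (sdist G wt s u).toNat < (sdist G wt s t).toNat := by
    have h1 : ∀ u t, R u t → (sdist G wt s u).toNat < (sdist G wt s t).toNat := fun u t hu => by
      have := hwt _ ((SimpleGraph.mem_edgeSet _).2 (h.adj t u hu))
      rw [h.toNat_sdist_succ hu]
      omega
    intro u t hut
    induction hut with
    | single hu => exact h1 _ _ hu
    | tail _ hu ih => exact ih.trans (h1 _ _ hu)
  have hirr : ∀ t, ¬ Relation.TransGen R t t := fun t ht => (hlt t t ht).false
  refine ⟨fun t => (Finset.univ.filter fun x => Relation.TransGen R x t).card, fun t => ?_,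
    fun t ht => ?_, fun t u hu => ?_⟩
  · have : (Finset.univ.filter fun x => Relation.TransGen R x t).card <
        (Finset.univ : Finset (Fin n)).card :=
      Finset.card_lt_card (Finset.filter_ssubset.2 ⟨t, Finset.mem_univ t, hirr t⟩)
    simpa using this
  · rw [Finset.card_eq_zero, Finset.filter_eq_empty_iff]
    intro x _ hx
    obtain ⟨y, -, hy⟩ := Relation.TransGen.tail'_iff.1 hx
    simp [R, ht] at hy
  · have : (Finset.univ.filter fun x => Relation.TransGen R x t) =
        insert u (Finset.univ.filter fun x => Relation.TransGen R x u) := by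
      ext x
      simp only [Finset.mem_filter, Finset.mem_univ, true_and, Finset.mem_insert]
      rw [Relation.TransGen.tail'_iff]
      constructor
      · rintro ⟨y, hxy, hy⟩
        obtain rfl : u = y := by simpa [R, hu] using hy
        exact (Relation.reflTransGen_iff_eq_or_transGen.1 hxy).imp Eq.symm id
      · intro hx
        exact ⟨u, Relation.reflTransGen_iff_eq_or_transGen.2 (hx.imp Eq.symm id), hu⟩
    change Finset.card _ = Finset.card _ + 1
    rw [this, Finset.card_insert_of_notMem (by simpa using hirr u)]

end IsShortestPathTree

/-! ### Distances as words -/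

theorem encDist_top (w : ℕ) : encDist w ⊤ = 2 ^ w - 1 := by simp [encDist]

theorem encDist_coe (w a : ℕ) : encDist w a = a := by simp [encDist]

/-- Only the smaller side has to be known to lie below the word for `∞`; if the larger side is
finite, no bound is needed at all. -/
theorem encDist_le_encDist {w : ℕ} {a b : ℕ∞} (ha : a ≠ ⊤ → a < (2 ^ w - 1 : ℕ))
    (h : a ≤ b) : encDist w a ≤ encDist w b := by
  induction b with
  | top =>
    rw [encDist_top]
    induction a with
    | top => rw [encDist_top]
    | coe a =>
      rw [encDist_coe]
      exact (Nat.cast_lt.1 (ha (ENat.natCast_ne_top a))).le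
  | coe b =>
    induction a with
    | top => simp at h
    | coe a => rw [encDist_coe, encDist_coe]; exact_mod_cast h

theorem encDist_lt_encDist {w : ℕ} {a b : ℕ∞} (ha : a ≠ ⊤ → a < (2 ^ w - 1 : ℕ))
    (h : a < b) : encDist w a < encDist w b := by
  induction b with
  | top =>
    rw [encDist_top]
    induction a with
    | top => simp at h
    | coe a =>
      rw [encDist_coe]
      exact Nat.cast_lt.1 (ha (ENat.natCast_ne_top a))
  | coe b =>
    induction a with
    | top => simp at h
    | coe a => rw [encDist_coe, encDist_coe]; exact_mod_cast h

theorem encDist_lt_iff {w : ℕ} {a b : ℕ∞} (ha : a ≠ ⊤ → a < (2 ^ w - 1 : ℕ))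
    (hb : b ≠ ⊤ → b < (2 ^ w - 1 : ℕ)) : encDist w a < encDist w b ↔ a < b :=
  ⟨fun h => by
    by_contra hc
    exact absurd (encDist_le_encDist hb (not_lt.1 hc)) (by omega), encDist_lt_encDist ha⟩

/-! ### The numerical input as a model of a graph -/

namespace Inp

variable {w : ℕ} {O : Oracle} (T : Inp w O)

/-- The source. -/
def src : Fin T.n := ⟨T.s, T.hs⟩

/-- The ancestor at depth `i`. -/
def vtx (t : Fin T.n) (i : ℕ) : Fin T.n := ⟨T.anc t i, T.anc_lt t.2 i⟩

/-- The input is a shortest path tree of `G`; with the vertex `c` there fail the edges in `fe c`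
and the vertices in `fv c`. -/
structure Models (G : SimpleGraph (Fin T.n)) (wt : Sym2 (Fin T.n) → ℕ)
    (par : Fin T.n → Option (Fin T.n)) (fe : Fin T.n → Set (Sym2 (Fin T.n)))
    (fv : Fin T.n → Set (Fin T.n)) : Prop where
  one_le : ∀ e ∈ G.edgeSet, 1 ≤ wt e
  le_M : ∀ e ∈ G.edgeSet, wt e ≤ T.M
  tree : IsShortestPathTree G wt T.src par
  par_eq : ∀ c : Fin T.n, T.par c = (par c).elim T.n Fin.val
  len_eq : ∀ c : Fin T.n, T.len c = (sdist G wt T.src c).toNat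
  edge : ∀ c u, par c = some u → fe c ⊆ {s(u, c)}
  vertex : ∀ c, fv c ⊆ {c}
  val_eq : ∀ t c u : Fin T.n, par c = some u → T.val t c = encDist w (avoidDist G wt (fe c) (fv c) T.src t)

namespace Models

variable {T} {G : SimpleGraph (Fin T.n)} {wt : Sym2 (Fin T.n) → ℕ}
  {par : Fin T.n → Option (Fin T.n)} {fe : Fin T.n → Set (Sym2 (Fin T.n))}
  {fv : Fin T.n → Set (Fin T.n)}

theorem par_eq_iff (h : T.Models G wt par fe fv) {c u : Fin T.n} :
    T.par c = u ↔ par c = some u := by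
  rw [h.par_eq]
  rcases par c with _ | x
  · simpa using u.2.ne'
  · simp [Fin.ext_iff]

theorem dep_of_par_none (h : T.Models G wt par fe fv) {t : Fin T.n} (ht : par t = none) :
    T.dep t = 0 := T.dep_zero t t.2 (by simp [h.par_eq, ht])

theorem dep_of_par (h : T.Models G wt par fe fv) {t u : Fin T.n} (ht : par t = some u) :
    T.dep t = T.dep u + 1 := by
  have := h.par_eq_iff.2 ht
  rw [T.dep_succ t t.2 (by rw [this]; exact u.2), this]

theorem vtx_dep (t : Fin T.n) : T.vtx t (T.dep t) = t := Fin.ext (T.anc_dep t)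

theorem par_vtx (h : T.Models G wt par fe fv) {t : Fin T.n} {i : ℕ} (hi : i < T.dep t) :
    par (T.vtx t (i + 1)) = some (T.vtx t i) := h.par_eq_iff.1 (T.par_anc hi)

theorem reachable_vtx (h : T.Models G wt par fe fv) {t : Fin T.n} (ht : G.Reachable T.src t)
    (i : ℕ) : G.Reachable T.src (T.vtx t i) := by
  by_cases hi : T.dep t ≤ i
  · have : T.vtx t i = t := Fin.ext (by simp [vtx, anc, Nat.sub_eq_zero_of_le hi, up_zero])
    rwa [this]
  · exact h.tree.reachable_parent (h.par_vtx (not_le.1 hi))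

theorem vtx_zero (h : T.Models G wt par fe fv) {t : Fin T.n} (ht : G.Reachable T.src t) :
    T.vtx t 0 = T.src := by
  refine h.tree.eq_root (h.reachable_vtx ht 0) ?_
  by_contra hc
  obtain ⟨u, hu⟩ := Option.ne_none_iff_exists'.1 hc
  have h1 := h.dep_of_par hu
  have h2 : T.dep (T.vtx t 0) = 0 := T.dep_anc t.2 (Nat.zero_le _)
  omega

theorem geodesic (h : T.Models G wt par fe fv) {t : Fin T.n} (ht : G.Reachable T.src t) :
    Geodesic G wt T.src (T.vtx t) (fun i => T.len (T.anc t i)) (T.dep t) where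
  zero := h.vtx_zero ht
  adj i hi := h.tree.adj _ _ (h.par_vtx hi)
  succ i hi := by
    have := h.tree.toNat_sdist_succ (h.par_vtx hi)
    rw [← h.len_eq, ← h.len_eq] at this
    exact this
  dist i hi := by
    have := h.len_eq (T.vtx t i)
    change T.len (T.anc t i) = _ at this
    rw [this, ENat.natCast_toNat (sdist_ne_top (h.reachable_vtx ht i))]
  pos i hi := h.one_le _ ((SimpleGraph.mem_edgeSet _).2 (h.tree.adj _ _ (h.par_vtx hi)))

theorem failsAt (h : T.Models G wt par fe fv) {t : Fin T.n} {i : ℕ} (hi : 1 ≤ i)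
    (hit : i ≤ T.dep t) : FailsAt (T.vtx t) i (fe (T.vtx t i)) (fv (T.vtx t i)) where
  pos := hi
  edge := by
    obtain ⟨i, rfl⟩ : ∃ j, i = j + 1 := ⟨i - 1, by omega⟩
    exact h.edge _ _ (h.par_vtx hit)
  vertex := h.vertex _

/-- A vertex that cannot be reached has no parent, so it is its own root and differs from the
source; this is what the test in `dst` detects. -/
theorem dst_eq (h : T.Models G wt par fe fv) (t : Fin T.n) :
    T.dst t = encDist w (sdist G wt T.src t) := by
  unfold dst
  by_cases ht : G.Reachable T.src t
  · have h0 : T.anc t 0 = T.s := congrArg Fin.val (h.vtx_zero ht)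
    rw [if_pos h0, h.len_eq]
    conv_rhs => rw [← ENat.natCast_toNat (sdist_ne_top ht), encDist_coe]
  · have hd := h.dep_of_par_none (h.tree.par_eq_none ht)
    have h0 := vtx_dep t
    rw [hd] at h0
    rw [if_neg, sdist_eq_top ht, encDist_top]
    · rfl
    · intro hs
      have h1 : T.vtx t 0 = T.src := Fin.ext hs
      rw [← h0, h1] at ht
      exact ht .rfl

theorem dst_of_reachable (h : T.Models G wt par fe fv) {t : Fin T.n} (ht : G.Reachable T.src t) :
    T.dst t = T.len t := if_pos (congrArg Fin.val (h.vtx_zero ht))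

/-- The path of the tree. -/
theorem exists_tree_walk (h : T.Models G wt par fe fv) {t : Fin T.n} (ht : G.Reachable T.src t) :
    ∃ p : G.Walk T.src t, (walkWeight wt p : ℕ∞) = sdist G wt T.src t ∧
      (∀ x ∈ p.support, ∃ i ≤ T.dep t, x = T.vtx t i) ∧
      ∀ e ∈ p.edges, ∃ u v, par v = some u ∧ e = s(u, v) := by
  have hg := h.geodesic ht
  obtain ⟨p, h1, h2, h3⟩ := hg.exists_walk (Nat.zero_le _) le_rfl
  have h4 := hg.dist_zero
  have h5 := hg.dist _ le_rfl
  refine ⟨p.copy hg.zero (vtx_dep t), ?_, fun x hx => ?_, fun e he => ?_⟩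
  · rw [vtx_dep] at h5
    rw [h5, ← h1, h4]
    simp [walkWeight]
  · obtain ⟨l, -, hl, hx⟩ := h2 x (by simpa using hx)
    exact ⟨l, hl, hx⟩
  · obtain ⟨l, -, hl, he⟩ := h3 e (by simpa using he)
    exact ⟨_, _, h.par_vtx hl, he⟩

/-- It is enough that the tree path survives. The hypothesis asks this of every walk sharing the two
properties that `exists_tree_walk` provides; for an unreachable `t` both sides are `⊤`. -/
theorem avoidDist_eq_sdist (h : T.Models G wt par fe fv) {Fe : Set (Sym2 (Fin T.n))}
    {Fv : Set (Fin T.n)} {t : Fin T.n}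
    (hF : ∀ p : G.Walk T.src t, (∀ x ∈ p.support, ∃ i ≤ T.dep t, x = T.vtx t i) →
      (∀ e ∈ p.edges, ∃ u v, par v = some u ∧ e = s(u, v)) → Avoids Fe Fv p) :
    avoidDist G wt Fe Fv T.src t = sdist G wt T.src t := by
  by_cases ht : G.Reachable T.src t
  · obtain ⟨p, h1, h2, h3⟩ := h.exists_tree_walk ht
    exact le_antisymm (h1 ▸ avoidDist_le (hF p h2 h3)) (sdist_le_avoidDist _ _ _ _)
  · rw [avoidDist_eq_top_of_not_reachable ht, sdist_eq_top ht]

/-- A finite replacement distance is at most `n * M`, being attained by a path. Even after adding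
another `n * M` it stays below the word for `∞`. -/
theorem fits (h : T.Models G wt par fe fv) {Fe : Set (Sym2 (Fin T.n))}
    {Fv : Set (Fin T.n)} {t : Fin T.n} {d : ℕ} (hd : d ≤ T.n * T.M)
    (hne : avoidDist G wt Fe Fv T.src t + d ≠ ⊤) :
    avoidDist G wt Fe Fv T.src t + d < (2 ^ w - 1 : ℕ) := by
  have h1 : avoidDist G wt Fe Fv T.src t ≠ ⊤ := fun hc => hne (by simp [hc])
  have h2 := avoidDist_le_card_mul h.le_M h1
  rw [Fintype.card_fin] at h2
  have h3 := T.len_bound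
  refine (add_le_add_left h2 _).trans_lt ?_
  exact_mod_cast (by omega : T.n * T.M + d < 2 ^ w - 1)

theorem fits_zero (h : T.Models G wt par fe fv) {Fe : Set (Sym2 (Fin T.n))}
    {Fv : Set (Fin T.n)} {t : Fin T.n} (hne : avoidDist G wt Fe Fv T.src t ≠ ⊤) :
    avoidDist G wt Fe Fv T.src t < (2 ^ w - 1 : ℕ) := by
  have := h.fits (Fe := Fe) (Fv := Fv) (t := t) (d := 0) (Nat.zero_le _) (by simpa using hne)
  simpa using this

theorem val_vtx (h : T.Models G wt par fe fv) (t t' : Fin T.n) {i : ℕ} (hi : 1 ≤ i)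
    (hit : i ≤ T.dep t) : T.val t' (T.anc t i) =
      encDist w (avoidDist G wt (fe (T.vtx t i)) (fv (T.vtx t i)) T.src t') := by
  obtain ⟨i, rfl⟩ : ∃ j, i = j + 1 := ⟨i - 1, by omega⟩
  exact h.val_eq t' (T.vtx t (i + 1)) _ (h.par_vtx hit)

/-- The case distinction in `via` imitates the absorption of `⊤` by addition in `ℕ∞`. -/
theorem via_eq (h : T.Models G wt par fe fv) {t : Fin T.n} (ht : G.Reachable T.src t)
    (L ρ : ℕ) {i : ℕ} (hi : 1 ≤ i) (hit : i ≤ T.dep t) :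
    T.via L ρ t i = encDist w (avoidDist G wt (fe (T.vtx t i)) (fv (T.vtx t i)) T.src
      (T.vtx t (T.dep t - (T.dep t - ρ) % L)) +
        (T.len (T.anc t (T.dep t)) - T.len (T.anc t (T.dep t - (T.dep t - ρ) % L)) : ℕ)) := by
  set a := T.dep t - (T.dep t - ρ) % L with ha
  have h1 := h.dst_of_reachable ht
  have h2 : T.dst (T.piv L ρ t) = T.len (T.anc t a) := h.dst_of_reachable (h.reachable_vtx ht a)
  have h3 := h.val_vtx t (T.vtx t a) hi hit
  have h4 : T.val (T.piv L ρ t) (T.anc t i) = T.val (T.vtx t a) (T.anc t i) := rfl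
  have h5 := h.fits_zero (Fe := fe (T.vtx t i)) (Fv := fv (T.vtx t i)) (t := T.vtx t a)
  unfold via
  rw [h1, h2, h4, h3, T.anc_dep]
  generalize avoidDist G wt (fe (T.vtx t i)) (fv (T.vtx t i)) T.src (T.vtx t a) = A at h5 ⊢
  induction A with
  | top => rw [encDist_top, top_add, encDist_top]; exact if_pos rfl
  | coe A =>
    have := Nat.cast_lt.1 (h5 (ENat.natCast_ne_top A))
    rw [encDist_coe, if_neg (by unfold inf; omega), ← Nat.cast_add, encDist_coe]

/-- Turns the comparison of words made by the program into the hypothesis `hlt` of the lemmas on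
`Geodesic`, with the depth of the pivot as `a`. -/
theorem val_lt_via_iff (h : T.Models G wt par fe fv) {t : Fin T.n} (ht : G.Reachable T.src t)
    (L ρ : ℕ) {i : ℕ} (hi : 1 ≤ i) (hit : i ≤ T.dep t) :
    T.val t (T.anc t i) < T.via L ρ t i ↔
      avoidDist G wt (fe (T.vtx t i)) (fv (T.vtx t i)) T.src (T.vtx t (T.dep t)) <
      avoidDist G wt (fe (T.vtx t i)) (fv (T.vtx t i)) T.src
        (T.vtx t (T.dep t - (T.dep t - ρ) % L)) +
        (T.len (T.anc t (T.dep t)) - T.len (T.anc t (T.dep t - (T.dep t - ρ) % L)) : ℕ) := by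
  rw [h.via_eq ht L ρ hi hit, h.val_vtx t t hi hit, vtx_dep, encDist_lt_iff h.fits_zero]
  refine h.fits ?_
  have := T.len_le t t.2
  rw [T.anc_dep]
  omega

/-- A finite entry of the running minimum stems from a failure at some `j ≤ i` whose optimal
replacement paths beat the route via the pivot. By `avoidDist_mono` such a path also avoids the
failure at `i`, which is still above the pivot. -/
theorem val_le_far (h : T.Models G wt par fe fv) {t : Fin T.n} (ht : G.Reachable T.src t)
    {L ρ : ℕ} (hL : 1 ≤ L) {i : ℕ} (hi : 1 ≤ i) (hit : i ≤ T.dep t - L) :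
    T.val t (T.anc t i) ≤ T.far L ρ t i := by
  rcases T.far_cases (L := L) (ρ := ρ) (t := t) i with hf | ⟨j, hj1, hji, hjL, hlt, hf⟩
  · rw [hf, h.val_vtx t t hi (by omega)]
    refine (encDist_le_encDist h.fits_zero le_top).trans (encDist_top w).le
  · rw [hf, h.val_vtx t t hi (by omega), h.val_vtx t t hj1 (by omega)]
    rw [h.val_lt_via_iff ht L ρ hj1 (by omega)] at hlt
    refine encDist_le_encDist h.fits_zero ?_
    have := Nat.mod_lt (T.dep t - ρ) hL
    have := (h.geodesic ht).avoidDist_mono (h.failsAt hj1 (by omega)) (Nat.sub_le _ _) hlt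
      (h.failsAt hi (by omega)) hji (by omega)
    rwa [vtx_dep] at this

/-- The answer for a failure far from `t`. -/
theorem min_via_far (h : T.Models G wt par fe fv) {t : Fin T.n} (ht : G.Reachable T.src t)
    {L ρ : ℕ} (hL : 1 ≤ L) {i : ℕ} (hi : 1 ≤ i) (hit : i ≤ T.dep t - L) :
    min (T.via L ρ t i) (T.far L ρ t i) = T.val t (T.anc t i) := by
  have h1 := h.val_le_far (ρ := ρ) ht hL hi hit
  by_cases hlt : T.val t (T.anc t i) < T.via L ρ t i
  · have := T.far_le hi le_rfl hit hlt
    omega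
  · have hge : T.via L ρ t i ≤ T.val t (T.anc t i) := not_lt.1 hlt
    have hle : T.val t (T.anc t i) ≤ T.via L ρ t i := by
      rw [h.via_eq ht L ρ hi (by omega), h.val_vtx t t hi (by omega)]
      refine encDist_le_encDist h.fits_zero ?_
      have := Nat.mod_lt (T.dep t - ρ) hL
      have := (h.geodesic ht).avoidDist_le_add (h.failsAt hi (by omega))
        (show i < T.dep t - (T.dep t - ρ) % L by omega) (Nat.sub_le _ _)
      rwa [vtx_dep] at this
    omega

/-- The changes of `far` are breakpoints in the sense of `Geodesic.card_sq_le`. An unreachable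
vertex has depth `0`, and its array is constant. -/
theorem changes_sq_le (h : T.Models G wt par fe fv) (t : Fin T.n) {L : ℕ} (hL : 1 ≤ L) (ρ N : ℕ) :
    changes (T.far L ρ t) N ^ 2 ≤ 40 * (T.n * T.M) := by
  have hmem : ∀ m ∈ (Finset.Ico 1 N).filter fun p => T.far L ρ t p ≠ T.far L ρ t (p - 1),
      1 ≤ m ∧ m ≤ T.dep t - L ∧ T.val t (T.anc t m) < T.via L ρ t m ∧
      T.val t (T.anc t m) < T.far L ρ t (m - 1) ∧ T.far L ρ t m = T.val t (T.anc t m) := by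
    intro m hm
    simp only [Finset.mem_filter, Finset.mem_Ico] at hm
    exact ⟨hm.1.1, T.far_change hm.1.1 hm.2⟩
  have hmod := Nat.mod_lt (T.dep t - ρ) hL
  by_cases ht : G.Reachable T.src t
  · have := (h.geodesic ht).card_sq_le T.hM h.le_M (Fe := fun m => fe (T.vtx t m))
      (Fv := fun m => fv (T.vtx t m)) (a := T.dep t - (T.dep t - ρ) % L)
      (B := (Finset.Ico 1 N).filter fun p => T.far L ρ t p ≠ T.far L ρ t (p - 1))
      (Nat.sub_le _ _) (fun m hm => ?_) (fun m hm => ?_) (fun m hm => ?_)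
      (fun m hm m' hm' hlt => ?_)
    · rwa [Fintype.card_fin] at this
    · obtain ⟨h1, h2, -⟩ := hmem m hm
      exact h.failsAt h1 (by omega)
    · obtain ⟨h1, h2, -⟩ := hmem m hm
      omega
    · obtain ⟨h1, h2, h3, -⟩ := hmem m hm
      exact (h.val_lt_via_iff ht L ρ h1 (by omega)).1 h3
    · obtain ⟨h1, h2, h3, h4, h5⟩ := hmem m hm
      obtain ⟨k1, k2, k3, k4, k5⟩ := hmem m' hm'
      -- The value at `m'` undercuts the running minimum just before it, which is at most the value
      -- recorded at `m`.
      have h6 := k4.trans_le (T.far_antitone (show m ≤ m' - 1 by omega))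
      rw [h5, h.val_vtx t t h1 (by omega), h.val_vtx t t k1 (by omega),
        encDist_lt_iff h.fits_zero h.fits_zero] at h6
      rwa [vtx_dep]
  · have hd := h.dep_of_par_none (h.tree.par_eq_none ht)
    have : changes (T.far L ρ t) N = 0 := by
      rw [changes, Finset.card_eq_zero, Finset.eq_empty_iff_forall_notMem]
      intro m hm
      obtain ⟨h1, h2, -⟩ := hmem m hm
      omega
    simp [this]

/-- An edge with lower endpoint `v` can lie on the tree path only if `v` does, so the tree path
survives. The alternative `fe v = ∅` serves a failing vertex that has no parent. -/
theorem avoids_of_not_ancestor (h : T.Models G wt par fe fv) {t v : Fin T.n}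
    (hfe : fe v = ∅ ∨ ∃ u, par v = some u) (hv : ∀ i ≤ T.dep t, T.vtx t i ≠ v) :
    avoidDist G wt (fe v) (fv v) T.src t = sdist G wt T.src t := by
  refine h.avoidDist_eq_sdist fun p hp _ => ?_
  have hvp : v ∉ p.support := fun hc => by
    obtain ⟨i, hi, he⟩ := hp v hc
    exact hv i hi he.symm
  refine ⟨fun e he hef => ?_, fun x hx hxf => ?_⟩
  · rcases hfe with hfe | ⟨u, hu⟩
    · simp [hfe] at hef
    · rw [h.edge v u hu hef] at he
      exact hvp (p.snd_mem_support_of_mem_edges he)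
  · rw [h.vertex v hxf] at hx
    exact hvp hx

theorem ne_vtx_of_dep {t v : Fin T.n} (h : T.dep t < T.dep v ∨ T.anc t (T.dep v) ≠ v) :
    ∀ i ≤ T.dep t, T.vtx t i ≠ v := by
  rintro i hi rfl
  have : T.dep (T.vtx t i) = i := T.dep_anc t.2 hi
  rw [this] at h
  exact h.elim (fun h => by omega) fun h => h rfl

theorem ans_eq (h : T.Models G wt par fe fv) {t u v : Fin T.n} (hv : par v = some u) {L : ℕ}
    (hL : 1 ≤ L) (ρ : ℕ) :
    T.ans L ρ t v = encDist w (avoidDist G wt (fe v) (fv v) T.src t) := by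
  have hdv := h.dep_of_par hv
  unfold ans
  split_ifs with h1 h2 h3
  · rw [h.avoids_of_not_ancestor (Or.inr ⟨u, hv⟩) (ne_vtx_of_dep (Or.inl h1)), h.dst_eq]
  · by_cases ht : G.Reachable T.src t
    · rw [h.min_via_far ht hL (by omega) (by omega), h2, h.val_eq t v u hv]
    · have := h.dep_of_par_none (h.tree.par_eq_none ht)
      omega
  · exact h.val_eq t v u hv
  · rw [h.avoids_of_not_ancestor (Or.inr ⟨u, hv⟩) (ne_vtx_of_dep (Or.inr h2)), h.dst_eq]

/-- Such a `v` is the source or unreachable. When the answer is computed from `via` and `far`, `t`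
has positive depth, hence is reachable, and `v` is the source: then the pivot stores `inf`, and
`far` is `inf` at depth `0`. Elsewhere the stored value or the plain distance is right. -/
theorem ans_eq_of_par_none (h : T.Models G wt par fe fv) {t v : Fin T.n} (hv : par v = none)
    (hfe : fe v = ∅) (hfv : v ∈ fv v) (hval : ∀ t : Fin T.n, T.val t v =
      encDist w (avoidDist G wt (fe v) (fv v) T.src t)) {L : ℕ} (hL : 1 ≤ L)
    (ρ : ℕ) :
    T.ans L ρ t v = encDist w (avoidDist G wt (fe v) (fv v) T.src t) := by
  have hdv := h.dep_of_par_none hv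
  unfold ans
  split_ifs with h1 h2 h3
  · omega
  · rw [hdv] at h2
    have htop : ∀ x : Fin T.n, T.vtx t 0 = v → G.Reachable T.src t →
        avoidDist G wt (fe v) (fv v) T.src x = ⊤ := by
      rintro x h0 ht
      rw [h.vtx_zero ht] at h0
      subst h0
      exact iInf₂_eq_top.2 fun p hp => (hp.2 _ p.start_mem_support hfv).elim
    by_cases ht : G.Reachable T.src t
    · have hvia : T.via L ρ t (T.dep v) = T.inf := by
        have : T.val (T.piv L ρ t) (T.anc t (T.dep v)) = T.inf := by
          rw [hdv, h2]
          refine (hval (T.vtx t (T.dep t - (T.dep t - ρ) % L))).trans ?_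
          rw [htop _ (Fin.ext h2) ht, encDist_top]
          rfl
        unfold via
        rw [if_pos this]
      rw [hvia, hdv, htop _ (Fin.ext h2) ht, encDist_top]
      exact min_self _
    · have := h.dep_of_par_none (h.tree.par_eq_none ht)
      omega
  · exact hval t
  · rw [h.avoids_of_not_ancestor (Or.inl hfe) (ne_vtx_of_dep (Or.inr h2)), h.dst_eq]

end Models
end Inp
end SSDSO

namespace SSDSO

/-! ### The space -/

theorem spaceBound_nonneg (n M : ℕ) : 0 ≤ spaceBound n M := by
  unfold spaceBound
  positivity

namespace Inp

variable {w : ℕ} {O : Oracle} {T : Inp w O}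

/-- The choice of `r` balances the stored blocks, `r * K`, against the directory, `n / r ^ 2`. The
square of the left side is at most `40 * n ^ 2`, and `40 ≤ 7 ^ 2`. -/
theorem cube_mul_le {n M r K : ℕ} (hn : 1 ≤ n) (hr : r = 1 ∨ r ^ 6 * M ≤ n) (hK : K ≤ n)
    (hK2 : K ^ 2 ≤ 40 * (n * M)) : r ^ 3 * K ≤ 7 * n := by
  rcases hr with rfl | hr
  · omega
  · refine (Nat.pow_le_pow_iff_left two_ne_zero).1 ?_
    calc (r ^ 3 * K) ^ 2 = r ^ 6 * K ^ 2 := by ring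
      _ ≤ r ^ 6 * (40 * (n * M)) := Nat.mul_le_mul_left _ hK2
      _ = 40 * n * (r ^ 6 * M) := by ring
      _ ≤ 40 * n * n := Nat.mul_le_mul_left _ hr
      _ ≤ (7 * n) ^ 2 := by nlinarith

/-- After multiplication by `r₀ ^ 2` each contribution is quadratic in `n`: the near tables because
`r₀ ^ 4 ≤ n`, the rows of the pivots because `ρ` is least frequent, the compressed arrays by
`cube_mul_le`. -/
theorem Result.total_mul_le {r₀ ρ lim : ℕ} {mem : ℕ → ℕ} (h : T.Result r₀ ρ lim mem)
    (hch : ∀ t < T.n, ∀ N, changes (T.far (r₀ * r₀) ρ t) N ^ 2 ≤ 40 * (T.n * T.M)) :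
    T.total r₀ ρ T.n * r₀ ^ 2 ≤ 100 * T.n ^ 2 := by
  have hn := T.n_pos
  obtain ⟨hr1, hrr, hN1, hN, hN', hN''⟩ := h.params.bounds
  have hle := h.params.le
  have hr := h.params.pos
  have hpow : r₀ ^ 4 ≤ T.n := by
    rcases h.small with hs | hs
    · rw [hs, one_pow]
      exact hn
    · calc r₀ ^ 4 ≤ r₀ ^ 6 := Nat.pow_le_pow_right hr (by norm_num)
        _ ≤ r₀ ^ 6 * T.M := Nat.le_mul_of_pos_right _ T.hM
        _ ≤ T.n := hs
  have hpow' : r₀ ^ 3 ≤ T.n := (Nat.pow_le_pow_right hr (by norm_num)).trans hpow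
  have htable : ∑ t ∈ Finset.range T.n, T.tableCost r₀ ρ t =
      T.n * (2 * (r₀ * r₀)) + T.count (r₀ * r₀) T.n ρ * (2 * T.n) := by
    unfold tableCost
    rw [Inp.count, Finset.sum_add_distrib, Finset.sum_const, Finset.card_range, smul_eq_mul,
      ← Finset.sum_filter, Finset.sum_const, smul_eq_mul]
  have hfar : ∀ t ∈ Finset.range T.n, T.farCost r₀ ρ t * r₀ ^ 2 ≤ 50 * T.n := by
    intro t ht
    rw [Finset.mem_range] at ht
    have h1 := cube_mul_le hn h.small (T.changes_far_le (L := r₀ * r₀) (ρ := ρ) ht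
      (r₀ * r₀ * T.quo r₀)) (hch t ht _)
    unfold farCost
    generalize changes (T.far (r₀ * r₀) ρ t) (r₀ * r₀ * T.quo r₀) = K at h1
    calc (T.quo r₀ + r₀ * (6 * K + 4)) * r₀ ^ 2
        = r₀ * r₀ * T.quo r₀ + 6 * (r₀ ^ 3 * K) + 4 * r₀ ^ 3 := by ring
      _ ≤ 50 * T.n := by omega
  have hfar' : (∑ t ∈ Finset.range T.n, T.farCost r₀ ρ t) * r₀ ^ 2 ≤ T.n * (50 * T.n) := by
    rw [Finset.sum_mul]
    refine (Finset.sum_le_sum hfar).trans ?_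
    simp
  have hbase : T.base * r₀ ^ 2 ≤ 16 * T.n * T.n :=
    Nat.mul_le_mul (by unfold base; omega) (by rw [pow_two]; exact hle)
  have h1 : T.n * r₀ ^ 4 ≤ T.n * T.n := Nat.mul_le_mul_left _ hpow
  have h2 : T.n * (r₀ * r₀ * T.count (r₀ * r₀) T.n ρ) ≤ T.n * T.n :=
    Nat.mul_le_mul_left _ h.count
  unfold total
  rw [Finset.sum_add_distrib, htable]
  generalize (∑ t ∈ Finset.range T.n, T.farCost r₀ ρ t) = F at hfar' ⊢
  generalize T.count (r₀ * r₀) T.n ρ = c at h2 ⊢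
  nlinarith

/-- Maximality of `r` gives `n ≤ (2 * r) ^ 6 * M`, so the cube root of `n` is at most `4 * r ^ 2`
times that of `M`. Thus `n ^ 2 / r ^ 2` is at most four times the first term of the minimum; the
second term only needs `r ≥ 1`. -/
theorem le_spaceBound {n M r S : ℕ} (hr : 1 ≤ r) (hn : 1 ≤ n) (hlt : n < (r + 1) ^ 6 * M)
    (hS : S * r ^ 2 ≤ 100 * n ^ 2) : (S : ℝ) ≤ 400 * spaceBound n M := by
  have hS' : (S : ℝ) * r ^ 2 ≤ 100 * n ^ 2 := by exact_mod_cast hS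
  have hr' : (1 : ℝ) ≤ r := by exact_mod_cast hr
  have hn' : (0 : ℝ) < n := by exact_mod_cast hn
  have hr2 : (1 : ℝ) ≤ (r : ℝ) ^ 2 := one_le_pow₀ hr'
  unfold spaceBound
  rw [mul_min_of_nonneg _ _ (by norm_num)]
  refine le_min ?_ ?_
  · have h1 : (n : ℝ) ≤ (4 * (r : ℝ) ^ 2) ^ (3 : ℕ) * M := by
      have : n ≤ (4 * r ^ 2) ^ 3 * M := hlt.le.trans (Nat.mul_le_mul_right _ (by
        calc (r + 1) ^ 6 ≤ (2 * r) ^ 6 := Nat.pow_le_pow_left (by omega) 6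
          _ = (4 * r ^ 2) ^ 3 := by ring))
      exact_mod_cast this
    have h2 : (n : ℝ) ^ (1 / 3 : ℝ) ≤ 4 * (r : ℝ) ^ 2 * (M : ℝ) ^ (1 / 3 : ℝ) := by
      refine (Real.rpow_le_rpow hn'.le h1 (by norm_num)).trans ?_
      rw [Real.mul_rpow (by positivity) (by positivity), ← Real.rpow_natCast,
        ← Real.rpow_mul (by positivity)]
      norm_num
    have h3 : (n : ℝ) ^ (5 / 3 : ℝ) * (n : ℝ) ^ (1 / 3 : ℝ) = (n : ℝ) ^ 2 := by
      rw [← Real.rpow_add hn', ← Real.rpow_natCast]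
      norm_num
    have h4 : (0 : ℝ) < (n : ℝ) ^ (1 / 3 : ℝ) := Real.rpow_pos_of_pos hn' _
    refine le_of_mul_le_mul_right ?_ h4
    calc (S : ℝ) * (n : ℝ) ^ (1 / 3 : ℝ)
        ≤ S * (4 * (r : ℝ) ^ 2 * (M : ℝ) ^ (1 / 3 : ℝ)) :=
          mul_le_mul_of_nonneg_left h2 (Nat.cast_nonneg _)
      _ = 4 * (M : ℝ) ^ (1 / 3 : ℝ) * (S * (r : ℝ) ^ 2) := by ring
      _ ≤ 4 * (M : ℝ) ^ (1 / 3 : ℝ) * (100 * n ^ 2) :=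
          mul_le_mul_of_nonneg_left hS' (by positivity)
      _ = 400 * ((M : ℝ) ^ (1 / 3 : ℝ) * (n : ℝ) ^ (5 / 3 : ℝ)) * (n : ℝ) ^ (1 / 3 : ℝ) := by
          rw [← h3]; ring
  · nlinarith [Nat.cast_nonneg (α := ℝ) S]

theorem Result.le_spaceBound {r₀ ρ lim : ℕ} {mem : ℕ → ℕ} (h : T.Result r₀ ρ lim mem)
    (hch : ∀ t < T.n, ∀ N, changes (T.far (r₀ * r₀) ρ t) N ^ 2 ≤ 40 * (T.n * T.M)) :
    (lim : ℝ) ≤ 400 * spaceBound T.n T.M :=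
  (Nat.cast_le.2 h.le_total).trans
    (Inp.le_spaceBound h.params.pos T.n_pos h.large (h.total_mul_le hch))

end Inp

/-! ### The input -/

section Input

variable {w n M : ℕ} {O : Oracle} {G : SimpleGraph (Fin n)} {wt : Sym2 (Fin n) → ℕ} {s : Fin n}
  {par : Fin n → Option (Fin n)}

theorem parentAnswer_le (c : Fin n) : parentAnswer par c ≤ n := by
  unfold parentAnswer
  rw [dif_pos c.2]
  rcases par c with _ | u
  · simp
  · simp

theorem parentAnswer_eq (c : Fin n) : parentAnswer par c = (par c).elim n Fin.val := by
  simp [parentAnswer]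

theorem weightAnswer_le (hM : ∀ e ∈ G.edgeSet, wt e ≤ M) (h : IsShortestPathTree G wt s par)
    (c : Fin n) : weightAnswer wt par c ≤ M := by
  unfold weightAnswer
  rw [dif_pos c.2]
  rcases hc : par c with _ | u
  · simp
  · simpa using hM _ ((SimpleGraph.mem_edgeSet _).2 (h.adj c u hc))

theorem encDist_avoidDist (hM : ∀ e ∈ G.edgeSet, wt e ≤ M) (Fe : Set (Sym2 (Fin n)))
    (Fv : Set (Fin n)) (t : Fin n) : encDist w (avoidDist G wt Fe Fv s t) = 2 ^ w - 1 ∨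
      encDist w (avoidDist G wt Fe Fv s t) ≤ n * M := by
  by_cases h : avoidDist G wt Fe Fv s t = ⊤
  · exact Or.inl (by rw [h, encDist_top])
  · have := avoidDist_le_card_mul hM h
    rw [Fintype.card_fin] at this
    obtain ⟨a, ha⟩ := ENat.ne_top_iff_exists.1 h
    rw [← ha] at this ⊢
    exact Or.inr (by rw [encDist_coe]; exact_mod_cast this)

/-- The numerical input given by a shortest path tree. -/
theorem exists_inp (hM1 : 1 ≤ M) (hwt : ∀ e ∈ G.edgeSet, 1 ≤ wt e ∧ wt e ≤ M)
    (htree : IsShortestPathTree G wt s par) (hbig : (n + M + 1) ^ 20 ≤ 2 ^ w)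
    (hpar : ∀ c b, O .parent c b = parentAnswer par c)
    (hwgt : ∀ c b, O .weight c b = weightAnswer wt par c)
    (hval : ∀ t < n, ∀ c < n, O .replDist t c = 2 ^ w - 1 ∨ O .replDist t c ≤ n * M) :
    ∃ T : Inp w O, T.n = n ∧ T.M = M ∧ T.s = s ∧ T.val = O .replDist ∧
      (∀ c : Fin n, T.par c = (par c).elim n Fin.val) ∧
      ∀ c : Fin n, T.len c = (sdist G wt s c).toNat := by
  obtain ⟨dep, hd1, hd2, hd3⟩ := htree.exists_depth fun e he => (hwt e he).1
  have hle : n + M + 1 ≤ 2 ^ w := (Nat.le_self_pow (by norm_num) _).trans hbig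
  have hmul : n * M < 2 ^ w := by
    refine lt_of_lt_of_le ?_ ((Nat.pow_le_pow_right (by omega) (by norm_num : 2 ≤ 20)).trans hbig)
    nlinarith
  have hcases : ∀ c : Fin n, par c = none ∧ parentAnswer par c = n ∨
      ∃ u, par c = some u ∧ parentAnswer par c = u := fun c => by
    rw [parentAnswer_eq]
    rcases hc : par c with _ | u <;> simp
  refine ⟨{
    n := n, M := M, s := s, par := parentAnswer par, wgt := weightAnswer wt par
    val := O .replDist
    dep := fun c => if h : c < n then dep ⟨c, h⟩ else 0
    len := fun c => if h : c < n then (sdist G wt s ⟨c, h⟩).toNat else 0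
    hM := hM1, hs := s.2, big := hbig
    ask_par := fun c hc b => ?_, ask_wgt := fun c hc b => ?_, ask_val := fun t ht c hc => ?_
    par_le := fun c hc => parentAnswer_le ⟨c, hc⟩
    dep_lt := fun c hc => ?_, dep_zero := fun c hc h => ?_, dep_succ := fun c hc h => ?_
    len_zero := fun c hc h => ?_, len_succ := fun c hc h => ?_, len_le := fun c hc => ?_
    val_le := hval }, rfl, rfl, rfl, rfl, parentAnswer_eq, fun c => by simp⟩
  · rw [hpar, Nat.mod_eq_of_lt]
    have := parentAnswer_le (par := par) ⟨c, hc⟩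
    simp only at this
    omega
  · rw [hwgt, Nat.mod_eq_of_lt]
    have := weightAnswer_le (fun e he => (hwt e he).2) htree ⟨c, hc⟩
    simp only at this
    omega
  · rw [Nat.mod_eq_of_lt]
    have := hval t ht c hc
    omega
  · rw [dif_pos hc]
    exact hd1 _
  · rcases hcases ⟨c, hc⟩ with ⟨h1, -⟩ | ⟨u, -, h2⟩
    · rw [dif_pos hc, hd2 _ h1]
    · have := u.2
      simp only at h2
      omega
  · rcases hcases ⟨c, hc⟩ with ⟨-, h1⟩ | ⟨u, h1, h2⟩
    · simp only at h1
      omega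
    · simp only at h2
      rw [dif_pos hc, hd3 _ u h1]
      simp [h2]
  · rcases hcases ⟨c, hc⟩ with ⟨h1, -⟩ | ⟨u, -, h2⟩
    · rw [dif_pos hc]
      by_cases hr : G.Reachable s ⟨c, hc⟩
      · rw [htree.eq_root hr h1, sdist_self]
        rfl
      · rw [sdist_eq_top hr]
        rfl
    · have := u.2
      simp only at h2
      omega
  · rcases hcases ⟨c, hc⟩ with ⟨-, h1⟩ | ⟨u, h1, h2⟩
    · simp only at h1
      omega
    · simp only at h2
      have : weightAnswer wt par c = wt s(u, ⟨c, hc⟩) := by simp [weightAnswer, hc, h1]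
      rw [dif_pos hc, htree.toNat_sdist_succ h1, this]
      simp [h2]
  · rw [dif_pos hc]
    simpa using toNat_sdist_le (fun e he => (hwt e he).2) s (⟨c, hc⟩ : Fin n)

end Input

/-! ### The oracles -/

namespace Inp

variable {w : ℕ} {O : Oracle} {T : Inp w O}

theorem Result.represents_init {r₀ ρ : ℕ} {σ : State} (h : T.Result r₀ ρ (σ.reg 0) σ.mem)
    (args : List ℕ) : T.Represents r₀ ρ (σ.reg 0) (State.init args σ.output).mem :=
  h.represents fun a ha => by simp [State.init, State.output, ha]

namespace Models

variable {G : SimpleGraph (Fin T.n)} {wt : Sym2 (Fin T.n) → ℕ}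
  {par : Fin T.n → Option (Fin T.n)} {fe : Fin T.n → Set (Sym2 (Fin T.n))}
  {fv : Fin T.n → Set (Fin T.n)}

theorem edge_dso (h : T.Models G wt par fe fv) (hfe : ∀ c u, par c = some u → fe c = {s(u, c)})
    (hfv : ∀ c, fv c = ∅) : ∃ σ t, Exec w O preprocess (.init [T.n, T.M, T.s] []) σ t ∧
      t ≤ 5000 * T.n ^ 2 ∧ (σ.output.length : ℝ) ≤ 400 * spaceBound T.n T.M ∧
      ∀ t u v : Fin T.n, ∃ τ t', Exec w noOracle edgeLookup
        (.init [t.val, u.val, v.val] σ.output) τ t' ∧ t' ≤ 300 ∧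
        τ.reg 0 = encDist w (edgeReplDist G wt T.src t s(u, v)) := by
  obtain ⟨σ, t, r₀, ρ, hexec, htime, hres⟩ := T.preprocess_spec
  have hL := hres.params.bounds.1
  refine ⟨σ, t, hexec, htime, ?_, fun t u v => ?_⟩
  · have := hres.le_spaceBound fun t ht N => h.changes_sq_le ⟨t, ht⟩ hL ρ N
    simpa [State.output] using this
  · have hspec : wp w noOracle edgeLookup (.init [t.val, u.val, v.val] σ.output) 0 fun τ t' =>
        t' ≤ 300 ∧ τ.reg 0 = encDist w (edgeReplDist G wt T.src t s(u, v)) := by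
      refine T.edgeLookup_spec t.2 u.2 v.2 (hres.represents_init _) rfl rfl rfl fun τ x hx ht => ?_
      refine ⟨by omega, ?_⟩
      rw [hx, edgeReplDist_eq]
      split_ifs with h1 h2
      · rw [h.par_eq_iff] at h1
        rw [h.ans_eq h1 hL, hfe _ _ h1, hfv]
      · rw [h.par_eq_iff] at h2
        rw [h.ans_eq h2 hL, hfe _ _ h2, hfv, Sym2.eq_swap]
      -- Every edge of the tree path joins a vertex to its parent, so one that equals `s(u, v)`
      -- would contradict `h1` or `h2`.
      · rw [h.par_eq_iff] at h1 h2
        rw [h.dst_eq, h.avoidDist_eq_sdist fun p _ hp => ⟨fun e he hef => ?_, by simp⟩]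
        obtain ⟨x, y, hxy, rfl⟩ := hp e he
        rcases Sym2.eq_iff.1 hef with ⟨rfl, rfl⟩ | ⟨rfl, rfl⟩
        · exact h1 hxy
        · exact h2 hxy
    obtain ⟨τ, τ', t', he, hs, ht, hr⟩ := hspec _ (State.Sim.refl _)
    exact ⟨τ, t', he, by omega, (hs.2 0 (by norm_num)).trans hr⟩

theorem vertex_dso (h : T.Models G wt par fe fv) (hfe : ∀ c, fe c = ∅) (hfv : ∀ c, fv c = {c})
    (hval : ∀ t v : Fin T.n, T.val t v = encDist w (vertexReplDist G wt T.src t v)) :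
    ∃ σ t, Exec w O preprocess (.init [T.n, T.M, T.s] []) σ t ∧
      t ≤ 5000 * T.n ^ 2 ∧ (σ.output.length : ℝ) ≤ 400 * spaceBound T.n T.M ∧
      ∀ t v : Fin T.n, ∃ τ t', Exec w noOracle lookup (.init [t.val, v.val] σ.output) τ t' ∧
        t' ≤ 300 ∧ τ.reg 0 = encDist w (vertexReplDist G wt T.src t v) := by
  obtain ⟨σ, t, r₀, ρ, hexec, htime, hres⟩ := T.preprocess_spec
  have hL := hres.params.bounds.1
  refine ⟨σ, t, hexec, htime, ?_, fun t v => ?_⟩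
  · have := hres.le_spaceBound fun t ht N => h.changes_sq_le ⟨t, ht⟩ hL ρ N
    simpa [State.output] using this
  · have hspec : wp w noOracle lookup (.init [t.val, v.val] σ.output) 0 fun τ t' =>
        t' ≤ 300 ∧ τ.reg 0 = encDist w (vertexReplDist G wt T.src t v) := by
      refine T.lookup_spec t.2 v.2 (hres.represents_init _) rfl rfl fun τ x hx ht => ?_
      refine ⟨by omega, ?_⟩
      rw [hx, vertexReplDist_eq, ← hfe v, ← hfv v]
      rcases hv : par v with _ | u
      · refine h.ans_eq_of_par_none hv (hfe v) (by simp [hfv]) (fun t => ?_) hL ρ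
        rw [hval, vertexReplDist_eq, hfe, hfv]
      · exact h.ans_eq hv hL ρ
    obtain ⟨τ, τ', t', he, hs, ht, hr⟩ := hspec _ (State.Sim.refl _)
    exact ⟨τ, t', he, by omega, (hs.2 0 (by norm_num)).trans hr⟩

end Models
end Inp

/-! ### The data structures obtained from the oracles -/

section DSO

variable {w n M : ℕ} {O : Oracle} {G : SimpleGraph (Fin n)} {wt : Sym2 (Fin n) → ℕ} {s : Fin n}
  {par : Fin n → Option (Fin n)}

theorem exists_edge_dso (hM1 : 1 ≤ M) (hwt : ∀ e ∈ G.edgeSet, 1 ≤ wt e ∧ wt e ≤ M)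
    (htree : IsShortestPathTree G wt s par) (hbig : (n + M + 1) ^ 20 ≤ 2 ^ w)
    (hpar : ∀ c b, O .parent c b = parentAnswer par c)
    (hwgt : ∀ c b, O .weight c b = weightAnswer wt par c)
    (hval : ∀ t c : Fin n, O .replDist t c =
      (par c).elim 0 fun u => encDist w (edgeReplDist G wt s t s(u, c))) :
    ∃ σ t, Exec w O preprocess (.init [n, M, s.val] []) σ t ∧
      t ≤ 5000 * n ^ 2 ∧ (σ.output.length : ℝ) ≤ 400 * spaceBound n M ∧
      ∀ t u v : Fin n, ∃ τ t', Exec w noOracle edgeLookup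
        (.init [t.val, u.val, v.val] σ.output) τ t' ∧ t' ≤ 300 ∧
        τ.reg 0 = encDist w (edgeReplDist G wt s t s(u, v)) := by
  obtain ⟨T, rfl, rfl, hs, hT, hTpar, hTlen⟩ := exists_inp hM1 hwt htree hbig hpar hwgt
    fun t ht c hc => by
      have := hval ⟨t, ht⟩ ⟨c, hc⟩
      simp only at this
      rw [this]
      rcases par ⟨c, hc⟩ with _ | u
      · simp
      · simp only [Option.elim_some, edgeReplDist_eq]
        exact encDist_avoidDist (fun e he => (hwt e he).2) _ _ _
  obtain rfl : s = T.src := Fin.ext hs.symm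
  have h : T.Models G wt par (fun c => (par c).elim ∅ fun u => {s(u, c)}) fun _ => ∅ := {
    one_le := fun e he => (hwt e he).1
    le_M := fun e he => (hwt e he).2
    tree := htree
    par_eq := hTpar
    len_eq := hTlen
    edge := fun c u hu => by simp [hu]
    vertex := fun c => by simp
    val_eq := fun t c u hu => by
      rw [hT, hval]
      simp [hu, edgeReplDist_eq] }
  exact h.edge_dso (fun c u hu => by simp [hu]) fun _ => rfl

theorem exists_vertex_dso (hM1 : 1 ≤ M) (hwt : ∀ e ∈ G.edgeSet, 1 ≤ wt e ∧ wt e ≤ M)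
    (htree : IsShortestPathTree G wt s par) (hbig : (n + M + 1) ^ 20 ≤ 2 ^ w)
    (hpar : ∀ c b, O .parent c b = parentAnswer par c)
    (hwgt : ∀ c b, O .weight c b = weightAnswer wt par c)
    (hval : ∀ t c : Fin n, O .replDist t c = encDist w (vertexReplDist G wt s t c)) :
    ∃ σ t, Exec w O preprocess (.init [n, M, s.val] []) σ t ∧
      t ≤ 5000 * n ^ 2 ∧ (σ.output.length : ℝ) ≤ 400 * spaceBound n M ∧
      ∀ t v : Fin n, ∃ τ t', Exec w noOracle lookup (.init [t.val, v.val] σ.output) τ t' ∧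
        t' ≤ 300 ∧ τ.reg 0 = encDist w (vertexReplDist G wt s t v) := by
  obtain ⟨T, rfl, rfl, hs, hT, hTpar, hTlen⟩ := exists_inp hM1 hwt htree hbig hpar hwgt
    fun t ht c hc => by
      have := hval ⟨t, ht⟩ ⟨c, hc⟩
      simp only at this
      rw [this, vertexReplDist_eq]
      exact encDist_avoidDist (fun e he => (hwt e he).2) _ _ _
  obtain rfl : s = T.src := Fin.ext hs.symm
  have h : T.Models G wt par (fun _ => ∅) fun c => {c} := {
    one_le := fun e he => (hwt e he).1
    le_M := fun e he => (hwt e he).2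
    tree := htree
    par_eq := hTpar
    len_eq := hTlen
    edge := fun c u hu => by simp
    vertex := fun c => le_rfl
    val_eq := fun t c u hu => by rw [hT, hval, vertexReplDist_eq] }
  exact h.vertex_dso (fun _ => rfl) (fun _ => rfl) fun t v => by rw [hT, hval]

end DSO

end SSDSO

theorem mainTheorem7 :
    -- edge failures
    (∃ (pre query : SSDSO.Prog) (k C : ℕ),
      ∀ (n M w : ℕ) (G : SimpleGraph (Fin n)) (wt : Sym2 (Fin n) → ℕ) (s : Fin n)
        (par : Fin n → Option (Fin n)),
        1 ≤ M →
        (∀ e ∈ G.edgeSet, 1 ≤ wt e ∧ wt e ≤ M) →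
        SSDSO.IsShortestPathTree G wt s par →
        (n + M + 1) ^ k ≤ 2 ^ w →
        ∃ (σ : SSDSO.State) (T : ℕ),
          SSDSO.Exec w (SSDSO.edgeOracle w G wt s par) pre
            (SSDSO.State.init [n, M, s.val] []) σ T ∧
          T ≤ C * n ^ 2 ∧
          (σ.output.length : ℝ) ≤ C * SSDSO.spaceBound n M ∧
          ∀ t u v : Fin n, G.Adj u v →
            ∃ (τ : SSDSO.State) (T' : ℕ),
              SSDSO.Exec w SSDSO.noOracle query
                (SSDSO.State.init [t.val, u.val, v.val] σ.output) τ T' ∧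
              T' ≤ C ∧
              τ.reg 0 = SSDSO.encDist w (SSDSO.edgeReplDist G wt s t s(u, v))) ∧
    -- vertex failures
    (∃ (pre query : SSDSO.Prog) (k C : ℕ),
      ∀ (n M w : ℕ) (G : SimpleGraph (Fin n)) (wt : Sym2 (Fin n) → ℕ) (s : Fin n)
        (par : Fin n → Option (Fin n)),
        1 ≤ M →
        (∀ e ∈ G.edgeSet, 1 ≤ wt e ∧ wt e ≤ M) →
        SSDSO.IsShortestPathTree G wt s par →
        (n + M + 1) ^ k ≤ 2 ^ w →
        ∃ (σ : SSDSO.State) (T : ℕ),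
          SSDSO.Exec w (SSDSO.vertexOracle w G wt s par) pre
            (SSDSO.State.init [n, M, s.val] []) σ T ∧
          T ≤ C * n ^ 2 ∧
          (σ.output.length : ℝ) ≤ C * SSDSO.spaceBound n M ∧
          ∀ t v : Fin n,
            ∃ (τ : SSDSO.State) (T' : ℕ),
              SSDSO.Exec w SSDSO.noOracle query
                (SSDSO.State.init [t.val, v.val] σ.output) τ T' ∧
              T' ≤ C ∧
              τ.reg 0 = SSDSO.encDist w (SSDSO.vertexReplDist G wt s t v)) := by
  -- `20` is the exponent in `Inp.big`; `5000` is the constant of the preprocessing time and also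
  -- covers `400` for the space and `300` for a query.
  refine ⟨⟨SSDSO.preprocess, SSDSO.edgeLookup, 20, 5000, ?_⟩,
    ⟨SSDSO.preprocess, SSDSO.lookup, 20, 5000, ?_⟩⟩
  · intro n M w G wt s par hM hwt htree hbig
    obtain ⟨σ, T, h1, h2, h3, h4⟩ := SSDSO.exists_edge_dso hM hwt htree hbig
      (O := SSDSO.edgeOracle w G wt s par) (fun _ _ => rfl) (fun _ _ => rfl)
      fun t c => by simp [SSDSO.edgeOracle]
    refine ⟨σ, T, h1, h2, h3.trans ?_, fun t u v _ => ?_⟩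
    · have : 0 ≤ SSDSO.spaceBound n M := SSDSO.spaceBound_nonneg n M
      push_cast
      linarith
    · obtain ⟨τ, T', k1, k2, k3⟩ := h4 t u v
      exact ⟨τ, T', k1, by omega, k3⟩
  · intro n M w G wt s par hM hwt htree hbig
    obtain ⟨σ, T, h1, h2, h3, h4⟩ := SSDSO.exists_vertex_dso hM hwt htree hbig
      (O := SSDSO.vertexOracle w G wt s par) (fun _ _ => rfl) (fun _ _ => rfl)
      fun t c => by simp [SSDSO.vertexOracle]
    refine ⟨σ, T, h1, h2, h3.trans ?_, fun t v => ?_⟩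
    · have : 0 ≤ SSDSO.spaceBound n M := SSDSO.spaceBound_nonneg n M
      push_cast
      linarith
    · obtain ⟨τ, T', k1, k2, k3⟩ := h4 t v
      exact ⟨τ, T', k1, by omega, k3⟩
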